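/- **Setting.** Let $\mathfrak g=\mathfrak g_{\bar0}\oplus\mathfrak g_{\bar1}$, $\mathfrak g_{\bar1}\neq0$, be a finite-dimensional basic classical Lie superalgebra over $\mathbb C$: $\mathfrak g$ is simple, $\mathfrak g_{\bar0}$ is reductive and acts completely reducibly on $\mathfrak g_{\bar1}$, and $\mathfrak g$ carries a nondegenerate consistent supersymmetric invariant bilinear form $B$, which we fix. Write $\mathfrak g_{\bar0}=\mathfrak g_{\bar0}^0\oplus\mathfrak g_{\bar0}^1\oplus\dots\oplus\mathfrak g_{\bar0}^r$ with $\mathfrak g_{\bar0}^0$ the centre and $\mathfrak g_{\bar0}^i$ simple for $i\ge1$, and let $B_i=B|_{\mathfrak g_{\bar0}^i}$ (nondegenerate). Let $\mathfrak h\subset\mathfrak g_{\bar0}$ be a Cartan subalgebra, $\Delta=\Delta_{\bar0}\cup\Delta_{\bar1}$ the roots of $\mathfrak g$, $\mathfrak h_{\mathbb R}^*\subset\mathfrak h^*$ the real span of $\Delta$, $\Delta_{\bar0}^+$ a positive system in $\Delta_{\bar0}$, $\mathfrak n_{\bar0}^{\pm}$ the sums of the root spaces of $\mathfrak g_{\bar0}$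 for the roots in $\pm\Delta_{\bar0}^+$, and $\rho_{\bar0}=\frac12\sum_{\alpha\in\Delta_{\bar0}^+}\alpha$. Identify $\mathfrak h\cong\mathfrak h^*$ and $\mathfrak g_{\bar0}\cong\mathfrak g_{\bar0}^*$ via $B$; thus $\mathfrak h^*\subset\mathfrak g_{\bar0}^*$ (extension by zero on root spaces). Let $\mathrm{Ad}^*_{G_{\bar0}}$ be the coadjoint action of the connected simply connected Lie group $G_{\bar0}$ with Lie algebra $\mathfrak g_{\bar0}$ (its image in $\mathrm{GL}(\mathfrak g_{\bar0})$ under $\mathrm{Ad}$ is the group generated by all $e^{\mathrm{ad}\,x}$). **Operators.** For a Lie algebra $\mathfrak k$ with nondegenerate invariant symmetric form $B$, let $\mathrm{Cl}(\mathfrak k)$ be the Clifford algebra with $xy+yx=2B(x,y)$, $q:\bigwedge\mathfrak k\to\mathrm{Cl}(\mathfrak k)$ the quantization map, and, for a basis $(e_a)$ with $B$-dual basis $(e^a)$, $$\mathrm D_{\mathfrak k}=\sum_a e^a\otimes e_a+1\otimes q(\phi),\qquad \phi=-\tfrac1{12}\sum_{a,b,c}B([e_a,e_b],e_c)\,e^a\wedge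 e^b\wedge e^c,$$ in $\mathfrak U(\mathfrak k)\otimes\mathrm{Cl}(\mathfrak k)$. For $\eta\in\mathfrak k^*$ put $\mathrm D_{\mathfrak k}(\eta)=\mathrm D_{\mathfrak k}+1\otimes h_\eta$, where $B(h_\eta,\cdot)=\eta$, and $\Delta_{\mathfrak k}(\eta)=\mathrm D_{\mathfrak k}(\eta)^2$. For $\xi\in\mathfrak h_{\mathbb R}^*$ let $\Delta_i(\xi^i)=\Delta_{\mathfrak g_{\bar0}^i}(\xi^i)$ (formed with $B_i$), where $\xi^i$ is the restriction of $\xi$ to $\mathfrak g_{\bar0}^i$, regarded as an element of $\mathfrak U(\mathfrak g_{\bar0})\otimes\mathrm{Cl}(\mathfrak g_{\bar0})$. Let $\mathfrak p=\mathfrak n_{\bar0}^+\oplus\mathfrak n_{\bar0}^-$ and let $S=\bigwedge\mathfrak n_{\bar0}^-$ be the spin module of $\mathrm{Cl}(\mathfrak p)$: $\bar u\in\mathfrak n_{\bar0}^-$ acts by exterior multiplication and $u\in\mathfrak n_{\bar0}^+$ by $2\iota_u$, where $\iota_u$ is the contraction with $B(u,\cdot)$. **Theorem.** Let $L_0(\Lambda)$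 be a finite-dimensional simple $\mathfrak g_{\bar0}$-module with highest weight $\Lambda\in\mathfrak h_{\mathbb R}^*$, and fix Hermitian inner products on $L_0(\Lambda)$ and on $S$, and the induced one on $L_0(\Lambda)\otimes S$, with adjoints denoted $\dagger$. Let $\xi\in\mathfrak h_{\mathbb R}^*$. Each $\Delta_i(\xi^i)$ lies in the subalgebra $\mathfrak U(\mathfrak g_{\bar0})\otimes\mathrm{Cl}(\mathfrak p)$ and hence acts, by a uniquely determined operator, on $L_0(\Lambda)\otimes S$. Put $\widetilde\Delta_{\mathfrak g_{\bar0}}(\xi)=\sum_{i=0}^r\Delta_i(\xi^i)^\dagger\Delta_i(\xi^i)$ on $L_0(\Lambda)\otimes S$. Then: 1. If $\xi$ is antidominant, i.e. $2B(\xi,\alpha)/B(\alpha,\alpha)\le0$ for all $\alpha\in\Delta_{\bar0}^+$, then $\ker\widetilde\Delta_{\mathfrak g_{\bar0}}(\xi)=\{0\}$ unless $\xi=-\Lambda-\rho_{\bar0}$. 2. For every $\xi\in\mathfrak h_{\mathbb R}^*$, $$\ker\widetilde\Delta_{\mathfrak g_{\bar0}}(\xi)\neq\{0\}\iff\xi\in\mathrm{Ad}^*_{G_{\bar0}}(-\Lambda-\rho_{\bar0}).$$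 -/

import Mathlib

open scoped TensorProduct
open Module

noncomputable section

attribute [local instance 100] LieRing.ofAssociativeRing

namespace DiracFamily

/-- `(𝔨, B)` is a quadratic Lie algebra: `B` is symmetric, nondegenerate and invariant. -/
structure IsQuadratic {𝔨 : Type*} [LieRing 𝔨] [LieAlgebra ℂ 𝔨] (B : LinearMap.BilinForm ℂ 𝔨) :
    Prop where
  symm : ∀ a b, B a b = B b a
  nondegenerate : B.Nondegenerate
  invariant : ∀ a b c, B ⁅a, b⁆ c = B a ⁅b, c⁆

/-! ### Basic classical Lie superalgebras

A Lie superalgebra `𝔤 = 𝔤₀ ⊕ 𝔤₁` is given by its even part (a Lie algebra), its odd part (a module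
over the even part), and the bracket of two odd elements. -/

section Superalgebra

variable (𝔤₀ 𝔤₁ : Type*) [LieRing 𝔤₀] [LieAlgebra ℂ 𝔤₀]
  [AddCommGroup 𝔤₁] [Module ℂ 𝔤₁] [LieRingModule 𝔤₀ 𝔤₁] [LieModule ℂ 𝔤₀ 𝔤₁]

/-- A Lie superalgebra structure on `𝔤₀ ⊕ 𝔤₁`: the bracket `[x, y]` of odd elements, with the
super Jacobi identity for (even, odd, odd) and for (odd, odd, odd). The identities with at least
two even arguments are those of the Lie algebra `𝔤₀` and its module `𝔤₁`. -/
structure LieSuperalgebra where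
  oddBracket : 𝔤₁ →ₗ[ℂ] 𝔤₁ →ₗ[ℂ] 𝔤₀
  symm : ∀ x y, oddBracket x y = oddBracket y x
  lie_oddBracket : ∀ (a : 𝔤₀) (x y : 𝔤₁),
    ⁅a, oddBracket x y⁆ = oddBracket ⁅a, x⁆ y + oddBracket x ⁅a, y⁆
  jacobi_odd : ∀ x y z : 𝔤₁, ⁅oddBracket x y, z⁆ + ⁅oddBracket y z, x⁆ + ⁅oddBracket z x, y⁆ = 0

variable {𝔤₀ 𝔤₁}

/-- `I₀ ⊕ I₁` is a (graded) ideal of `𝔤₀ ⊕ 𝔤₁`. -/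
structure LieSuperalgebra.IsIdeal (𝔤 : LieSuperalgebra 𝔤₀ 𝔤₁) (I₀ : Submodule ℂ 𝔤₀)
    (I₁ : Submodule ℂ 𝔤₁) : Prop where
  even_even : ∀ a : 𝔤₀, ∀ b ∈ I₀, ⁅a, b⁆ ∈ I₀
  even_odd : ∀ a : 𝔤₀, ∀ x ∈ I₁, ⁅a, x⁆ ∈ I₁
  odd_even : ∀ b ∈ I₀, ∀ x : 𝔤₁, ⁅b, x⁆ ∈ I₁
  odd_odd : ∀ x : 𝔤₁, ∀ y ∈ I₁, 𝔤.oddBracket x y ∈ I₀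

/-- A Lie superalgebra is simple if its bracket is not identically zero and it has no graded
ideals except `0` and itself. -/
structure LieSuperalgebra.IsSimple (𝔤 : LieSuperalgebra 𝔤₀ 𝔤₁) : Prop where
  not_abelian : (∃ a b : 𝔤₀, ⁅a, b⁆ ≠ 0) ∨ (∃ (a : 𝔤₀) (x : 𝔤₁), ⁅a, x⁆ ≠ 0) ∨
    ∃ x y : 𝔤₁, 𝔤.oddBracket x y ≠ 0
  eq_bot_or_eq_top : ∀ (I₀ : Submodule ℂ 𝔤₀) (I₁ : Submodule ℂ 𝔤₁), 𝔤.IsIdeal I₀ I₁ →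
    (I₀ = ⊥ ∧ I₁ = ⊥) ∨ (I₀ = ⊤ ∧ I₁ = ⊤)

/-- A classical Lie superalgebra: simple, with `𝔤₁` completely reducible over `𝔤₀`. -/
structure LieSuperalgebra.IsClassical (𝔤 : LieSuperalgebra 𝔤₀ 𝔤₁) : Prop where
  simple : 𝔤.IsSimple
  completelyReducible : ComplementedLattice (LieSubmodule ℂ 𝔤₀ 𝔤₁)

/-- A nondegenerate, consistent, supersymmetric, invariant bilinear form on `𝔤₀ ⊕ 𝔤₁`; by
consistency it is given by its restrictions to `𝔤₀` and `𝔤₁`. The remaining cases of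
`B([x, y], z) = B(x, [y, z])` follow from the two stated ones by supersymmetry. -/
structure LieSuperalgebra.InvariantForm (𝔤 : LieSuperalgebra 𝔤₀ 𝔤₁) where
  even : LinearMap.BilinForm ℂ 𝔤₀
  odd : LinearMap.BilinForm ℂ 𝔤₁
  even_quadratic : IsQuadratic even
  odd_skew : ∀ x y, odd x y = -odd y x
  odd_nondegenerate : odd.Nondegenerate
  odd_invariant : ∀ (a : 𝔤₀) (x y : 𝔤₁), odd ⁅a, x⁆ y = even a (𝔤.oddBracket x y)

end Superalgebra

/-- A decomposition `𝔨 = 𝔨⁰ ⊕ 𝔨¹ ⊕ ⋯ ⊕ 𝔨ʳ` of a reductive Lie algebra into its centre `𝔨⁰` (possibly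
zero) and simple ideals. -/
structure ReductiveDecomposition (𝔨 : Type*) [LieRing 𝔨] [LieAlgebra ℂ 𝔨] (r : ℕ) where
  ideal : Fin (r + 1) → LieIdeal ℂ 𝔨
  ideal_zero : ideal 0 = LieAlgebra.center ℂ 𝔨
  simple : ∀ i : Fin r, LieAlgebra.IsSimple ℂ (ideal i.succ)
  isInternal : DirectSum.IsInternal fun i => (ideal i).toSubmodule

/-! ### The quantum Weil algebra and the cubic Dirac operator of a quadratic Lie algebra -/

section Weil

variable {𝔨 : Type*} [LieRing 𝔨] [LieAlgebra ℂ 𝔨]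

/-- The Clifford algebra, with relations `x y + y x = 2 B(x, y)`. -/
abbrev Cl {V : Type*} [AddCommGroup V] [Module ℂ V] (B : LinearMap.BilinForm ℂ V) : Type _ :=
  CliffordAlgebra (LinearMap.BilinMap.toQuadraticMap B)

/-- The quantum Weil algebra `𝔘(𝔨) ⊗ Cl(𝔨)`. -/
abbrev Weil (B : LinearMap.BilinForm ℂ 𝔨) : Type _ := UniversalEnvelopingAlgebra ℂ 𝔨 ⊗[ℂ] Cl B

instance instInvertibleTwoComplex : Invertible (2 : ℂ) := invertibleOfNonzero two_ne_zero

/-- The quantization map `q : ⋀ V → Cl(V)`. -/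
def quantization {V : Type*} [AddCommGroup V] [Module ℂ V] (B : LinearMap.BilinForm ℂ V) :
    ExteriorAlgebra ℂ V ≃ₗ[ℂ] Cl B :=
  (CliffordAlgebra.equivExterior (LinearMap.BilinMap.toQuadraticMap B)).symm

variable [FiniteDimensional ℂ 𝔨]

/-- The structure constants tensor
`φ = -(1/12) ∑ B([e_a, e_b], e_c) e^a ∧ e^b ∧ e^c`, i.e. the Cartan 3-form
`(x, y, z) ↦ -(1/2) B([x, y], z)`. -/
def structureTensor (B : LinearMap.BilinForm ℂ 𝔨) (hB : B.Nondegenerate) : ExteriorAlgebra ℂ 𝔨 :=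
  let e := Module.finBasis ℂ 𝔨
  let e' := B.dualBasis hB e
  (-(1 / 12 : ℂ)) • ∑ a, ∑ b, ∑ c, B ⁅e a, e b⁆ (e c) •
    (ExteriorAlgebra.ι ℂ (e' a) * ExteriorAlgebra.ι ℂ (e' b) * ExteriorAlgebra.ι ℂ (e' c))

/-- The cubic Dirac operator `D = ∑ e^a ⊗ e_a + 1 ⊗ q(φ)`. -/
def cubicDirac (B : LinearMap.BilinForm ℂ 𝔨) (hB : B.Nondegenerate) : Weil B :=
  let e := Module.finBasis ℂ 𝔨
  let e' := B.dualBasis hB e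
  ∑ a, UniversalEnvelopingAlgebra.ι ℂ (e' a) ⊗ₜ[ℂ]
      CliffordAlgebra.ι (LinearMap.BilinMap.toQuadraticMap B) (e a) +
    1 ⊗ₜ[ℂ] quantization B (structureTensor B hB)

/-- The family `D(ξ) = D + 1 ⊗ ξ^♯`, where `B(ξ^♯, ·) = ξ`. -/
def diracFamily (B : LinearMap.BilinForm ℂ 𝔨) (hB : B.Nondegenerate) (ξ : Dual ℂ 𝔨) : Weil B :=
  cubicDirac B hB +
    1 ⊗ₜ[ℂ] CliffordAlgebra.ι (LinearMap.BilinMap.toQuadraticMap B) ((B.toDual hB).symm ξ)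

/-- The family of Laplace operators `Δ(ξ) = D(ξ)²`. -/
def laplaceFamily (B : LinearMap.BilinForm ℂ 𝔨) (hB : B.Nondegenerate) (ξ : Dual ℂ 𝔨) : Weil B :=
  diracFamily B hB ξ ^ 2

end Weil

/-! ### Factors of a reductive quadratic Lie algebra -/

section Factors

variable {𝔨 : Type*} [LieRing 𝔨] [LieAlgebra ℂ 𝔨]

/-- The restriction of a bilinear form to an ideal. -/
def restrictForm (B : LinearMap.BilinForm ℂ 𝔨) (I : LieIdeal ℂ 𝔨) : LinearMap.BilinForm ℂ I :=
  B.restrict I.toSubmodule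

/-- The algebra map `𝔚(I) → 𝔚(𝔨)` induced by the inclusion of an ideal. -/
def weilInclusion (B : LinearMap.BilinForm ℂ 𝔨) (I : LieIdeal ℂ 𝔨) :
    Weil (restrictForm B I) →ₐ[ℂ] Weil B :=
  Algebra.TensorProduct.map
    (UniversalEnvelopingAlgebra.lift ℂ ((UniversalEnvelopingAlgebra.ι ℂ).comp I.incl))
    (CliffordAlgebra.map
      { toLinearMap := I.toSubmodule.subtype
        map_app' := fun _ => rfl })

/-- Two distinct factors of a decomposition are orthogonal for any invariant symmetric form. -/
lemma ReductiveDecomposition.orthogonal {r : ℕ} (dec : ReductiveDecomposition 𝔨 r)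
    {B : LinearMap.BilinForm ℂ 𝔨} (hB : IsQuadratic B) {i j : Fin (r + 1)} (hij : i ≠ j)
    {x y : 𝔨} (hx : x ∈ dec.ideal i) (hy : y ∈ dec.ideal j) : B x y = 0 := by
  have key : ∀ (k : Fin r) (l : Fin (r + 1)), k.succ ≠ l → ∀ x ∈ dec.ideal k.succ,
      ∀ y ∈ dec.ideal l, B x y = 0 := by
    intro k l hkl x hx y hy
    have hdisj := dec.isInternal.submodule_iSupIndep.pairwiseDisjoint hkl
    have hs := dec.simple k
    have hperf : ⁅(⊤ : LieIdeal ℂ (dec.ideal k.succ)), (⊤ : LieIdeal ℂ (dec.ideal k.succ))⁆ = ⊤ := by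
      refine (hs.eq_bot_or_eq_top _).resolve_left fun h => hs.non_abelian ?_
      rw [LieSubmodule.lie_eq_bot_iff] at h
      exact ⟨fun a b => h a (LieSubmodule.mem_top a) b (LieSubmodule.mem_top b)⟩
    have hx' : (⟨x, hx⟩ : dec.ideal k.succ) ∈
        (⁅(⊤ : LieIdeal ℂ (dec.ideal k.succ)), (⊤ : LieIdeal ℂ (dec.ideal k.succ))⁆).toSubmodule := by
      rw [hperf]; trivial
    rw [LieSubmodule.lieIdeal_oper_eq_linear_span'] at hx'
    have : ∀ z : dec.ideal k.succ, z ∈ Submodule.span ℂ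
        {m | ∃ x ∈ (⊤ : LieIdeal ℂ (dec.ideal k.succ)), ∃ n ∈ (⊤ : LieIdeal ℂ (dec.ideal k.succ)),
          ⁅x, n⁆ = m} → B (z : 𝔨) y = 0 := by
      intro z hz
      induction hz using Submodule.span_induction with
      | mem z hz =>
        obtain ⟨a, -, b, -, rfl⟩ := hz
        change B ⁅(a : 𝔨), (b : 𝔨)⁆ y = 0
        rw [hB.invariant]
        have h0 : ⁅(b : 𝔨), y⁆ = 0 := by
          have h1 : ⁅(b : 𝔨), y⁆ ∈ dec.ideal k.succ := lie_mem_left ℂ 𝔨 _ _ _ b.2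
          have h2 : ⁅(b : 𝔨), y⁆ ∈ dec.ideal l := lie_mem_right ℂ 𝔨 _ _ _ hy
          exact (Submodule.disjoint_def.mp hdisj) _ h1 h2
        rw [h0, map_zero]
      | zero => simp
      | add a b _ _ ha hb => simp [ha, hb]
      | smul c a _ ha => simp [ha]
    exact this _ hx'
  rcases Fin.eq_zero_or_eq_succ i with rfl | ⟨k, rfl⟩
  · rcases Fin.eq_zero_or_eq_succ j with rfl | ⟨k, rfl⟩
    · exact absurd rfl hij
    · rw [hB.symm]
      exact key k 0 hij.symm y hy x hx
  · exact key k j hij x hx y hy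

/-- A symmetric form restricts nondegenerately to a summand with an orthogonal complement. -/
lemma restrict_nondegenerate {V : Type*} [AddCommGroup V] [Module ℂ V]
    {B : LinearMap.BilinForm ℂ V} (hsymm : ∀ a b, B a b = B b a) (hB : B.Nondegenerate)
    {p q : Submodule ℂ V} (hpq : Codisjoint p q) (h : ∀ x ∈ p, ∀ y ∈ q, B x y = 0) :
    (B.restrict p).Nondegenerate := by
  have hrefl : (B.restrict p).IsRefl := fun a b hab => by
    simpa [hsymm b.1 a.1] using hab
  rw [LinearMap.BilinForm.Nondegenerate, hrefl.nondegenerate_iff_separatingLeft,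
    LinearMap.separatingLeft_iff_ker_eq_bot,
    LinearMap.BilinForm.ker_restrict_eq_of_codisjoint hpq h, hB.ker_eq_bot]
  simp

/-- A nondegenerate invariant form restricts to a nondegenerate form on each factor. -/
lemma ReductiveDecomposition.nondegenerate {r : ℕ} (dec : ReductiveDecomposition 𝔨 r)
    {B : LinearMap.BilinForm ℂ 𝔨} (hB : IsQuadratic B) (i : Fin (r + 1)) :
    (restrictForm B (dec.ideal i)).Nondegenerate := by
  refine restrict_nondegenerate hB.symm hB.nondegenerate
    (q := ⨆ j ≠ i, (dec.ideal j).toSubmodule) ?_ ?_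
  · exact codisjoint_iff.mpr ((iSup_split_single (fun j => (dec.ideal j).toSubmodule) i).symm.trans
      dec.isInternal.submodule_iSup_eq_top)
  · intro x hx y hy
    have hle : (⨆ j ≠ i, (dec.ideal j).toSubmodule) ≤ LinearMap.ker (B x) :=
      iSup₂_le fun j hj z hz => dec.orthogonal hB (Ne.symm hj) hx hz
    exact hle hy

/-- The factorwise Laplace family `ξ ↦ Δ_{𝔨ⁱ}(ξⁱ)`, viewed in `𝔚(𝔨)`, where `ξⁱ` is the restriction of
`ξ` to `𝔨ⁱ`. -/
def laplaceFactor [FiniteDimensional ℂ 𝔨] {r : ℕ} (dec : ReductiveDecomposition 𝔨 r)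
    {B : LinearMap.BilinForm ℂ 𝔨} (hB : IsQuadratic B) (ξ : Dual ℂ 𝔨) (i : Fin (r + 1)) : Weil B :=
  weilInclusion B (dec.ideal i)
    (laplaceFamily (restrictForm B (dec.ideal i)) (dec.nondegenerate hB i)
      (ξ ∘ₗ (dec.ideal i).toSubmodule.subtype))

end Factors

/-! ### Roots, positive systems, coadjoint orbits -/

section Roots

variable {𝔨 : Type*} [LieRing 𝔨] [LieAlgebra ℂ 𝔨] (𝔥 : LieSubalgebra ℂ 𝔨)

/-- The nonzero weights of `𝔥` on a `𝔨`-module: for `M = 𝔨` the roots of `𝔨`, and for the odd part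
`M = 𝔤₁` of a Lie superalgebra with even part `𝔨` the odd roots. -/
def roots (M : Type*) [AddCommGroup M] [Module ℂ M] [LieRingModule 𝔨 M] [LieModule ℂ 𝔨 M] :
    Set (Dual ℂ 𝔥) :=
  {α | α ≠ 0 ∧ LieModule.weightSpace M (α : 𝔥 → ℂ) ≠ ⊥}

/-- The real span `𝔥_ℝ^*` of the root system `Δ = Δ₀ ∪ Δ₁` of a Lie superalgebra `𝔨 ⊕ 𝔤₁`. -/
def realRootSpan (𝔤₁ : Type*) [AddCommGroup 𝔤₁] [Module ℂ 𝔤₁] [LieRingModule 𝔨 𝔤₁]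
    [LieModule ℂ 𝔨 𝔤₁] : Submodule ℝ (Dual ℂ 𝔥) :=
  Submodule.span ℝ (roots 𝔥 𝔨 ∪ roots 𝔥 𝔤₁)

/-- `P` is a positive system of roots of `𝔨`: the roots on which some real-linear functional that
vanishes on no root is positive. -/
def IsPositiveSystem (P : Finset (Dual ℂ 𝔥)) : Prop :=
  ∃ f : Dual ℂ 𝔥 →ₗ[ℝ] ℝ, (∀ α ∈ roots 𝔥 𝔨, f α ≠ 0) ∧
    ∀ α, α ∈ P ↔ α ∈ roots 𝔥 𝔨 ∧ 0 < f α

variable {𝔥}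

/-- The half sum `ρ` of the positive roots. -/
def weylVector (P : Finset (Dual ℂ 𝔥)) : Dual ℂ 𝔥 := (1 / 2 : ℂ) • ∑ α ∈ P, α

/-- `𝔫⁺`, the sum of the positive root spaces. -/
def nPos (P : Finset (Dual ℂ 𝔥)) : Submodule ℂ 𝔨 :=
  ⨆ α ∈ P, (LieModule.weightSpace 𝔨 (α : 𝔥 → ℂ)).toSubmodule

/-- `𝔫⁻`, the sum of the negative root spaces. -/
def nNeg (P : Finset (Dual ℂ 𝔥)) : Submodule ℂ 𝔨 :=
  ⨆ α ∈ P, (LieModule.weightSpace 𝔨 ((-α : Dual ℂ 𝔥) : 𝔥 → ℂ)).toSubmodule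

/-- `L` is a highest weight module of highest weight `Λ` if it is generated by a nonzero vector of
weight `Λ` killed by `𝔫⁺`; for irreducible `L` the generation is automatic. -/
def HasHighestWeight (P : Finset (Dual ℂ 𝔥)) (L : Type*) [AddCommGroup L] [Module ℂ L]
    [LieRingModule 𝔨 L] [LieModule ℂ 𝔨 L] (Λ : Dual ℂ 𝔥) : Prop :=
  ∃ v : L, v ≠ 0 ∧ (∀ x ∈ nPos P, ⁅x, v⁆ = 0) ∧ (∀ h : 𝔥, ⁅(h : 𝔨), v⁆ = Λ h • v) ∧
    LieSubmodule.lieSpan ℂ 𝔨 {v} = ⊤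

lemma form_eq_zero_of_add_ne_zero {B : LinearMap.BilinForm ℂ 𝔨} (hB : IsQuadratic B)
    {α β : Dual ℂ 𝔥} (h : α + β ≠ 0) {x y : 𝔨}
    (hx : x ∈ LieModule.weightSpace 𝔨 (α : 𝔥 → ℂ)) (hy : y ∈ LieModule.weightSpace 𝔨 (β : 𝔥 → ℂ)) :
    B x y = 0 := by
  obtain ⟨t, ht⟩ : ∃ t, (α + β) t ≠ 0 := by
    by_contra! hc
    exact h (LinearMap.ext hc)
  rw [LieModule.mem_weightSpace] at hx hy
  have h1 := hB.invariant x (t : 𝔨) y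
  have hx' : ⁅(t : 𝔨), x⁆ = α t • x := hx t
  have hy' : ⁅(t : 𝔨), y⁆ = β t • y := hy t
  rw [← lie_skew, hx', hy'] at h1
  have h2 : (α t + β t) * B x y = 0 := by
    simp only [map_neg, map_smul, LinearMap.neg_apply, LinearMap.smul_apply, smul_eq_mul] at h1
    linear_combination -h1
  exact (mul_eq_zero.mp h2).resolve_left ht

lemma form_nPos_eq_zero {B : LinearMap.BilinForm ℂ 𝔨} (hB : IsQuadratic B) {P : Finset (Dual ℂ 𝔥)}
    (hP : IsPositiveSystem 𝔥 P) {x y : 𝔨} (hx : x ∈ nPos P) (hy : y ∈ nPos P) : B x y = 0 := by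
  obtain ⟨f, -, hf⟩ := hP
  have key : ∀ α ∈ P, ∀ x ∈ LieModule.weightSpace 𝔨 (α : 𝔥 → ℂ), ∀ y ∈ nPos P, B x y = 0 := by
    intro α hα x hx y hy
    have : nPos P ≤ LinearMap.ker (B x) := iSup₂_le fun β hβ y hy => by
      refine form_eq_zero_of_add_ne_zero hB (fun h0 => ?_) hx hy
      have := congrArg f h0
      rw [map_add, map_zero] at this
      linarith [((hf α).mp hα).2, ((hf β).mp hβ).2]
    exact this hy
  have : nPos P ≤ LinearMap.ker (B.flip y) := iSup₂_le fun α hα x hx => key α hα x hx y hy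
  exact this hx

lemma form_nNeg_eq_zero {B : LinearMap.BilinForm ℂ 𝔨} (hB : IsQuadratic B) {P : Finset (Dual ℂ 𝔥)}
    (hP : IsPositiveSystem 𝔥 P) {x y : 𝔨} (hx : x ∈ nNeg P) (hy : y ∈ nNeg P) : B x y = 0 := by
  obtain ⟨f, -, hf⟩ := hP
  have key : ∀ α ∈ P, ∀ x ∈ LieModule.weightSpace 𝔨 ((-α : Dual ℂ 𝔥) : 𝔥 → ℂ), ∀ y ∈ nNeg P,
      B x y = 0 := by
    intro α hα x hx y hy
    have : nNeg P ≤ LinearMap.ker (B x) := iSup₂_le fun β hβ y hy => by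
      refine form_eq_zero_of_add_ne_zero hB (fun h0 => ?_) hx hy
      have := congrArg f h0
      rw [map_add, map_zero, map_neg, map_neg] at this
      linarith [((hf α).mp hα).2, ((hf β).mp hβ).2]
    exact this hy
  have : nNeg P ≤ LinearMap.ker (B.flip y) := iSup₂_le fun α hα x hx => key α hα x hx y hy
  exact this hx

/-- The form is nondegenerate on a Cartan subalgebra. -/
lemma restrict_cartan_nondegenerate [FiniteDimensional ℂ 𝔨] [𝔥.IsCartanSubalgebra]
    {B : LinearMap.BilinForm ℂ 𝔨} (hB : IsQuadratic B) :
    (B.restrict 𝔥.toSubmodule).Nondegenerate := by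
  have hc := LieModule.isCompl_genWeightSpace_zero_posFittingComp ℂ 𝔥 𝔨
  have h0 : (LieModule.genWeightSpace 𝔨 (0 : 𝔥 → ℂ)).toSubmodule = 𝔥.toSubmodule := by
    rw [show LieModule.genWeightSpace 𝔨 (0 : 𝔥 → ℂ) = LieAlgebra.rootSpace 𝔥 0 from rfl,
      LieAlgebra.rootSpace_zero_eq]
    rfl
  refine restrict_nondegenerate hB.symm hB.nondegenerate
    (q := (LieModule.posFittingComp ℂ 𝔥 𝔨).toSubmodule) ?_ ?_
  · rw [← h0, codisjoint_iff, ← LieSubmodule.sup_toSubmodule, hc.sup_eq_top]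
    rfl
  · intro x hx y hy
    refine LieModule.eq_zero_of_mem_genWeightSpace_mem_posFitting ℂ 𝔥 𝔨 (fun t m n => ?_)
      (m₀ := x) ?_ hy
    · change B ⁅(t : 𝔨), m⁆ n = -B m ⁅(t : 𝔨), n⁆
      rw [← hB.invariant, ← lie_skew]
      simp only [map_neg, LinearMap.neg_apply]
    · rw [← h0] at hx
      exact hx

variable [FiniteDimensional ℂ 𝔨] [𝔥.IsCartanSubalgebra]

/-- The element `h_ξ ∈ 𝔥` with `B(h_ξ, ·) = ξ` on `𝔥`. -/
def sharp {B : LinearMap.BilinForm ℂ 𝔨} (hB : IsQuadratic B) (ξ : Dual ℂ 𝔥) : 𝔥 :=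
  (LinearMap.BilinForm.toDual (B.restrict 𝔥.toSubmodule) (restrict_cartan_nondegenerate hB)).symm ξ

/-- The embedding `𝔥^* ⊂ 𝔨^*` given by `𝔥 ⊂ 𝔨` and the identifications `𝔥 ≅ 𝔥^*`, `𝔨 ≅ 𝔨^*` coming
from `B`; it extends a functional by zero on the root spaces. -/
def extend {B : LinearMap.BilinForm ℂ 𝔨} (hB : IsQuadratic B) (ξ : Dual ℂ 𝔥) : Dual ℂ 𝔨 :=
  B (sharp hB ξ : 𝔨)

/-- `ξ ∈ 𝔥_ℝ^*` is antidominant: `⟨ξ, α^∨⟩ = 2 B(ξ, α) / B(α, α) ≤ 0` for all positive roots `α`. -/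
def IsAntidominant {B : LinearMap.BilinForm ℂ 𝔨} (hB : IsQuadratic B) (P : Finset (Dual ℂ 𝔥))
    (ξ : Dual ℂ 𝔥) : Prop :=
  ∀ α ∈ P, (2 * ξ (sharp hB α) / α (sharp hB α)).re ≤ 0

end Roots

section Adjoint

variable {𝔨 : Type*} [LieRing 𝔨] [LieAlgebra ℂ 𝔨] [FiniteDimensional ℂ 𝔨]

/-- The operator `exp(ad x)` on `𝔨`. -/
def expAd (x : 𝔨) : 𝔨 →ₗ[ℂ] 𝔨 :=
  let b := Module.finBasis ℂ 𝔨
  Matrix.toLin b b (NormedSpace.exp (LinearMap.toMatrix b b (LieAlgebra.ad ℂ 𝔨 x)))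

variable (𝔨) in
/-- The image `Ad(K) ⊂ GL(𝔨)` of a connected Lie group `K` with Lie algebra `𝔨` under the adjoint
representation: the group generated by the operators `Ad(exp x) = exp(ad x)`. -/
def adjointGroup : Subgroup (𝔨 ≃ₗ[ℂ] 𝔨) :=
  Subgroup.closure {g | ∃ x : 𝔨, (g : 𝔨 →ₗ[ℂ] 𝔨) = expAd x}

/-- The coadjoint orbit `Ad^*_K(ξ)`, where `(Ad^*_g ξ)(y) = ξ(Ad_g⁻¹ y)`. -/
def coadjointOrbit (ξ : Dual ℂ 𝔨) : Set (Dual ℂ 𝔨) :=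
  {η | ∃ g ∈ adjointGroup 𝔨, η = ξ ∘ₗ (g.symm : 𝔨 →ₗ[ℂ] 𝔨)}

end Adjoint

/-! ### The spin module and the operators on `L ⊗ S` -/

section Spin

variable {𝔨 : Type*} [LieRing 𝔨] [LieAlgebra ℂ 𝔨] {𝔥 : LieSubalgebra ℂ 𝔨}

/-- The linear map `𝔫⁺ ⊕ 𝔫⁻ → 𝔨`; its image is `𝔭`, the orthogonal complement of `𝔥`. -/
def polarization (P : Finset (Dual ℂ 𝔥)) : (nPos P × nNeg P) →ₗ[ℂ] 𝔨 :=
  (nPos P).subtype.coprod (nNeg P).subtype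

/-- The form `B` on `𝔭 = 𝔫⁺ ⊕ 𝔫⁻`. -/
def formP (B : LinearMap.BilinForm ℂ 𝔨) (P : Finset (Dual ℂ 𝔥)) :
    LinearMap.BilinForm ℂ (nPos P × nNeg P) :=
  B.compl₁₂ (polarization P) (polarization P)

/-- The algebra `𝔘(𝔨) ⊗ Cl(𝔭)`. -/
abbrev WeilP (B : LinearMap.BilinForm ℂ 𝔨) (P : Finset (Dual ℂ 𝔥)) : Type _ :=
  UniversalEnvelopingAlgebra ℂ 𝔨 ⊗[ℂ] Cl (formP B P)

/-- The inclusion `𝔘(𝔨) ⊗ Cl(𝔭) → 𝔘(𝔨) ⊗ Cl(𝔨) = 𝔚(𝔨)`. -/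
def weilPInclusion (B : LinearMap.BilinForm ℂ 𝔨) (P : Finset (Dual ℂ 𝔥)) :
    WeilP B P →ₐ[ℂ] Weil B :=
  Algebra.TensorProduct.map (AlgHom.id ℂ _)
    (CliffordAlgebra.map
      { toLinearMap := polarization P
        map_app' := fun _ => rfl })

instance instFiniteDimensionalExteriorAlgebra (V : Type*) [AddCommGroup V] [Module ℂ V]
    [FiniteDimensional ℂ V] : FiniteDimensional ℂ (ExteriorAlgebra ℂ V) := by
  have htop : (⨆ n : ℕ, (⋀[ℂ]^n V : Submodule ℂ (ExteriorAlgebra ℂ V))) = ⊤ :=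
    (DirectSum.Decomposition.isInternal
      (fun n : ℕ => (⋀[ℂ]^n V : Submodule ℂ (ExteriorAlgebra ℂ V)))).submodule_iSup_eq_top
  have hle : (⊤ : Submodule ℂ (ExteriorAlgebra ℂ V)) ≤
      ⨆ n : Fin (finrank ℂ V + 1), (⋀[ℂ]^(n : ℕ) V : Submodule ℂ (ExteriorAlgebra ℂ V)) := by
    rw [← htop]
    refine iSup_le fun n => ?_
    by_cases hn : n < finrank ℂ V + 1
    · exact le_iSup (fun n : Fin (finrank ℂ V + 1) =>
        (⋀[ℂ]^(n : ℕ) V : Submodule ℂ (ExteriorAlgebra ℂ V))) ⟨n, hn⟩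
    · have h0 : finrank ℂ (⋀[ℂ]^n V : Submodule ℂ (ExteriorAlgebra ℂ V)) = 0 := by
        rw [exteriorPower.finrank_eq, Nat.choose_eq_zero_of_lt (by omega)]
      rw [Submodule.finrank_eq_zero] at h0
      rw [h0]
      exact bot_le
  exact Module.finite_def.mpr (by
    rw [← top_le_iff.mp hle]
    exact (inferInstance : Module.Finite ℂ ↥(⨆ n : Fin (finrank ℂ V + 1),
      (⋀[ℂ]^(n : ℕ) V : Submodule ℂ (ExteriorAlgebra ℂ V)))) |> Module.Finite.iff_fg.mp)

/-- The spin module `S = ⋀ 𝔫⁻`. -/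
abbrev Spin (P : Finset (Dual ℂ 𝔥)) : Type _ := ExteriorAlgebra ℂ (nNeg P)

/-- The Clifford action of `u + ū ∈ 𝔫⁺ ⊕ 𝔫⁻` on `S = ⋀ 𝔫⁻`: exterior multiplication by `ū` plus twice
the contraction with `B(u, ·)` (twice, because of the relation `u ū + ū u = 2 B(u, ū)`). -/
def spinVector (B : LinearMap.BilinForm ℂ 𝔨) (P : Finset (Dual ℂ 𝔥)) :
    (nPos P × nNeg P) →ₗ[ℂ] Module.End ℂ (Spin P) :=
  ((2 : ℂ) • (CliffordAlgebra.contractLeft (Q := (0 : QuadraticForm ℂ (nNeg P)))) ∘ₗ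
      (B.compl₁₂ (nPos P).subtype (nNeg P).subtype)).coprod
    (LinearMap.mul ℂ (Spin P) ∘ₗ ExteriorAlgebra.ι ℂ)

lemma spinVector_apply (B : LinearMap.BilinForm ℂ 𝔨) (P : Finset (Dual ℂ 𝔥))
    (m : nPos P × nNeg P) (w : Spin P) :
    spinVector B P m w = (2 : ℂ) • CliffordAlgebra.contractLeft
      (Q := (0 : QuadraticForm ℂ (nNeg P))) (B (m.1 : 𝔨) ∘ₗ (nNeg P).subtype) w +
      ExteriorAlgebra.ι ℂ m.2 * w := rfl

lemma spinVector_mul_self {B : LinearMap.BilinForm ℂ 𝔨} (hB : IsQuadratic B)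
    {P : Finset (Dual ℂ 𝔥)} (hP : IsPositiveSystem 𝔥 P) (m : nPos P × nNeg P) :
    spinVector B P m * spinVector B P m = algebraMap ℂ (Module.End ℂ (Spin P))
      (LinearMap.BilinMap.toQuadraticMap (formP B P) m) := by
  refine LinearMap.ext fun w => ?_
  have hQ : LinearMap.BilinMap.toQuadraticMap (formP B P) m = 2 * B (m.1 : 𝔨) (m.2 : 𝔨) := by
    change B ((m.1 : 𝔨) + (m.2 : 𝔨)) ((m.1 : 𝔨) + (m.2 : 𝔨)) = _
    rw [map_add, map_add, LinearMap.add_apply, LinearMap.add_apply,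
      form_nPos_eq_zero hB hP m.1.2 m.1.2, form_nNeg_eq_zero hB hP m.2.2 m.2.2,
      hB.symm (m.2 : 𝔨) (m.1 : 𝔨)]
    ring
  rw [hQ, Module.End.mul_apply, spinVector_apply, spinVector_apply, map_add, map_smul,
    CliffordAlgebra.contractLeft_contractLeft, ExteriorAlgebra.ι,
    CliffordAlgebra.contractLeft_ι_mul, mul_add, ← mul_assoc, CliffordAlgebra.ι_sq_scalar]
  simp [Module.algebraMap_end_apply, smul_sub]
  exact smul_comm _ _ _

/-- The action of `Cl(𝔭)` on the spin module. -/
def spinAction {B : LinearMap.BilinForm ℂ 𝔨} (hB : IsQuadratic B) {P : Finset (Dual ℂ 𝔥)}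
    (hP : IsPositiveSystem 𝔥 P) : Cl (formP B P) →ₐ[ℂ] Module.End ℂ (Spin P) :=
  CliffordAlgebra.lift _ ⟨spinVector B P, spinVector_mul_self hB hP⟩

variable (L : Type*) [AddCommGroup L] [Module ℂ L] [LieRingModule 𝔨 L] [LieModule ℂ 𝔨 L]

/-- The action of `𝔘(𝔨) ⊗ Cl(𝔭)` on `L ⊗ S`. -/
def weilPAction {B : LinearMap.BilinForm ℂ 𝔨} (hB : IsQuadratic B) {P : Finset (Dual ℂ 𝔥)}
    (hP : IsPositiveSystem 𝔥 P) : WeilP B P →ₐ[ℂ] Module.End ℂ (L ⊗[ℂ] Spin P) :=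
  Module.endTensorEndAlgHom.comp
    (Algebra.TensorProduct.map
      (UniversalEnvelopingAlgebra.lift ℂ (LieModule.toEnd ℂ 𝔨 L)) (spinAction hB hP))

variable {L}

/-- `w ∈ 𝔚(𝔨)` lies in the subalgebra `𝔘(𝔨) ⊗ Cl(𝔭)` and acts on `L ⊗ S` by the operator `T`. -/
def ActsAs {B : LinearMap.BilinForm ℂ 𝔨} (hB : IsQuadratic B) {P : Finset (Dual ℂ 𝔥)}
    (hP : IsPositiveSystem 𝔥 P) (w : Weil B) (T : Module.End ℂ (L ⊗[ℂ] Spin P)) : Prop :=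
  ∃ d : WeilP B P, weilPInclusion B P d = w ∧ weilPAction L hB hP d = T

end Spin

/-- The operator `∑ T_i^† T_i` on `V ⊗ W`, where the adjoint is taken for the Hermitian inner product
`⟨v ⊗ w, v' ⊗ w'⟩ = ⟨v, v'⟩ ⟨w, w'⟩` induced by inner products on `V` and `W`. -/
def sumAdjointMul {V W : Type*} [AddCommGroup V] [Module ℂ V] [FiniteDimensional ℂ V]
    [AddCommGroup W] [Module ℂ W] [FiniteDimensional ℂ W] (cV : InnerProductSpace.Core ℂ V)
    (cW : InnerProductSpace.Core ℂ W) {ι : Type*} [Fintype ι]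
    (T : ι → Module.End ℂ (V ⊗[ℂ] W)) : Module.End ℂ (V ⊗[ℂ] W) :=
  letI := cV.toNormedAddCommGroup
  letI := InnerProductSpace.ofCore cV.toCore
  letI := cW.toNormedAddCommGroup
  letI := InnerProductSpace.ofCore cW.toCore
  ∑ i, LinearMap.adjoint (T i) ∘ₗ T i

end DiracFamily

end

/-!
The proof reduces the two assertions to a computation of eigenvalues and then to the geometry of
the weights of `L ⊗ S`.

*The operators.* For a dual system `(u, v)` of a quadratic Lie algebra let
`α(x) = -(1/4) ∑ v_j [x, u_j]` be the spin representation in the Clifford algebra. The cubic term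
`γ` of the Dirac operator satisfies `γ x + x γ = 2 α(x)` and commutes with all `α(x)`, so that the
square `D(ξ)²` is the Casimir element of `𝔘(𝔨)`, plus the scalar `γ²`, plus the diagonal action of
`2 h_ξ`, plus `B(h_ξ, h_ξ)` (`dirac_sq`, and `laplaceFactor_eq` for a factor inside `𝔨`). In
particular `Δ_i(ξ^i)` involves the Clifford algebra only through `α(h)` for `h ∈ 𝔥`, which lies in
`Cl(𝔭)` (`spinElement_cartan`). The scalar `γ²` is a third of the Casimir element of the spin
representation and equals `(ρ, ρ)_i`, by evaluation on the product of the positive root vectors,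
which is a highest weight vector for left multiplication (`spinElement_casimir`). Hence on the
tensor product of a weight vector of `L` and one of `S`, of total weight `μ`, the `i`-th operator
is the scalar `(Λ + ρ, Λ + ρ)_i + 2 (ξ, μ)_i + (ξ, ξ)_i` (`weilPAction_laplaceP`). The kernel of
`∑ T_i^† T_i` is the common kernel of the `T_i`, so it is nonzero exactly when all these scalars
vanish for some weight `μ = ν + σ` of `L ⊗ S` (`exists_ker_iff`).

*Reality.* On a simple factor the form is a complex multiple of the Killing form, by Schur's
lemma. Dividing by these multiples and adding over the simple factors turns the scalars into a
single real identity `|Λ + ρ|² + 2 ⟨ξ, μ⟩ + |ξ|² = 0` for a form that is positive definite on real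
functionals of the semisimple part (`rootForm_self`). The centre needs a separate argument:
simplicity of the superalgebra forces it to have dimension at most one, because an element of the
centre acts on the odd part with square a scalar (`exists_smul_of_mem_center`). The form on the
centre is therefore anisotropic.

*Weights.* Every weight of `L ⊗ S` is conjugate, under elements of the adjoint group that act on
`𝔥` as root reflections, to a dominant one (`exists_isDominant`). Since it differs from `Λ + ρ` by
a sum of positive roots, it is shorter than `Λ + ρ` unless it is equal to `Λ + ρ`
(`IsDominant.rootForm_le`). With `|Λ + ρ|² - |μ|² + |ξ + μ|² = 0` this gives `ξ = -μ` with `μ`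
conjugate to `Λ + ρ`, and `μ = Λ + ρ` if `ξ` is antidominant (`eq_neg_of_laplace_zero`).
Conversely, if `-ξ` is conjugate to `Λ + ρ`, the elements `y`, `y₀` of `𝔥` that represent `-ξ`,
`Λ + ρ` for the Killing form have the same eigenvalues on `L` and on `𝔨`. Choosing a weight `ν` of
`L` with `ν(y) = Λ(y₀)` and the weight `σ` of `S` that is largest on `y`, one obtains a weight
`μ = ν + σ` with `⟨μ, -ξ⟩ ≥ |Λ + ρ|²`, and as both `μ` and `-ξ` are at most of length `|Λ + ρ|`,
they coincide (`mem_tensorSpinWeights_of_mem_coadjointOrbit`).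
-/

open scoped TensorProduct
open Module
noncomputable section
attribute [local instance 100] LieRing.ofAssociativeRing
namespace DiracFamily

/-! ### Dual systems for a bilinear form -/

section DualSystem

variable {V : Type*} [AddCommGroup V] [Module ℂ V] {J J' : Type*} [Fintype J] [Fintype J']

/-- Finite families `u`, `v` with `∑ B(x, v_j) u_j = x` for all `x`, so that `∑ u_j ⊗ v_j` is the
canonical tensor of the form `B`. A basis and its dual basis are an example, but the families need
not be linearly independent: the orthogonal projection of a dual system to a summand is a dual
system of the summand. -/
def IsDualSystem (B : LinearMap.BilinForm ℂ V) (u v : J → V) : Prop :=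
  ∀ x, ∑ j, B x (v j) • u j = x

lemma IsDualSystem.symm {B : LinearMap.BilinForm ℂ V} (hs : ∀ a b, B a b = B b a)
    (hB : B.Nondegenerate) {u v : J → V} (h : IsDualSystem B u v) : IsDualSystem B v u := by
  intro x
  refine sub_eq_zero.mp (hB.1 _ fun y => ?_)
  have h1 : B x y = B x (∑ j, B y (v j) • u j) := by rw [h y]
  simp only [map_sub, map_sum, map_smul, LinearMap.sub_apply, LinearMap.sum_apply,
    LinearMap.smul_apply, smul_eq_mul] at h1 ⊢
  rw [h1, sub_eq_zero]
  exact Finset.sum_congr rfl fun j _ => by rw [hs (v j) y, mul_comm]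

/-- The canonical tensor does not depend on the dual system. -/
lemma IsDualSystem.sum_eq {B : LinearMap.BilinForm ℂ V} (hs : ∀ a b, B a b = B b a)
    (hB : B.Nondegenerate) {u v : J → V} {u' v' : J' → V} (h : IsDualSystem B u v)
    (h' : IsDualSystem B u' v') {M : Type*} [AddCommGroup M] [Module ℂ M]
    (F : V →ₗ[ℂ] V →ₗ[ℂ] M) : ∑ j, F (u j) (v j) = ∑ k, F (u' k) (v' k) := by
  have h1 : ∀ j, F (u j) (v j) = ∑ k, F (u' k) (B (u j) (v' k) • v j) := fun j => by
    conv_lhs => rw [← h' (u j)]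
    simp only [map_sum, map_smul, LinearMap.sum_apply, LinearMap.smul_apply]
  simp_rw [h1]
  rw [Finset.sum_comm]
  refine Finset.sum_congr rfl fun k _ => ?_
  rw [← map_sum]
  congr 1
  simp_rw [hs (u _)]
  exact h.symm hs hB _

/-- A bilinear expression in a dual system is symmetric in the two families. -/
lemma IsDualSystem.sum_swap {B : LinearMap.BilinForm ℂ V} (hs : ∀ a b, B a b = B b a)
    (hB : B.Nondegenerate) {u v : J → V} (h : IsDualSystem B u v)
    {M : Type*} [AddCommGroup M] [Module ℂ M]
    (F : V →ₗ[ℂ] V →ₗ[ℂ] M) : ∑ j, F (u j) (v j) = ∑ j, F (v j) (u j) :=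
  h.sum_eq hs hB (h.symm hs hB) F

lemma isDualSystem_dualBasis [FiniteDimensional ℂ V] {B : LinearMap.BilinForm ℂ V}
    (hs : ∀ a b, B a b = B b a) (hB : B.Nondegenerate) {ι : Type*} [Fintype ι] [DecidableEq ι]
    (e : Basis ι ℂ V) : IsDualSystem B e (B.dualBasis hB e) := by
  intro x
  refine e.ext_elem fun i => ?_
  have : ∀ j, B x (B.dualBasis hB e j) = e.repr x j := fun j => by
    rw [hs]
    conv_lhs => rw [← e.sum_repr x]
    simp only [map_sum, map_smul, LinearMap.BilinForm.apply_dualBasis_left, smul_eq_mul, mul_ite,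
      mul_one, mul_zero]
    simp
  simp_rw [this]
  rw [e.sum_repr]

/-- Adjoint operators can be moved from one leg of the canonical tensor to the other. -/
lemma IsDualSystem.sum_adjoint {B : LinearMap.BilinForm ℂ V} (hs : ∀ a b, B a b = B b a)
    (hB : B.Nondegenerate) {u v : J → V} (h : IsDualSystem B u v)
    {M : Type*} [AddCommGroup M] [Module ℂ M] (F : V →ₗ[ℂ] V →ₗ[ℂ] M)
    {T T' : V →ₗ[ℂ] V} (hT : ∀ x y, B (T x) y = B x (T' y)) :
    ∑ j, F (T (u j)) (v j) = ∑ j, F (u j) (T' (v j)) := by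
  have h1 : ∀ j, F (T (u j)) (v j) = ∑ k, F (u k) (B (T (u j)) (v k) • v j) := fun j => by
    conv_lhs => rw [← h (T (u j))]
    simp only [map_sum, map_smul, LinearMap.sum_apply, LinearMap.smul_apply]
  simp_rw [h1]
  rw [Finset.sum_comm]
  refine Finset.sum_congr rfl fun k _ => ?_
  rw [← map_sum]
  congr 1
  conv_rhs => rw [← h.symm hs hB (T' (v k))]
  exact Finset.sum_congr rfl fun j _ => by rw [hT, hs]

variable {𝔨 : Type*} [LieRing 𝔨] [LieAlgebra ℂ 𝔨]

/-- The canonical tensor of an invariant form is invariant. -/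
lemma IsDualSystem.sum_lie {B : LinearMap.BilinForm ℂ 𝔨} (hB : IsQuadratic B) {u v : J → 𝔨}
    (h : IsDualSystem B u v) {M : Type*} [AddCommGroup M] [Module ℂ M]
    (F : 𝔨 →ₗ[ℂ] 𝔨 →ₗ[ℂ] M) (x : 𝔨) :
    ∑ j, F ⁅x, u j⁆ (v j) = -∑ j, F (u j) ⁅x, v j⁆ := by
  have h1 := h.sum_adjoint hB.symm hB.nondegenerate F (T := LieModule.toEnd ℂ 𝔨 𝔨 x)
    (T' := -LieModule.toEnd ℂ 𝔨 𝔨 x) fun y z => by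
      simp only [LieModule.toEnd_apply_apply, LinearMap.neg_apply, map_neg]
      rw [← lie_skew, map_neg, LinearMap.neg_apply, hB.invariant]
  simpa [-lie_skew] using h1

/-- Swapping the two legs of the symmetric canonical tensor changes the sign of its bracket. -/
lemma IsDualSystem.sum_lie_self {B : LinearMap.BilinForm ℂ 𝔨} (hB : IsQuadratic B) {u v : J → 𝔨}
    (h : IsDualSystem B u v) : ∑ j, ⁅u j, v j⁆ = 0 := by
  have h1 := h.sum_swap hB.symm hB.nondegenerate (LieModule.toEnd ℂ 𝔨 𝔨).toLinearMap
  have h2 : ∑ j, ⁅u j, v j⁆ = ∑ j, ⁅v j, u j⁆ := h1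
  have h3 : ∑ j, ⁅v j, u j⁆ = -∑ j, ⁅u j, v j⁆ := by
    rw [← Finset.sum_neg_distrib]
    exact Finset.sum_congr rfl fun j _ => (lie_skew _ _).symm
  rw [h3] at h2
  have h4 : (2 : ℂ) • ∑ j, ⁅u j, v j⁆ = 0 := by
    rw [two_smul]
    nth_rw 1 [h2]
    exact neg_add_cancel _
  exact (smul_eq_zero.mp h4).resolve_left two_ne_zero

end DualSystem

/-! ### The square of the cubic Dirac operator -/

section Clifford

variable {𝔨 : Type*} [LieRing 𝔨] [LieAlgebra ℂ 𝔨] {J : Type*} [Fintype J]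

/-- The generator of the Clifford algebra given by a vector. -/
abbrev cl {V : Type*} [AddCommGroup V] [Module ℂ V] (B : LinearMap.BilinForm ℂ V) : V →ₗ[ℂ] Cl B :=
  CliffordAlgebra.ι (LinearMap.BilinMap.toQuadraticMap B)

lemma cl_mul_add {V : Type*} [AddCommGroup V] [Module ℂ V] {B : LinearMap.BilinForm ℂ V}
    (hs : ∀ a b, B a b = B b a) (x y : V) :
    cl B x * cl B y + cl B y * cl B x = algebraMap ℂ _ (2 * B x y) := by
  rw [CliffordAlgebra.ι_mul_ι_add_swap, QuadraticMap.polar]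
  simp only [LinearMap.BilinMap.toQuadraticMap_apply, map_add, LinearMap.add_apply]
  rw [hs y x]
  ring_nf

lemma cl_mul_self {V : Type*} [AddCommGroup V] [Module ℂ V] {B : LinearMap.BilinForm ℂ V}
    (x : V) : cl B x * cl B x = algebraMap ℂ _ (B x x) := by
  rw [CliffordAlgebra.ι_sq_scalar]; rfl

/-- The spin representation `x ↦ α(x) = -(1/4) ∑ v_j [x, u_j] ∈ Cl(𝔨)`, for a dual system. -/
def spinElement (B : LinearMap.BilinForm ℂ 𝔨) (u v : J → 𝔨) : 𝔨 →ₗ[ℂ] Cl B :=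
  (-(1 / 4 : ℂ)) • ∑ j, LinearMap.mulLeft ℂ (cl B (v j)) ∘ₗ cl B ∘ₗ
    ((LieModule.toEnd ℂ 𝔨 𝔨 : 𝔨 →ₗ[ℂ] Module.End ℂ 𝔨).flip (u j))

lemma spinElement_apply (B : LinearMap.BilinForm ℂ 𝔨) (u v : J → 𝔨) (x : 𝔨) :
    spinElement B u v x = (-(1 / 4 : ℂ)) • ∑ j, cl B (v j) * cl B ⁅x, u j⁆ := by
  simp [spinElement]

/-- The cubic term `-(1/12) ∑ v_a v_b [u_a, u_b]` of the Dirac operator. -/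
def cubicTerm (B : LinearMap.BilinForm ℂ 𝔨) (u v : J → 𝔨) : Cl B :=
  (-(1 / 12 : ℂ)) • ∑ a, ∑ b, cl B (v a) * cl B (v b) * cl B ⁅u a, u b⁆

variable {B : LinearMap.BilinForm ℂ 𝔨} {u v : J → 𝔨}

lemma cubicTerm_eq_sum_spinElement :
    cubicTerm B u v = (1 / 3 : ℂ) • ∑ a, cl B (v a) * spinElement B u v (u a) := by
  simp only [cubicTerm, spinElement_apply, Finset.mul_sum, mul_smul_comm, ← Finset.smul_sum,
    smul_smul, ← mul_assoc]
  norm_num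

/-- `α(x)` acts on `𝔨 ⊂ Cl(𝔨)` by commutators as `ad x`. -/
lemma spinElement_commutator (hB : IsQuadratic B) (h : IsDualSystem B u v) (x y : 𝔨) :
    spinElement B u v x * cl B y - cl B y * spinElement B u v x = cl B ⁅x, y⁆ := by
  have key : ∀ j, (cl B (v j) * cl B ⁅x, u j⁆) * cl B y - cl B y * (cl B (v j) * cl B ⁅x, u j⁆) =
      -(2 : ℂ) • (cl B (B ⁅x, y⁆ (u j) • v j) + cl B (B y (v j) • ⁅x, u j⁆)) := by
    intro j
    have h1 := cl_mul_add hB.symm ⁅x, u j⁆ y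
    have h2 := cl_mul_add hB.symm y (v j)
    have h3 : B ⁅x, u j⁆ y = - B ⁅x, y⁆ (u j) := by
      rw [← lie_skew, map_neg, LinearMap.neg_apply, hB.invariant, hB.symm]
    calc _ = cl B (v j) * (cl B ⁅x, u j⁆ * cl B y + cl B y * cl B ⁅x, u j⁆) -
          (cl B y * cl B (v j) + cl B (v j) * cl B y) * cl B ⁅x, u j⁆ := by noncomm_ring
      _ = _ := by
        rw [h1, h2, h3, ← Algebra.commutes, ← Algebra.smul_def, ← Algebra.smul_def, map_smul,
          map_smul]
        module
  simp only [spinElement_apply, smul_mul_assoc, mul_smul_comm, Finset.sum_mul, Finset.mul_sum,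
    ← smul_sub, ← Finset.sum_sub_distrib, key, ← Finset.smul_sum, Finset.sum_add_distrib, ← map_sum]
  have h4 : ∑ j, B ⁅x, y⁆ (u j) • v j = ⁅x, y⁆ := h.symm hB.symm hB.nondegenerate _
  have h5 : ∑ j, B y (v j) • ⁅x, u j⁆ = ⁅x, y⁆ := by
    simp_rw [← lie_smul]
    rw [← lie_sum, h y]
  rw [h4, h5]
  module

lemma sum_cl_mul_cl_lie (hB : IsQuadratic B) (h : IsDualSystem B u v) (x : 𝔨) :
    ∑ j, cl B ⁅x, v j⁆ * cl B (u j) = -∑ j, cl B (v j) * cl B ⁅x, u j⁆ := by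
  have h1 := (h.symm hB.symm hB.nondegenerate).sum_lie hB
    ((LinearMap.mul ℂ (Cl B)).compl₁₂ (cl B) (cl B)) x
  simpa using h1

/-- `[γ, x]₊ = 2 α(x)` for the cubic term `γ`. -/
lemma cubicTerm_anticommutator (hB : IsQuadratic B) (h : IsDualSystem B u v) (x : 𝔨) :
    cubicTerm B u v * cl B x + cl B x * cubicTerm B u v = (2 : ℂ) • spinElement B u v x := by
  have key : ∀ a b, (cl B (v a) * cl B (v b) * cl B ⁅u a, u b⁆) * cl B x +
      cl B x * (cl B (v a) * cl B (v b) * cl B ⁅u a, u b⁆) =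
      (2 : ℂ) • (cl B (v a) * cl B (B ⁅x, u a⁆ (u b) • v b)
        - cl B (v a) * cl B ⁅u a, B x (v b) • u b⁆
        + cl B (v b) * cl B ⁅B x (v a) • u a, u b⁆) := by
    intro a b
    have h1 := cl_mul_add hB.symm ⁅u a, u b⁆ x
    have h2 := cl_mul_add hB.symm x (v a)
    have h3 := cl_mul_add hB.symm x (v b)
    have h4 : B ⁅u a, u b⁆ x = B ⁅x, u a⁆ (u b) := by rw [hB.symm, ← hB.invariant]
    calc _ = cl B (v a) * cl B (v b) * (cl B ⁅u a, u b⁆ * cl B x + cl B x * cl B ⁅u a, u b⁆) -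
          cl B (v a) * (cl B x * cl B (v b) + cl B (v b) * cl B x) * cl B ⁅u a, u b⁆ +
          (cl B x * cl B (v a) + cl B (v a) * cl B x) * (cl B (v b) * cl B ⁅u a, u b⁆) := by
            noncomm_ring
      _ = _ := by
        rw [h1, h2, h3, h4, ← Algebra.commutes, ← Algebra.commutes (2 * B x (v b)),
          mul_assoc (algebraMap ℂ _ _) (cl B (v a)), ← Algebra.smul_def, ← Algebra.smul_def,
          ← Algebra.smul_def]
        simp only [map_smul, lie_smul, smul_lie, mul_smul_comm]
        module
  simp only [cubicTerm, smul_mul_assoc, mul_smul_comm, Finset.sum_mul, Finset.mul_sum,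
    ← smul_add, ← Finset.sum_add_distrib, key]
  simp only [← Finset.smul_sum, Finset.sum_add_distrib, Finset.sum_sub_distrib]
  have h4 : ∀ a, ∑ b, cl B (v a) * cl B (B ⁅x, u a⁆ (u b) • v b) = cl B (v a) * cl B ⁅x, u a⁆ := by
    intro a
    rw [← Finset.mul_sum, ← map_sum]
    congr 2
    exact h.symm hB.symm hB.nondegenerate _
  have h5 : ∀ a, ∑ b, cl B (v a) * cl B ⁅u a, B x (v b) • u b⁆ = -(cl B (v a) * cl B ⁅x, u a⁆) := by
    intro a
    rw [← Finset.mul_sum, ← map_sum, ← lie_sum, h x, ← lie_skew, map_neg, mul_neg]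
  have h6 : ∑ a, ∑ b, cl B (v b) * cl B ⁅B x (v a) • u a, u b⁆ =
      ∑ b, cl B (v b) * cl B ⁅x, u b⁆ := by
    rw [Finset.sum_comm]
    refine Finset.sum_congr rfl fun b _ => ?_
    rw [← Finset.mul_sum, ← map_sum, ← sum_lie, h x]
  simp only [h4, h5, h6, spinElement_apply, Finset.sum_neg_distrib]
  module

/-- The cubic term is invariant. -/
lemma spinElement_commute_cubicTerm (hB : IsQuadratic B) (h : IsDualSystem B u v) (x : 𝔨) :
    spinElement B u v x * cubicTerm B u v = cubicTerm B u v * spinElement B u v x := by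
  set α := spinElement B u v x with hα
  have hc : ∀ y, α * cl B y = cl B y * α + cl B ⁅x, y⁆ := fun y => by
    rw [← spinElement_commutator hB h x y, ← hα]; abel
  have key : ∀ a b, α * (cl B (v a) * cl B (v b) * cl B ⁅u a, u b⁆) =
      (cl B (v a) * cl B (v b) * cl B ⁅u a, u b⁆) * α +
      (cl B ⁅x, v a⁆ * (cl B (v b) * cl B ⁅u a, u b⁆) +
        cl B (v a) * (cl B ⁅x, v b⁆ * cl B ⁅u a, u b⁆)
      + cl B (v a) * cl B (v b) * cl B ⁅⁅x, u a⁆, u b⁆ +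
        cl B (v a) * (cl B (v b) * cl B ⁅u a, ⁅x, u b⁆⁆)) := by
    intro a b
    have h1 : cl B ⁅x, ⁅u a, u b⁆⁆ = cl B ⁅⁅x, u a⁆, u b⁆ + cl B ⁅u a, ⁅x, u b⁆⁆ := by
      rw [← map_add, ← leibniz_lie]
    calc _ = (α * cl B (v a)) * (cl B (v b) * cl B ⁅u a, u b⁆) := by noncomm_ring
      _ = cl B ⁅x, v a⁆ * (cl B (v b) * cl B ⁅u a, u b⁆) +
          cl B (v a) * (α * cl B (v b)) * cl B ⁅u a, u b⁆ := by rw [hc]; noncomm_ring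
      _ = cl B ⁅x, v a⁆ * (cl B (v b) * cl B ⁅u a, u b⁆) +
          cl B (v a) * cl B ⁅x, v b⁆ * cl B ⁅u a, u b⁆ +
          cl B (v a) * cl B (v b) * (α * cl B ⁅u a, u b⁆) := by rw [hc]; noncomm_ring
      _ = _ := by rw [hc, h1]; noncomm_ring
  have hv := h.symm hB.symm hB.nondegenerate
  have lie2 : ∀ y : 𝔨, ∑ j, cl B ⁅x, v j⁆ * cl B ⁅y, u j⁆ = -∑ j, cl B (v j) * cl B ⁅y, ⁅x, u j⁆⁆ :=
    fun y => by
    have h1 := hv.sum_lie hB ((LinearMap.mul ℂ (Cl B)).compl₁₂ (cl B)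
      (cl B ∘ₗ (LieModule.toEnd ℂ 𝔨 𝔨 y))) x
    simpa using h1
  have lie1 : ∑ a, ∑ b, cl B ⁅x, v a⁆ * (cl B (v b) * cl B ⁅u a, u b⁆) =
      -∑ a, ∑ b, cl B (v a) * cl B (v b) * cl B ⁅⁅x, u a⁆, u b⁆ := by
    conv_lhs => rw [Finset.sum_comm]
    conv_rhs => rw [Finset.sum_comm]
    rw [← Finset.sum_neg_distrib]
    refine Finset.sum_congr rfl fun b _ => ?_
    have h1 := hv.sum_lie hB ((LinearMap.mul ℂ (Cl B)).compl₁₂ (cl B)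
      (LinearMap.mulLeft ℂ (cl B (v b)) ∘ₗ cl B ∘ₗ
        ((LieModule.toEnd ℂ 𝔨 𝔨 : 𝔨 →ₗ[ℂ] Module.End ℂ 𝔨).flip (u b)))) x
    simpa [mul_assoc] using h1
  simp only [cubicTerm, smul_mul_assoc, mul_smul_comm, Finset.sum_mul, Finset.mul_sum, key,
    Finset.sum_add_distrib]
  congr 1
  rw [lie1]
  simp only [← Finset.mul_sum, lie2]
  simp

/-- `α : 𝔨 → Cl(𝔨)` is a homomorphism of Lie algebras. -/
lemma spinElement_lie (hB : IsQuadratic B) (h : IsDualSystem B u v) (x y : 𝔨) :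
    spinElement B u v x * spinElement B u v y - spinElement B u v y * spinElement B u v x =
      spinElement B u v ⁅x, y⁆ := by
  set α := spinElement B u v x with hα
  have hc : ∀ y, α * cl B y = cl B y * α + cl B ⁅x, y⁆ := fun y => by
    rw [← spinElement_commutator hB h x y, ← hα]; abel
  have key : ∀ j, α * (cl B (v j) * cl B ⁅y, u j⁆) = (cl B (v j) * cl B ⁅y, u j⁆) * α +
      (cl B ⁅x, v j⁆ * cl B ⁅y, u j⁆ + cl B (v j) * cl B ⁅x, ⁅y, u j⁆⁆) := fun j => by
    calc _ = (α * cl B (v j)) * cl B ⁅y, u j⁆ := by noncomm_ring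
      _ = cl B ⁅x, v j⁆ * cl B ⁅y, u j⁆ + cl B (v j) * (α * cl B ⁅y, u j⁆) := by
          rw [hc]; noncomm_ring
      _ = _ := by rw [hc]; noncomm_ring
  have hv := h.symm hB.symm hB.nondegenerate
  have lie2 : ∑ j, cl B ⁅x, v j⁆ * cl B ⁅y, u j⁆ = -∑ j, cl B (v j) * cl B ⁅y, ⁅x, u j⁆⁆ := by
    have h1 := hv.sum_lie hB ((LinearMap.mul ℂ (Cl B)).compl₁₂ (cl B)
      (cl B ∘ₗ (LieModule.toEnd ℂ 𝔨 𝔨 y))) x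
    simpa using h1
  rw [spinElement_apply B u v y, spinElement_apply B u v ⁅x, y⁆]
  simp only [mul_smul_comm, smul_mul_assoc, Finset.mul_sum, Finset.sum_mul, key, ← smul_sub,
    Finset.sum_add_distrib, lie2, lie_lie, map_sub, mul_sub, Finset.sum_sub_distrib]
  congr 1
  abel

/-- The square of the cubic term is a third of the Casimir element of the spin representation. -/
lemma cubicTerm_sq (hB : IsQuadratic B) (h : IsDualSystem B u v) :
    cubicTerm B u v ^ 2 = (1 / 3 : ℂ) • ∑ a, spinElement B u v (v a) * spinElement B u v (u a) := by
  set γ := cubicTerm B u v with hγ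
  have key : ∀ a, γ * (cl B (v a) * spinElement B u v (u a)) +
      (cl B (v a) * spinElement B u v (u a)) * γ =
      (2 : ℂ) • (spinElement B u v (v a) * spinElement B u v (u a)) := fun a => by
    rw [mul_assoc, hγ, spinElement_commute_cubicTerm hB h, ← mul_assoc, ← mul_assoc, ← add_mul,
      cubicTerm_anticommutator hB h, smul_mul_assoc]
  have h2 : (2 : ℂ) • γ ^ 2 = (2 : ℂ) • ((1 / 3 : ℂ) •
      ∑ a, spinElement B u v (v a) * spinElement B u v (u a)) := by
    calc (2 : ℂ) • γ ^ 2 = γ * γ + γ * γ := by rw [two_smul, sq]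
      _ = γ * ((1 / 3 : ℂ) • ∑ a, cl B (v a) * spinElement B u v (u a)) +
          ((1 / 3 : ℂ) • ∑ a, cl B (v a) * spinElement B u v (u a)) * γ := by
            rw [← cubicTerm_eq_sum_spinElement]
      _ = _ := by
        simp only [mul_smul_comm, smul_mul_assoc, Finset.mul_sum, Finset.sum_mul, ← smul_add,
          ← Finset.sum_add_distrib, key, ← Finset.smul_sum]
        rw [smul_comm]
  exact smul_right_injective _ (two_ne_zero) h2

lemma cubicTerm_sq_commute (hB : IsQuadratic B) (h : IsDualSystem B u v) (x : 𝔨) :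
    cubicTerm B u v ^ 2 * cl B x = cl B x * cubicTerm B u v ^ 2 := by
  set γ := cubicTerm B u v with hγ
  have h1 := cubicTerm_anticommutator hB h x
  have h2 := spinElement_commute_cubicTerm hB h x
  rw [← hγ] at h1 h2
  have h3 : γ ^ 2 * cl B x - cl B x * γ ^ 2 =
      γ * (γ * cl B x + cl B x * γ) - (γ * cl B x + cl B x * γ) * γ := by noncomm_ring
  rw [h1, mul_smul_comm, smul_mul_assoc, h2, sub_self] at h3
  exact sub_eq_zero.mp h3

end Clifford

section Quantization

lemma quantization_ι_mul {V : Type*} [AddCommGroup V] [Module ℂ V] {B : LinearMap.BilinForm ℂ V}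
    (hs : ∀ a b, B a b = B b a) (x : V) (w : ExteriorAlgebra ℂ V) :
    quantization B (ExteriorAlgebra.ι ℂ x * w) =
      cl B x * quantization B w - CliffordAlgebra.contractLeft (B x) (quantization B w) := by
  have h1 : -(QuadraticMap.associated (R := ℂ) (-(LinearMap.BilinMap.toQuadraticMap B))) x =
      B x := by
    ext y
    simp [QuadraticMap.associated_apply, hs y x]
    ring
  rw [← h1]
  exact CliffordAlgebra.changeForm_ι_mul (CliffordAlgebra.changeForm.neg_proof
    CliffordAlgebra.changeForm.associated_neg_proof) x w

lemma quantization_algebraMap {V : Type*} [AddCommGroup V] [Module ℂ V]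
    (B : LinearMap.BilinForm ℂ V) (c : ℂ) :
    quantization B (algebraMap ℂ _ c) = algebraMap ℂ _ c :=
  CliffordAlgebra.changeForm_algebraMap (CliffordAlgebra.changeForm.neg_proof
    CliffordAlgebra.changeForm.associated_neg_proof) c

lemma quantization_ι {V : Type*} [AddCommGroup V] [Module ℂ V] (B : LinearMap.BilinForm ℂ V)
    (x : V) : quantization B (ExteriorAlgebra.ι ℂ x) = cl B x :=
  CliffordAlgebra.changeForm_ι (CliffordAlgebra.changeForm.neg_proof
    CliffordAlgebra.changeForm.associated_neg_proof) x

lemma quantization_ι_mul_ι_mul_ι {V : Type*} [AddCommGroup V] [Module ℂ V]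
    {B : LinearMap.BilinForm ℂ V} (hs : ∀ a b, B a b = B b a) (x y z : V) :
    quantization B (ExteriorAlgebra.ι ℂ x * ExteriorAlgebra.ι ℂ y * ExteriorAlgebra.ι ℂ z) =
      cl B x * cl B y * cl B z - B y z • cl B x - B x y • cl B z + B x z • cl B y := by
  rw [mul_assoc, quantization_ι_mul hs, quantization_ι_mul hs, quantization_ι,
    CliffordAlgebra.contractLeft_ι, map_sub, CliffordAlgebra.contractLeft_ι_mul,
    CliffordAlgebra.contractLeft_ι, CliffordAlgebra.contractLeft_algebraMap, mul_sub,
    ← Algebra.commutes, ← Algebra.commutes, ← Algebra.smul_def, ← Algebra.smul_def, mul_assoc]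
  abel

variable {𝔨 : Type*} [LieRing 𝔨] [LieAlgebra ℂ 𝔨] {J : Type*} [Fintype J]
  {B : LinearMap.BilinForm ℂ 𝔨} {u v : J → 𝔨}

/-- The lower order terms in the quantization of the structure tensor cancel. -/
lemma quantization_structureTensor [FiniteDimensional ℂ 𝔨] (hB : IsQuadratic B) :
    quantization B (structureTensor B hB.nondegenerate) =
      cubicTerm B (Module.finBasis ℂ 𝔨) (B.dualBasis hB.nondegenerate (Module.finBasis ℂ 𝔨)) := by
  set e := Module.finBasis ℂ 𝔨
  set e' := B.dualBasis hB.nondegenerate e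
  have h : IsDualSystem B e e' := isDualSystem_dualBasis hB.symm hB.nondegenerate e
  have hv : IsDualSystem B e' e := h.symm hB.symm hB.nondegenerate
  have pair : ∀ x y, ∑ c, B x (e c) * B y (e' c) = B x y := fun x y => by
    conv_rhs => rw [← h y]
    simp [mul_comm]
  have h1 : ∀ a b, ∑ c, B ⁅e a, e b⁆ (e c) • (cl B (e' a) * cl B (e' b) * cl B (e' c)) =
      cl B (e' a) * cl B (e' b) * cl B ⁅e a, e b⁆ := fun a b => by
    conv_rhs => rw [← hv ⁅e a, e b⁆]
    simp only [map_sum, map_smul, Finset.mul_sum, mul_smul_comm]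
  have h2 : ∀ a, ∑ b, ∑ c, B ⁅e a, e b⁆ (e c) • B (e' b) (e' c) • cl B (e' a) = 0 := fun a => by
    simp only [smul_smul, ← Finset.sum_smul]
    have : ∑ b, ∑ c, B ⁅e a, e b⁆ (e c) * B (e' b) (e' c) = 0 := by
      simp_rw [pair, hB.invariant]
      rw [← map_sum, h.sum_lie_self hB, map_zero]
    rw [this, zero_smul]
  have h3 : ∑ a, ∑ b, ∑ c, B ⁅e a, e b⁆ (e c) • B (e' a) (e' b) • cl B (e' c) = 0 := by
    have : ∀ a b, ∑ c, B ⁅e a, e b⁆ (e c) • B (e' a) (e' b) • cl B (e' c) =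
        cl B ⁅e a, B (e' a) (e' b) • e b⁆ := fun a b => by
      conv_rhs => rw [lie_smul, map_smul, ← hv ⁅e a, e b⁆, map_sum, Finset.smul_sum]
      exact Finset.sum_congr rfl fun c _ => by rw [map_smul, smul_comm]
    simp_rw [this, ← map_sum, ← lie_sum]
    have h4 : ∀ a, ∑ b, B (e' a) (e' b) • e b = e' a := fun a => h _
    simp_rw [h4, h.sum_lie_self hB, map_zero]
  have h5 : ∑ a, ∑ b, ∑ c, B ⁅e a, e b⁆ (e c) • B (e' a) (e' c) • cl B (e' b) = 0 := by
    rw [Finset.sum_comm]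
    refine Finset.sum_eq_zero fun b _ => ?_
    simp only [smul_smul, ← Finset.sum_smul]
    have : ∑ a, ∑ c, B ⁅e a, e b⁆ (e c) * B (e' a) (e' c) = 0 := by
      have h6 : ∀ a, B ⁅e a, e b⁆ (e' a) = -B ⁅e a, e' a⁆ (e b) := fun a => by
        rw [hB.invariant, hB.invariant, ← lie_skew, map_neg]
      simp_rw [pair, h6]
      rw [Finset.sum_neg_distrib, ← LinearMap.sum_apply, ← map_sum, h.sum_lie_self hB, map_zero]
      simp
    rw [this, zero_smul]
  change quantization B ((-(1 / 12 : ℂ)) • ∑ a, ∑ b, ∑ c, B ⁅e a, e b⁆ (e c) •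
    (ExteriorAlgebra.ι ℂ (e' a) * ExteriorAlgebra.ι ℂ (e' b) * ExteriorAlgebra.ι ℂ (e' c))) =
    (-(1 / 12 : ℂ)) • ∑ a, ∑ b, cl B (e' a) * cl B (e' b) * cl B ⁅e a, e b⁆
  simp only [map_smul, map_sum, quantization_ι_mul_ι_mul_ι hB.symm, smul_add, smul_sub,
    Finset.sum_add_distrib, Finset.sum_sub_distrib, h1, h3, h5]
  simp [h2]

/-- The supercommutator with a vector is a contraction. -/
lemma cl_mul_sub_involute_mul (hs : ∀ a b, B a b = B b a) (x : 𝔨) (w : Cl B) :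
    cl B x * w - CliffordAlgebra.involute w * cl B x =
      CliffordAlgebra.contractLeft ((2 : ℂ) • B x) w := by
  induction w using CliffordAlgebra.left_induction with
  | algebraMap r => simp [Algebra.commutes]
  | add a b ha hb =>
    rw [map_add, map_add, ← ha, ← hb]
    noncomm_ring
  | ι_mul b m hb =>
    have h1 := cl_mul_add hs x m
    have h2 : cl B x * (cl B m * b) - CliffordAlgebra.involute (cl B m * b) * cl B x =
        (cl B x * cl B m + cl B m * cl B x) * b
          - cl B m * (cl B x * b - CliffordAlgebra.involute b * cl B x) := by
      rw [map_mul, CliffordAlgebra.involute_ι]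
      noncomm_ring
    rw [CliffordAlgebra.contractLeft_ι_mul, ← hb, h2, h1, ← Algebra.smul_def]
    simp

/-- The Euler operator: if all contractions of an element of the exterior algebra vanish, the
element is a scalar. -/
lemma exists_algebraMap_of_contractLeft_eq_zero {V : Type*} [AddCommGroup V] [Module ℂ V]
    [FiniteDimensional ℂ V] (w : ExteriorAlgebra ℂ V)
    (hw : ∀ d : Dual ℂ V, CliffordAlgebra.contractLeft (Q := (0 : QuadraticForm ℂ V)) d w = 0) :
    ∃ c : ℂ, w = algebraMap ℂ _ c := by
  let e := Module.finBasis ℂ V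
  let E : ExteriorAlgebra ℂ V →ₗ[ℂ] ExteriorAlgebra ℂ V :=
    ∑ a, LinearMap.mulLeft ℂ (ExteriorAlgebra.ι ℂ (e a)) ∘ₗ
      CliffordAlgebra.contractLeft (Q := (0 : QuadraticForm ℂ V)) (e.coord a)
  have hE : ∀ m w, E (ExteriorAlgebra.ι ℂ m * w) =
      ExteriorAlgebra.ι ℂ m * w + ExteriorAlgebra.ι ℂ m * E w := by
    intro m w
    have h1 : ∀ a, ExteriorAlgebra.ι ℂ (e a) *
        CliffordAlgebra.contractLeft (Q := (0 : QuadraticForm ℂ V)) (e.coord a)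
          (ExteriorAlgebra.ι ℂ m * w) = ExteriorAlgebra.ι ℂ (e.repr m a • e a) * w +
        ExteriorAlgebra.ι ℂ m * (ExteriorAlgebra.ι ℂ (e a) *
          CliffordAlgebra.contractLeft (Q := (0 : QuadraticForm ℂ V)) (e.coord a) w) := by
      intro a
      have h2 : ExteriorAlgebra.ι ℂ (e a) * ExteriorAlgebra.ι ℂ m =
          -(ExteriorAlgebra.ι ℂ m * ExteriorAlgebra.ι ℂ (e a)) :=
        eq_neg_of_add_eq_zero_left (ExteriorAlgebra.ι_add_mul_swap _ _)
      rw [ExteriorAlgebra.ι, CliffordAlgebra.contractLeft_ι_mul, ← ExteriorAlgebra.ι, mul_sub,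
        ← mul_assoc _ (ExteriorAlgebra.ι ℂ m), h2, ← mul_assoc, map_smul]
      simp
    simp only [E, LinearMap.sum_apply, LinearMap.comp_apply, LinearMap.mulLeft_apply, h1,
      Finset.sum_add_distrib, ← Finset.sum_mul, ← Finset.mul_sum, ← map_sum, e.sum_repr]
  have hn : ∀ (n : ℕ) (x : ExteriorAlgebra ℂ V), x ∈ ⋀[ℂ]^n V → E x = (n : ℂ) • x := by
    intro n x hx
    induction hx using Submodule.pow_induction_on_left' with
    | algebraMap r => simp [E, CliffordAlgebra.contractLeft_algebraMap]
    | add x y i _ _ hx hy => rw [map_add, hx, hy, smul_add]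
    | mem_mul m hm i x _ hx =>
      obtain ⟨m, rfl⟩ := hm
      rw [hE, hx, mul_smul_comm, Nat.cast_succ, add_smul, one_smul, add_comm]
  have hEw : E w = 0 := by simp [E, hw]
  classical
  let dec := fun n : ℕ => (⋀[ℂ]^n V : Submodule ℂ (ExteriorAlgebra ℂ V))
  have hsum : ∀ x : ExteriorAlgebra ℂ V, ∑ i ∈ (DirectSum.decompose dec x).support,
    (DirectSum.decompose dec x i : ExteriorAlgebra ℂ V) = x := DirectSum.sum_support_decompose dec
  have hcomp : ∀ n : ℕ, (n : ℂ) • (DirectSum.decompose dec w n : ExteriorAlgebra ℂ V) = 0 := by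
    intro n
    have h1 : E w = ∑ i ∈ (DirectSum.decompose dec w).support,
        (i : ℂ) • (DirectSum.decompose dec w i : ExteriorAlgebra ℂ V) := by
      conv_lhs => rw [← hsum w]
      rw [map_sum]
      exact Finset.sum_congr rfl fun i _ => hn i _ (DirectSum.decompose dec w i).2
    rw [hEw] at h1
    have h2 := congrArg (fun x => (DirectSum.decompose dec x n : ExteriorAlgebra ℂ V)) h1
    simp only [DirectSum.decompose_zero, DirectSum.zero_apply, ZeroMemClass.coe_zero,
      DirectSum.decompose_sum, DirectSum.decompose_smul, DirectSum.decompose_coe,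
      DirectSum.sum_apply, AddSubmonoidClass.coe_finsetSum] at h2
    by_cases hs : n ∈ (DirectSum.decompose dec w).support
    · rw [Finset.sum_eq_single n] at h2
      · rw [DirectSum.smul_apply, DirectSum.of_eq_same] at h2
        exact h2.symm
      · intro b _ hb
        simp [DirectSum.smul_apply, DirectSum.of_eq_of_ne _ _ _ (Ne.symm hb)]
      · exact fun h => absurd hs h
    · rw [DFinsupp.notMem_support_iff.mp hs]
      simp
  have hz : ∀ n : ℕ, n ≠ 0 → (DirectSum.decompose dec w n : ExteriorAlgebra ℂ V) = 0 := fun n hn0 =>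
    (smul_eq_zero.mp (hcomp n)).resolve_left (Nat.cast_ne_zero.mpr hn0)
  have hw0 : w = (DirectSum.decompose dec w 0 : ExteriorAlgebra ℂ V) := by
    conv_lhs => rw [← hsum w]
    refine Finset.sum_eq_single 0 (fun n _ h => hz n h) fun h => ?_
    rw [DFinsupp.notMem_support_iff.mp h]
    rfl
  have := (DirectSum.decompose dec w 0).2
  rw [← hw0] at this
  simp only [dec, pow_zero, Submodule.mem_one] at this
  obtain ⟨c, hc⟩ := this
  exact ⟨c, hc.symm⟩

/-- The square of the cubic term is a scalar: it is even and central. -/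
lemma exists_cubicTerm_sq_eq [FiniteDimensional ℂ 𝔨] (hB : IsQuadratic B)
    (h : IsDualSystem B u v) : ∃ c : ℂ, cubicTerm B u v ^ 2 = algebraMap ℂ _ c := by
  have hinv : CliffordAlgebra.involute (cubicTerm B u v ^ 2) = cubicTerm B u v ^ 2 := by
    have : CliffordAlgebra.involute (cubicTerm B u v) = -cubicTerm B u v := by
      simp [cubicTerm, CliffordAlgebra.involute_ι]
    rw [map_pow, this, neg_sq]
  have h0 : ∀ x, CliffordAlgebra.contractLeft (B x) (cubicTerm B u v ^ 2) = 0 := by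
    intro x
    have h1 := cl_mul_sub_involute_mul hB.symm x (cubicTerm B u v ^ 2)
    rw [hinv, cubicTerm_sq_commute hB h, sub_self, map_smul, LinearMap.smul_apply] at h1
    exact (smul_eq_zero.mp h1.symm).resolve_left two_ne_zero
  obtain ⟨c, hc⟩ := exists_algebraMap_of_contractLeft_eq_zero
    ((quantization B).symm (cubicTerm B u v ^ 2)) fun d => by
      obtain ⟨x, rfl⟩ := (B.toDual hB.nondegenerate).surjective d
      have := CliffordAlgebra.changeForm_contractLeft
        (CliffordAlgebra.changeForm.associated_neg_proof
          (Q := LinearMap.BilinMap.toQuadraticMap B)) (B x) (cubicTerm B u v ^ 2)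
      rw [h0, map_zero] at this
      exact this.symm
  refine ⟨c, ?_⟩
  rw [LinearEquiv.symm_apply_eq] at hc
  rw [hc]
  exact quantization_algebraMap B c

/-- Kostant's formula for the square of the cubic Dirac operator, shifted by a vector `x`. It holds
in any algebra to which `𝔘(𝔨)` and `Cl(𝔨)` map with commuting images. -/
lemma dirac_sq {A : Type*} [Ring A] [Algebra ℂ A] (hB : IsQuadratic B) (h : IsDualSystem B u v)
    (E : 𝔨 →ₗ[ℂ] A) (K : Cl B →ₐ[ℂ] A) (hEE : ∀ x y, E x * E y - E y * E x = E ⁅x, y⁆)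
    (hEK : ∀ x w, E x * K w = K w * E x) (x : 𝔨) :
    (∑ a, E (v a) * K (cl B (u a)) + K (cubicTerm B u v) + K (cl B x)) ^ 2 =
      ∑ a, E (v a) * E (u a) + K (cubicTerm B u v ^ 2) +
        (2 : ℂ) • (E x + K (spinElement B u v x)) + algebraMap ℂ A (B x x) := by
  set γ := cubicTerm B u v with hγ
  set α := spinElement B u v with hα
  set X := ∑ a, E (v a) * K (cl B (u a)) with hX
  have hv := h.symm hB.symm hB.nondegenerate
  have hXw : ∀ w, X * K w + K w * X = ∑ a, E (v a) * K (cl B (u a) * w + w * cl B (u a)) := by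
    intro w
    rw [hX, Finset.sum_mul, Finset.mul_sum, ← Finset.sum_add_distrib]
    refine Finset.sum_congr rfl fun a _ => ?_
    rw [← mul_assoc, ← hEK, mul_assoc, mul_assoc, ← map_mul, ← map_mul, ← mul_add, ← map_add]
  have hXγ : X * K γ + K γ * X = (2 : ℂ) • ∑ a, E (v a) * K (α (u a)) := by
    rw [hXw, Finset.smul_sum]
    refine Finset.sum_congr rfl fun a _ => ?_
    rw [add_comm, cubicTerm_anticommutator hB h, map_smul, mul_smul_comm]
  have hXx : X * K (cl B x) + K (cl B x) * X = (2 : ℂ) • E x := by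
    rw [hXw]
    conv_rhs => rw [← hv x, map_sum, Finset.smul_sum]
    refine Finset.sum_congr rfl fun a _ => ?_
    rw [cl_mul_add hB.symm, AlgHom.commutes, ← Algebra.commutes, ← Algebra.smul_def, map_smul,
      smul_smul, hB.symm]
  have hγx : K γ * K (cl B x) + K (cl B x) * K γ = (2 : ℂ) • K (α x) := by
    rw [← map_mul, ← map_mul, ← map_add, cubicTerm_anticommutator hB h, map_smul]
  have hxx : K (cl B x) * K (cl B x) = algebraMap ℂ A (B x x) := by
    rw [← map_mul, cl_mul_self, AlgHom.commutes]
  -- antisymmetrising in one factor turns `X²` into the Casimir element and a commutator term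
  have hXX : (2 : ℂ) • (X * X) = (2 : ℂ) • ∑ a, E (v a) * E (u a) -
      (4 : ℂ) • ∑ a, E (v a) * K (α (u a)) := by
    have e1 : X * X = ∑ a, ∑ b, (E (v a) * E (v b)) * K (cl B (u a) * cl B (u b)) := by
      rw [hX, Finset.sum_mul_sum]
      refine Finset.sum_congr rfl fun a _ => Finset.sum_congr rfl fun b _ => ?_
      rw [map_mul, mul_assoc, ← mul_assoc (K _), ← hEK]
      noncomm_ring
    have e2 : X * X = ∑ a, ∑ b, (E (v b) * E (v a)) * K (cl B (u b) * cl B (u a)) := by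
      rw [e1, Finset.sum_comm]
    have e3 : ∀ a b, (E (v a) * E (v b)) * K (cl B (u a) * cl B (u b)) +
        (E (v b) * E (v a)) * K (cl B (u b) * cl B (u a)) =
        (2 : ℂ) • (E (v a) * E (B (u a) (u b) • v b)) -
          E ⁅v a, v b⁆ * K (cl B (u b)) * K (cl B (u a)) := by
      intro a b
      rw [← hEE]
      calc _ = (E (v a) * E (v b)) * K (cl B (u a) * cl B (u b) + cl B (u b) * cl B (u a)) -
          (E (v a) * E (v b) - E (v b) * E (v a)) * K (cl B (u b) * cl B (u a)) := by
            rw [map_add]; noncomm_ring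
        _ = _ := by
          rw [cl_mul_add hB.symm, AlgHom.commutes, ← Algebra.commutes, ← Algebra.smul_def,
            map_smul, mul_smul_comm, smul_smul, map_mul K, mul_assoc _ (K _)]
    have e4 : ∀ a, ∑ b, E (v a) * E (B (u a) (u b) • v b) = E (v a) * E (u a) := fun a => by
      rw [← Finset.mul_sum, ← map_sum, hv (u a)]
    have e5 : ∀ a, ∑ b, E ⁅v a, v b⁆ * K (cl B (u b)) = -∑ b, E (v b) * K (cl B ⁅v a, u b⁆) :=
      fun a => by
      have := hv.sum_lie hB ((LinearMap.mul ℂ A).compl₁₂ E (K.toLinearMap ∘ₗ cl B)) (v a)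
      simpa using this
    have e6 : ∑ a, ∑ b, E ⁅v a, v b⁆ * K (cl B (u b)) * K (cl B (u a)) =
        (4 : ℂ) • ∑ a, E (v a) * K (α (u a)) := by
      simp_rw [← Finset.sum_mul, e5, neg_mul, Finset.sum_mul]
      rw [Finset.sum_neg_distrib, Finset.sum_comm, Finset.smul_sum, ← Finset.sum_neg_distrib]
      refine Finset.sum_congr rfl fun b _ => ?_
      have : ∑ a, cl B ⁅v a, u b⁆ * cl B (u a) = -((4 : ℂ) • α (u b)) := by
        have e7 : ∀ a, cl B ⁅v a, u b⁆ * cl B (u a) = -(cl B ⁅u b, v a⁆ * cl B (u a)) := fun a => by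
          rw [← lie_skew, map_neg, neg_mul]
        simp_rw [e7]
        rw [Finset.sum_neg_distrib, sum_cl_mul_cl_lie hB h, hα, spinElement_apply, smul_smul]
        norm_num
      simp_rw [mul_assoc, ← map_mul]
      rw [← Finset.mul_sum, ← map_sum, this, map_neg, map_smul, mul_neg, neg_neg, mul_smul_comm]
    rw [two_smul]
    nth_rw 1 [e1]
    rw [e2]
    simp_rw [← Finset.sum_add_distrib, e3, Finset.sum_sub_distrib, e6, ← Finset.smul_sum, e4]
  have hXX' : X * X = ∑ a, E (v a) * E (u a) - (2 : ℂ) • ∑ a, E (v a) * K (α (u a)) := by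
    refine smul_right_injective _ (two_ne_zero (α := ℂ)) ?_
    simp only [hXX, smul_sub, smul_smul]
    norm_num
  calc _ = X * X + (X * K γ + K γ * X) + K γ ^ 2 + (X * K (cl B x) + K (cl B x) * X) +
        (K γ * K (cl B x) + K (cl B x) * K γ) + K (cl B x) * K (cl B x) := by noncomm_ring
    _ = _ := by
      rw [hXγ, hXx, hγx, hxx, hXX', map_pow]
      module

end Quantization

/-! ### Functoriality of Clifford algebras -/

section CliffordMap

variable {V W : Type*} [AddCommGroup V] [Module ℂ V] [AddCommGroup W] [Module ℂ W]

lemma contractLeft_map {Q₁ : QuadraticForm ℂ V} {Q₂ : QuadraticForm ℂ W} (f : Q₁ →qᵢ Q₂)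
    (d : Dual ℂ W) (w : CliffordAlgebra Q₁) :
    CliffordAlgebra.contractLeft d (CliffordAlgebra.map f w) =
      CliffordAlgebra.map f (CliffordAlgebra.contractLeft (d ∘ₗ f.toLinearMap) w) := by
  induction w using CliffordAlgebra.left_induction with
  | algebraMap r => simp [CliffordAlgebra.contractLeft_algebraMap]
  | add a b ha hb => simp only [map_add, ha, hb]
  | ι_mul b m hb =>
    rw [map_mul, CliffordAlgebra.map_apply_ι, CliffordAlgebra.contractLeft_ι_mul,
      CliffordAlgebra.contractLeft_ι_mul, hb, map_sub, map_mul, map_smul,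
      CliffordAlgebra.map_apply_ι]
    rfl

/-- Quantization is natural, so that injectivity may be checked in the exterior algebra. -/
lemma cliffordMap_injective {B₁ : LinearMap.BilinForm ℂ V} {B₂ : LinearMap.BilinForm ℂ W}
    (hs₁ : ∀ a b, B₁ a b = B₁ b a) (hs₂ : ∀ a b, B₂ a b = B₂ b a)
    (f : LinearMap.BilinMap.toQuadraticMap B₁ →qᵢ LinearMap.BilinMap.toQuadraticMap B₂)
    (hf : Function.Injective f) : Function.Injective (CliffordAlgebra.map f) := by
  have hB : ∀ x, B₂ (f x) ∘ₗ f.toLinearMap = B₁ x := by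
    intro x
    ext y
    have h1 : B₂ (f (x + y)) (f (x + y)) = B₁ (x + y) (x + y) := f.map_app (x + y)
    have h2 : B₂ (f x) (f x) = B₁ x x := f.map_app x
    have h3 : B₂ (f y) (f y) = B₁ y y := f.map_app y
    simp only [map_add, LinearMap.add_apply] at h1
    rw [hs₁ y x, hs₂ (f y) (f x), h2, h3] at h1
    change B₂ (f x) (f y) = _
    linear_combination h1 / 2
  have key : ∀ w : ExteriorAlgebra ℂ V, CliffordAlgebra.map f (quantization B₁ w) =
      quantization B₂ (ExteriorAlgebra.map f.toLinearMap w) := by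
    intro w
    induction w using CliffordAlgebra.left_induction with
    | algebraMap r =>
      change CliffordAlgebra.map f (quantization B₁ (algebraMap ℂ (ExteriorAlgebra ℂ V) r)) =
        quantization B₂ (ExteriorAlgebra.map _ (algebraMap ℂ (ExteriorAlgebra ℂ V) r))
      rw [AlgHom.commutes, quantization_algebraMap, quantization_algebraMap, AlgHom.commutes]
    | add a b ha hb => simp only [map_add, ha, hb]
    | ι_mul b m hb =>
      change CliffordAlgebra.map f (quantization B₁ (ExteriorAlgebra.ι ℂ m * b)) =
        quantization B₂ (ExteriorAlgebra.map f.toLinearMap (ExteriorAlgebra.ι ℂ m * b))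
      rw [quantization_ι_mul hs₁, map_sub, map_mul, CliffordAlgebra.map_apply_ι, hb, map_mul,
        ExteriorAlgebra.map_apply_ι]
      change _ = quantization B₂ (ExteriorAlgebra.ι ℂ (f m) * _)
      rw [quantization_ι_mul hs₂, ← hb, contractLeft_map, hB]
  intro a b hab
  obtain ⟨a, rfl⟩ := (quantization B₁).surjective a
  obtain ⟨b, rfl⟩ := (quantization B₁).surjective b
  rw [key, key] at hab
  congr 1
  refine ExteriorAlgebra.map_injective_field (f := f.toLinearMap) (LinearMap.ker_eq_bot.mpr hf) ?_
  exact (quantization B₂).injective hab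

end CliffordMap

/-! ### The factorwise Laplace families -/

section Factor

variable {𝔨 : Type*} [LieRing 𝔨] [LieAlgebra ℂ 𝔨] {r : ℕ} (dec : ReductiveDecomposition 𝔨 r)

/-- The projection of `𝔨` onto the `i`-th factor of a decomposition. -/
def ReductiveDecomposition.proj (i : Fin (r + 1)) : 𝔨 →ₗ[ℂ] 𝔨 :=
  (dec.ideal i).toSubmodule.subtype ∘ₗ
    DirectSum.component ℂ _ (fun i => (dec.ideal i).toSubmodule) i ∘ₗ
    (LinearEquiv.ofBijective (DirectSum.coeLinearMap fun i => (dec.ideal i).toSubmodule)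
      dec.isInternal).symm.toLinearMap

namespace ReductiveDecomposition

lemma proj_mem (i : Fin (r + 1)) (x : 𝔨) : dec.proj i x ∈ dec.ideal i := by
  simp only [proj, LinearMap.comp_apply]
  exact Subtype.property _

lemma ofBijective_symm_of_mem {j : Fin (r + 1)} {x : 𝔨} (hx : x ∈ dec.ideal j) :
    (LinearEquiv.ofBijective (DirectSum.coeLinearMap fun i => (dec.ideal i).toSubmodule)
      dec.isInternal).symm x =
      DirectSum.lof ℂ _ (fun i => (dec.ideal i).toSubmodule) j ⟨x, hx⟩ := by
  rw [LinearEquiv.symm_apply_eq]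
  exact (DirectSum.coeLinearMap_lof (fun i => (dec.ideal i).toSubmodule) j ⟨x, hx⟩).symm

lemma proj_of_mem {i : Fin (r + 1)} {x : 𝔨} (hx : x ∈ dec.ideal i) : dec.proj i x = x := by
  simp only [proj, LinearMap.comp_apply, LinearEquiv.coe_coe, ofBijective_symm_of_mem dec hx,
    DirectSum.component.lof_self]
  rfl

lemma proj_of_mem_of_ne {i j : Fin (r + 1)} (hij : i ≠ j) {x : 𝔨} (hx : x ∈ dec.ideal j) :
    dec.proj i x = 0 := by
  simp only [proj, LinearMap.comp_apply, LinearEquiv.coe_coe, ofBijective_symm_of_mem dec hx]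
  rw [DirectSum.component.of, dif_neg hij.symm]
  rfl

lemma sum_proj (x : 𝔨) : ∑ i, dec.proj i x = x := by
  have hx : x ∈ ⨆ i, (dec.ideal i).toSubmodule := by
    rw [dec.isInternal.submodule_iSup_eq_top]; trivial
  induction hx using Submodule.iSup_induction' with
  | mem i x hx =>
    rw [Finset.sum_eq_single i (fun j _ hj => dec.proj_of_mem_of_ne hj hx)
      (fun h => absurd (Finset.mem_univ i) h), dec.proj_of_mem hx]
  | zero => simp
  | add x y _ _ hx hy => simp only [map_add, Finset.sum_add_distrib, hx, hy]

lemma lie_proj (i : Fin (r + 1)) (x y : 𝔨) : ⁅x, dec.proj i y⁆ = dec.proj i ⁅x, y⁆ := by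
  conv_rhs => rw [← dec.sum_proj y, lie_sum, map_sum]
  rw [Finset.sum_eq_single i (fun j _ hj => dec.proj_of_mem_of_ne hj.symm
    (lie_mem_right ℂ 𝔨 _ _ _ (dec.proj_mem j y))) (fun h => absurd (Finset.mem_univ i) h)]
  exact (dec.proj_of_mem (lie_mem_right ℂ 𝔨 _ _ _ (dec.proj_mem i y))).symm

lemma proj_lie (i : Fin (r + 1)) (x y : 𝔨) : ⁅dec.proj i x, y⁆ = dec.proj i ⁅x, y⁆ := by
  rw [← lie_skew, lie_proj, ← lie_skew x y, map_neg]

lemma proj_proj (i : Fin (r + 1)) (x : 𝔨) : dec.proj i (dec.proj i x) = dec.proj i x :=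
  dec.proj_of_mem (dec.proj_mem i x)

lemma proj_lie_proj (i : Fin (r + 1)) (x y : 𝔨) :
    ⁅dec.proj i x, dec.proj i y⁆ = ⁅x, dec.proj i y⁆ := by
  rw [dec.proj_lie, ← dec.lie_proj, dec.proj_proj]

lemma lie_proj_zero (x y : 𝔨) : ⁅x, dec.proj 0 y⁆ = 0 := by
  have h := dec.proj_mem 0 y
  rw [dec.ideal_zero] at h
  exact (LieModule.mem_maxTrivSubmodule ℂ 𝔨 𝔨 _).mp h x

lemma form_proj {B : LinearMap.BilinForm ℂ 𝔨} (hB : IsQuadratic B) (i : Fin (r + 1)) (x y : 𝔨) :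
    B (dec.proj i x) y = B (dec.proj i x) (dec.proj i y) := by
  conv_lhs => rw [← dec.sum_proj y, map_sum]
  exact Finset.sum_eq_single i (fun j _ hj => dec.orthogonal hB hj.symm (dec.proj_mem i x)
    (dec.proj_mem j y)) (fun h => absurd (Finset.mem_univ i) h)

lemma form_proj_left {B : LinearMap.BilinForm ℂ 𝔨} (hB : IsQuadratic B) (i : Fin (r + 1))
    (x y : 𝔨) : B (dec.proj i x) y = B x (dec.proj i y) := by
  rw [form_proj dec hB, hB.symm x, form_proj dec hB i y x, hB.symm]

lemma isQuadratic_restrictForm {B : LinearMap.BilinForm ℂ 𝔨} (hB : IsQuadratic B)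
    (i : Fin (r + 1)) : IsQuadratic (restrictForm B (dec.ideal i)) where
  symm a b := hB.symm a b
  nondegenerate := dec.nondegenerate hB i
  invariant a b c := hB.invariant a b c

end ReductiveDecomposition

variable {B : LinearMap.BilinForm ℂ 𝔨} {J : Type*} [Fintype J] {u v : J → 𝔨}

/-- On a factor, the spin representation is computed by the dual system of the whole algebra. -/
lemma sum_cl_proj_mul_cl_lie_proj (hB : IsQuadratic B) (h : IsDualSystem B u v) (i : Fin (r + 1))
    (x : 𝔨) : ∑ j, cl B (dec.proj i (v j)) * cl B ⁅dec.proj i x, dec.proj i (u j)⁆ =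
      ∑ j, cl B (v j) * cl B ⁅dec.proj i x, u j⁆ := by
  have h1 := (h.symm hB.symm hB.nondegenerate).sum_adjoint hB.symm hB.nondegenerate
    ((LinearMap.mul ℂ (Cl B)).compl₁₂ (cl B) (cl B ∘ₗ LieModule.toEnd ℂ 𝔨 𝔨 (dec.proj i x)))
    (dec.form_proj_left hB i)
  simp only [LinearMap.compl₁₂_apply, LinearMap.comp_apply, LieModule.toEnd_apply_apply,
    LinearMap.mul_apply'] at h1
  have h2 : ∀ y, ⁅dec.proj i x, dec.proj i y⁆ = ⁅dec.proj i x, y⁆ := fun y => by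
    rw [dec.lie_proj, ← dec.proj_lie, dec.proj_proj]
  simp_rw [h2] at h1 ⊢
  exact h1

variable [FiniteDimensional ℂ 𝔨]

/-- The Laplace family of a factor, for a dual system of the whole algebra: a Casimir element, a
constant which is a third of the Casimir element of the spin representation, the diagonal action of
a vector, and the square of that vector. -/
lemma laplaceFactor_eq (hB : IsQuadratic B) (h : IsDualSystem B u v) (i : Fin (r + 1)) :
    ∃ c : ℂ, algebraMap ℂ (Cl B) c = (1 / 3 : ℂ) •
        ∑ j, spinElement B u v (dec.proj i (v j)) * spinElement B u v (dec.proj i (u j)) ∧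
      ∀ x : 𝔨, laplaceFactor dec hB (B x) i =
        ∑ j, (UniversalEnvelopingAlgebra.ι ℂ (dec.proj i (v j)) *
            UniversalEnvelopingAlgebra.ι ℂ (dec.proj i (u j))) ⊗ₜ[ℂ] (1 : Cl B) +
          algebraMap ℂ (Weil B) c +
          (2 : ℂ) • (UniversalEnvelopingAlgebra.ι ℂ (dec.proj i x) ⊗ₜ[ℂ] (1 : Cl B) +
            1 ⊗ₜ[ℂ] spinElement B u v (dec.proj i x)) +
          algebraMap ℂ (Weil B) (B (dec.proj i x) (dec.proj i x)) := by
  classical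
  let I := dec.ideal i
  let BI := restrictForm B I
  have hBI : IsQuadratic BI := dec.isQuadratic_restrictForm hB i
  let uI : J → I := fun j => ⟨dec.proj i (u j), dec.proj_mem i _⟩
  let vI : J → I := fun j => ⟨dec.proj i (v j), dec.proj_mem i _⟩
  have hI : IsDualSystem BI uI vI := fun x => by
    refine Subtype.ext ?_
    have h1 : (x : 𝔨) = dec.proj i x := (dec.proj_of_mem x.2).symm
    have h2 := congrArg (dec.proj i) (h (x : 𝔨))
    rw [map_sum, ← h1] at h2
    have h3 : ((∑ j, BI x (vI j) • uI j : I) : 𝔨) = ∑ j, BI x (vI j) • (uI j : 𝔨) := by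
      simp
    rw [h3]
    conv_rhs => rw [← h2]
    refine Finset.sum_congr rfl fun j _ => ?_
    rw [map_smul]
    congr 1
    change B (x : 𝔨) (dec.proj i (v j)) = _
    rw [h1, ← dec.form_proj hB]
  let e := Module.finBasis ℂ I
  let e' := BI.dualBasis hBI.nondegenerate e
  have he : IsDualSystem BI e e' := isDualSystem_dualBasis hBI.symm hBI.nondegenerate e
  obtain ⟨c, hc⟩ := exists_cubicTerm_sq_eq hBI he
  let cm : Cl BI →ₐ[ℂ] Cl B := CliffordAlgebra.map
      { toLinearMap := I.toSubmodule.subtype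
        map_app' := fun _ => rfl }
  have hcm : ∀ y : I, cm (cl BI y) = cl B (y : 𝔨) := fun y => CliffordAlgebra.map_apply_ι _ _
  have hα : ∀ y : I, cm (spinElement BI e e' y) = spinElement B u v (y : 𝔨) := by
    intro y
    have h1 : ∑ a, cl BI (e' a) * cl BI ⁅y, e a⁆ = ∑ j, cl BI (vI j) * cl BI ⁅y, uI j⁆ := by
      have := (he.symm hBI.symm hBI.nondegenerate).sum_eq hBI.symm hBI.nondegenerate
        (hI.symm hBI.symm hBI.nondegenerate)
        ((LinearMap.mul ℂ (Cl BI)).compl₁₂ (cl BI) (cl BI ∘ₗ LieModule.toEnd ℂ I I y))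
      simpa using this
    rw [spinElement_apply, h1, map_smul, map_sum, spinElement_apply]
    simp only [map_mul, hcm]
    have h2 := sum_cl_proj_mul_cl_lie_proj dec hB h i (y : 𝔨)
    rw [dec.proj_of_mem y.2] at h2
    rw [← h2]
    rfl
  have hcas : ∀ {M : Type _} [AddCommGroup M] [Module ℂ M] (F : I →ₗ[ℂ] I →ₗ[ℂ] M),
      ∑ a, F (e' a) (e a) = ∑ j, F (vI j) (uI j) := fun F =>
    (he.symm hBI.symm hBI.nondegenerate).sum_eq hBI.symm hBI.nondegenerate
        (hI.symm hBI.symm hBI.nondegenerate) F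
  refine ⟨c, ?_, fun x => ?_⟩
  · have h1 := congrArg cm hc
    rw [cubicTerm_sq hBI he, map_smul, map_sum, AlgHom.commutes] at h1
    rw [← h1]
    congr 1
    simp only [map_mul, hα]
    have := hcas ((LinearMap.mul ℂ (Cl B)).compl₁₂ (spinElement B u v ∘ₗ I.toSubmodule.subtype)
      (spinElement B u v ∘ₗ I.toSubmodule.subtype))
    exact this
  · let E : I →ₗ[ℂ] Weil BI := Algebra.TensorProduct.includeLeft.toLinearMap ∘ₗ
      (UniversalEnvelopingAlgebra.ι ℂ : I →ₗ⁅ℂ⁆ UniversalEnvelopingAlgebra ℂ I).toLinearMap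
    let K : Cl BI →ₐ[ℂ] Weil BI := Algebra.TensorProduct.includeRight
    have hE : ∀ y, E y = UniversalEnvelopingAlgebra.ι ℂ y ⊗ₜ[ℂ] 1 := fun y => rfl
    have hK : ∀ w, K w = 1 ⊗ₜ[ℂ] w := fun y => rfl
    let px : I := ⟨dec.proj i x, dec.proj_mem i x⟩
    have hsq := dirac_sq hBI he E K
      (fun a b => by
        rw [hE, hE, hE, Algebra.TensorProduct.tmul_mul_tmul, Algebra.TensorProduct.tmul_mul_tmul,
          ← TensorProduct.sub_tmul, LieHom.map_lie, LieRing.of_associative_ring_bracket, one_mul])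
      (fun a w => by
        rw [hE, hK, Algebra.TensorProduct.tmul_mul_tmul, Algebra.TensorProduct.tmul_mul_tmul,
          one_mul, mul_one, one_mul, mul_one]) px
    have hpx : (BI.toDual hBI.nondegenerate).symm (B x ∘ₗ I.toSubmodule.subtype) = px := by
      rw [LinearEquiv.symm_apply_eq]
      ext y
      change B x (y : 𝔨) = B (dec.proj i x) (y : 𝔨)
      rw [dec.form_proj_left hB, dec.proj_of_mem y.2]
    have hD : diracFamily BI hBI.nondegenerate (B x ∘ₗ I.toSubmodule.subtype) =
        ∑ a, E (e' a) * K (cl BI (e a)) + K (cubicTerm BI e e') + K (cl BI px) := by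
      rw [diracFamily, hpx, cubicDirac, quantization_structureTensor hBI]
      simp only [hE, hK, Algebra.TensorProduct.tmul_mul_tmul, one_mul, mul_one]
      rfl
    have hL : laplaceFactor dec hB (B x) i = weilInclusion B I
        (diracFamily BI hBI.nondegenerate (B x ∘ₗ I.toSubmodule.subtype) ^ 2) := rfl
    rw [hL, hD, hsq]
    have hwE : ∀ y : I, weilInclusion B I (E y) =
        UniversalEnvelopingAlgebra.ι ℂ (y : 𝔨) ⊗ₜ[ℂ] (1 : Cl B) := fun y => by
      rw [hE, weilInclusion, Algebra.TensorProduct.map_tmul,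
        UniversalEnvelopingAlgebra.lift_ι_apply,
        map_one]
      rfl
    have hwK : ∀ w, weilInclusion B I (K w) = 1 ⊗ₜ[ℂ] cm w := fun w => by
      rw [hK, weilInclusion, Algebra.TensorProduct.map_tmul, map_one]
    have hwA : ∀ t : ℂ, weilInclusion B I (algebraMap ℂ _ t) = algebraMap ℂ _ t := fun t =>
      AlgHom.commutes _ t
    rw [hc, AlgHom.commutes]
    simp only [map_add, map_sum, map_mul, map_smul, hwE, hwK, hα]
    congr 3
    rotate_left
    · exact hwA c
    · exact hwA _
    have := hcas ((LinearMap.mul ℂ (Weil B)).compl₁₂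
      ((weilInclusion B I).toLinearMap ∘ₗ E) ((weilInclusion B I).toLinearMap ∘ₗ E))
    simp only [LinearMap.compl₁₂_apply, LinearMap.comp_apply, AlgHom.toLinearMap_apply, hwE,
      LinearMap.mul_apply', Algebra.TensorProduct.tmul_mul_tmul, mul_one] at this
    simp only [Algebra.TensorProduct.tmul_mul_tmul, mul_one]
    exact this

end Factor

/-! ### The centre of the even part -/

section Centre

variable {𝔤₀ 𝔤₁ : Type*} [LieRing 𝔤₀] [LieAlgebra ℂ 𝔤₀]
  [AddCommGroup 𝔤₁] [Module ℂ 𝔤₁] [LieRingModule 𝔤₀ 𝔤₁] [LieModule ℂ 𝔤₀ 𝔤₁]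
  [FiniteDimensional ℂ 𝔤₁] [Nontrivial 𝔤₁]

/-- A central even element acts on the odd part with scalar square, and as a scalar if the square
vanishes: for an eigenvalue `l`, the sum of the eigenspaces for `l` and `-l` generates a proper
graded ideal unless it is the whole odd part. -/
lemma exists_sq_of_mem_center (𝔤 : LieSuperalgebra 𝔤₀ 𝔤₁) (h𝔤 : 𝔤.IsClassical) {z : 𝔤₀}
    (hz : z ∈ LieAlgebra.center ℂ 𝔤₀) :
    ∃ l : ℂ, (∀ x : 𝔤₁, ⁅z, ⁅z, x⁆⁆ = (l * l) • x) ∧ (l = 0 → ∀ x : 𝔤₁, ⁅z, x⁆ = 0) := by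
  have hz0 : ∀ a : 𝔤₀, ⁅a, z⁆ = 0 := fun a => (LieModule.mem_maxTrivSubmodule ℂ 𝔤₀ 𝔤₀ z).mp hz a
  have hz1 : ∀ a : 𝔤₀, ⁅z, a⁆ = 0 := fun a => by rw [← lie_skew, hz0, neg_zero]
  have hcomm : ∀ (a : 𝔤₀) (x : 𝔤₁), ⁅z, ⁅a, x⁆⁆ = ⁅a, ⁅z, x⁆⁆ := fun a x => by
    rw [leibniz_lie, hz1, zero_lie, zero_add]
  let Z : Module.End ℂ 𝔤₁ := LieModule.toEnd ℂ 𝔤₀ 𝔤₁ z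
  have hZ : ∀ x, Z x = ⁅z, x⁆ := fun x => rfl
  obtain ⟨l, hl⟩ := Module.End.exists_eigenvalue Z
  obtain ⟨x₀, hx₀⟩ := hl.exists_hasEigenvector
  have hx₀' : ⁅z, x₀⁆ = l • x₀ := hx₀.apply_eq_smul
  -- the eigenspaces are submodules, and so is their sum `W`
  let V : ℂ → LieSubmodule ℂ 𝔤₀ 𝔤₁ := fun m =>
    { LinearMap.ker (Z - algebraMap ℂ (Module.End ℂ 𝔤₁) m) with
      lie_mem := fun {a x} hx => by
        change (Z - algebraMap ℂ (Module.End ℂ 𝔤₁) m) ⁅a, x⁆ = 0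
        have hx' : (Z - algebraMap ℂ (Module.End ℂ 𝔤₁) m) x = 0 := hx
        rw [LinearMap.sub_apply, Module.algebraMap_end_apply, hZ] at hx' ⊢
        rw [hcomm, ← lie_smul, ← lie_sub, hx', lie_zero] }
  have hV : ∀ m x, x ∈ V m ↔ ⁅z, x⁆ = m • x := fun m x => by
    change (Z - algebraMap ℂ (Module.End ℂ 𝔤₁) m) x = 0 ↔ _
    rw [LinearMap.sub_apply, Module.algebraMap_end_apply, hZ, sub_eq_zero]
  let W := V l ⊔ V (-l)
  obtain ⟨W', hW'⟩ := h𝔤.completelyReducible.exists_isCompl W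
  have hdisj : ∀ x ∈ W, x ∈ W' → x = 0 := fun x h1 h2 => by
    have : x ∈ W ⊓ W' := ⟨h1, h2⟩
    rwa [hW'.inf_eq_bot, LieSubmodule.mem_bot] at this
  have hsurj : ∀ m, (m = l ∨ m = -l) → ∀ x ∈ W', ∃ y ∈ W', x = ⁅z, y⁆ - m • y := by
    intro m hm x hx
    let T : W' →ₗ[ℂ] W' := LieModule.toEnd ℂ 𝔤₀ W' z - algebraMap ℂ (Module.End ℂ W') m
    have hT : ∀ y : W', (T y : 𝔤₁) = ⁅z, (y : 𝔤₁)⁆ - m • (y : 𝔤₁) := fun y => by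
      simp [T]
    have hinj : Function.Injective T := by
      rw [← LinearMap.ker_eq_bot, LinearMap.ker_eq_bot']
      intro y hy
      refine Subtype.ext (hdisj _ ?_ y.2)
      have h1 : ⁅z, (y : 𝔤₁)⁆ = m • (y : 𝔤₁) := sub_eq_zero.mp (by rw [← hT, hy]; rfl)
      rcases hm with rfl | rfl
      · exact (le_sup_left : V m ≤ W) ((hV _ _).mpr h1)
      · exact (le_sup_right : V (-l) ≤ W) ((hV _ _).mpr h1)
    obtain ⟨y, hy⟩ := (LinearMap.injective_iff_surjective.mp hinj) ⟨x, hx⟩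
    exact ⟨y, y.2, by rw [← hT, hy]⟩
  have horth' : ∀ m, (m = l ∨ m = -l) → ∀ x ∈ W', ∀ y ∈ V m, 𝔤.oddBracket x y = 0 := by
    intro m hm x hx y hy
    obtain ⟨x', -, rfl⟩ := hsurj (-m) (by rcases hm with rfl | rfl <;> simp) x hx
    have h1 := 𝔤.lie_oddBracket z x' y
    rw [hz1, (hV _ _).mp hy, map_smul] at h1
    rw [neg_smul, sub_neg_eq_add, map_add, map_smul, LinearMap.add_apply, LinearMap.smul_apply]
    exact h1.symm
  have horth : ∀ x ∈ W', ∀ y ∈ W, 𝔤.oddBracket x y = 0 := by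
    intro x hx y hy
    obtain ⟨a, ha, b, hb, rfl⟩ := LieSubmodule.mem_sup _ _ y |>.mp hy
    rw [map_add, horth' l (Or.inl rfl) x hx a ha, horth' (-l) (Or.inr rfl) x hx b hb, add_zero]
  let S : Set 𝔤₀ := {a | ∃ x ∈ W, ∃ y ∈ W, 𝔤.oddBracket x y = a}
  have hdecomp : ∀ x : 𝔤₁, ∃ w ∈ W, ∃ w' ∈ W', w + w' = x := fun x => by
    have : x ∈ W ⊔ W' := by rw [hW'.sup_eq_top]; trivial
    exact (LieSubmodule.mem_sup _ _ x).mp this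
  have hideal : 𝔤.IsIdeal (Submodule.span ℂ S) W.toSubmodule := by
    refine ⟨fun a b hb => ?_, fun a x hx => W.lie_mem hx, fun b hb x => ?_, fun x y hy => ?_⟩
    · induction hb using Submodule.span_induction with
      | mem b hb =>
        obtain ⟨x, hx, y, hy, rfl⟩ := hb
        rw [𝔤.lie_oddBracket]
        exact add_mem (Submodule.subset_span ⟨_, W.lie_mem hx, _, hy, rfl⟩)
          (Submodule.subset_span ⟨_, hx, _, W.lie_mem hy, rfl⟩)
      | zero => simp
      | add _ _ _ _ h1 h2 => rw [lie_add]; exact add_mem h1 h2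
      | smul c _ _ h1 => rw [lie_smul]; exact Submodule.smul_mem _ c h1
    · obtain ⟨w, hw, w', hw', rfl⟩ := hdecomp x
      rw [lie_add]
      refine add_mem (W.lie_mem hw) ?_
      have : ⁅b, w'⁆ = 0 := by
        induction hb using Submodule.span_induction with
        | mem b hb =>
          obtain ⟨x, hx, y, hy, rfl⟩ := hb
          have h1 := 𝔤.jacobi_odd x y w'
          rw [𝔤.symm y w', horth w' hw' y hy, horth w' hw' x hx, zero_lie, zero_lie, add_zero,
            add_zero] at h1
          exact h1
        | zero => simp
        | add _ _ _ _ h1 h2 => rw [add_lie, h1, h2, add_zero]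
        | smul c _ _ h1 => rw [smul_lie, h1, smul_zero]
      rw [this]
      exact zero_mem _
    · obtain ⟨w, hw, w', hw', rfl⟩ := hdecomp x
      rw [map_add, LinearMap.add_apply, horth w' hw' y hy, add_zero]
      exact Submodule.subset_span ⟨w, hw, y, hy, rfl⟩
  have hWtop : ∀ x : 𝔤₁, x ∈ W := by
    rcases h𝔤.simple.eq_bot_or_eq_top _ _ hideal with ⟨-, h2⟩ | ⟨-, h2⟩
    · exfalso
      have : x₀ ∈ W.toSubmodule := (le_sup_left : V l ≤ W) ((hV _ _).mpr hx₀')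
      rw [h2, Submodule.mem_bot] at this
      exact hx₀.2 this
    · intro x
      have : x ∈ W.toSubmodule := by rw [h2]; trivial
      exact this
  refine ⟨l, fun x => ?_, fun hl0 x => ?_⟩
  · obtain ⟨a, ha, b, hb, rfl⟩ := (LieSubmodule.mem_sup _ _ x).mp (hWtop x)
    rw [hV] at ha hb
    rw [lie_add, ha, hb, lie_add, lie_smul, lie_smul, ha, hb]
    module
  · obtain ⟨a, ha, b, hb, rfl⟩ := (LieSubmodule.mem_sup _ _ x).mp (hWtop x)
    rw [hV] at ha hb
    rw [lie_add, ha, hb, hl0]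
    simp

/-- The centre of the even part is at most one-dimensional. -/
lemma exists_smul_of_mem_center (𝔤 : LieSuperalgebra 𝔤₀ 𝔤₁) (h𝔤 : 𝔤.IsClassical) {z w : 𝔤₀}
    (hz : z ∈ LieAlgebra.center ℂ 𝔤₀) (hw : w ∈ LieAlgebra.center ℂ 𝔤₀) (hz0 : z ≠ 0) :
    ∃ c : ℂ, w = c • z := by
  -- the centre acts faithfully on the odd part
  have faithful : ∀ y ∈ LieAlgebra.center ℂ 𝔤₀, (∀ x : 𝔤₁, ⁅y, x⁆ = 0) → y = 0 := by
    intro y hy hy0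
    have hideal : 𝔤.IsIdeal (ℂ ∙ y) ⊥ := by
      refine ⟨fun a b hb => ?_, fun a x hx => ?_, fun b hb x => ?_, fun x y hy => ?_⟩
      · obtain ⟨c, rfl⟩ := Submodule.mem_span_singleton.mp hb
        rw [lie_smul, (LieModule.mem_maxTrivSubmodule ℂ 𝔤₀ 𝔤₀ y).mp hy a, smul_zero]
        exact zero_mem _
      · rw [Submodule.mem_bot] at hx ⊢
        rw [hx, lie_zero]
      · obtain ⟨c, rfl⟩ := Submodule.mem_span_singleton.mp hb
        rw [smul_lie, hy0, smul_zero]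
        exact zero_mem _
      · rw [Submodule.mem_bot] at hy
        rw [hy, map_zero]
        exact zero_mem _
    rcases h𝔤.simple.eq_bot_or_eq_top _ _ hideal with ⟨h1, -⟩ | ⟨-, h2⟩
    · exact Submodule.span_singleton_eq_bot.mp h1
    · exact absurd h2 bot_ne_top
  obtain ⟨l, hl, hl0⟩ := exists_sq_of_mem_center 𝔤 h𝔤 hz
  obtain ⟨m, hm, -⟩ := exists_sq_of_mem_center 𝔤 h𝔤 hw
  obtain ⟨n, hn, -⟩ := exists_sq_of_mem_center 𝔤 h𝔤 (add_mem hz hw)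
  have hl1 : l ≠ 0 := fun h => hz0 (faithful z hz (hl0 h))
  have hcomm : ∀ x : 𝔤₁, ⁅w, ⁅z, x⁆⁆ = ⁅z, ⁅w, x⁆⁆ := fun x => by
    rw [leibniz_lie, (LieModule.mem_maxTrivSubmodule ℂ 𝔤₀ 𝔤₀ z).mp hz w, zero_lie, zero_add]
  have hzw : ∀ x : 𝔤₁, ⁅z, ⁅w, x⁆⁆ = ((n * n - l * l - m * m) / 2) • x := fun x => by
    have h1 := hn x
    simp only [add_lie, lie_add, hl, hm, hcomm] at h1
    have h2 : (2 : ℂ) • ⁅z, ⁅w, x⁆⁆ = (n * n - l * l - m * m) • x := by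
      rw [sub_smul, sub_smul, ← h1, two_smul]; abel
    rw [div_eq_inv_mul, mul_smul, ← h2, smul_smul, inv_mul_cancel₀ two_ne_zero, one_smul]
  refine ⟨(n * n - l * l - m * m) / 2 / (l * l), ?_⟩
  rw [← sub_eq_zero]
  refine faithful _ (sub_mem hw (Submodule.smul_mem _ _ hz)) fun x => ?_
  have h3 : (l * l) • ⁅w, x⁆ = ((n * n - l * l - m * m) / 2) • ⁅z, x⁆ := by
    rw [← lie_smul, ← hl, ← lie_smul, ← hzw, hcomm, hcomm]
  have h4 : ⁅w, x⁆ = ((n * n - l * l - m * m) / 2 / (l * l)) • ⁅z, x⁆ := by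
    rw [div_eq_inv_mul _ (l * l), mul_smul, ← h3, smul_smul,
      inv_mul_cancel₀ (mul_ne_zero hl1 hl1), one_smul]
  rw [sub_lie, smul_lie, h4, sub_self]

end Centre

/-! ### Exponentials of endomorphisms and the adjoint group -/

section Exponential

variable {V W U : Type*} [AddCommGroup V] [Module ℂ V] [FiniteDimensional ℂ V]
  [AddCommGroup W] [Module ℂ W] [FiniteDimensional ℂ W]
  [AddCommGroup U] [Module ℂ U] [FiniteDimensional ℂ U]

/-- The exponential of an endomorphism of a finite-dimensional space, computed by matrices. -/
def expEnd (X : Module.End ℂ V) : Module.End ℂ V :=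
  let b := Module.finBasis ℂ V
  Matrix.toLin b b (NormedSpace.exp (LinearMap.toMatrix b b X))

lemma hasSum_matrix_exp {m : Type*} [Fintype m] [DecidableEq m] (A : Matrix m m ℂ) :
    HasSum (fun n : ℕ => ((n.factorial : ℂ)⁻¹) • A ^ n) (NormedSpace.exp A) := by
  let _ : SeminormedRing (Matrix m m ℂ) := Matrix.linftyOpSemiNormedRing
  let _ : NormedRing (Matrix m m ℂ) := Matrix.linftyOpNormedRing
  let _ : NormedAlgebra ℂ (Matrix m m ℂ) := Matrix.linftyOpNormedAlgebra
  exact NormedSpace.exp_series_hasSum_exp' (𝕂 := ℂ) A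

/-- Rectangular matrices that intertwine two matrices intertwine their exponentials. -/
lemma matrix_mul_exp {m n : Type*} [Fintype m] [DecidableEq m] [Fintype n] [DecidableEq n]
    {A : Matrix m m ℂ} {C : Matrix n n ℂ} {M : Matrix n m ℂ} (h : M * A = C * M) :
    M * NormedSpace.exp A = NormedSpace.exp C * M := by
  have hpow : ∀ k : ℕ, M * A ^ k = C ^ k * M := fun k => by
    induction k with
    | zero => simp
    | succ k ih =>
      rw [pow_succ, ← Matrix.mul_assoc, ih, Matrix.mul_assoc, h, ← Matrix.mul_assoc, pow_succ]
  have h1 := (hasSum_matrix_exp A).map (AddMonoidHom.mk' (fun X : Matrix m m ℂ => M * X)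
    (Matrix.mul_add M)) (continuous_const.matrix_mul continuous_id)
  have h2 := (hasSum_matrix_exp C).map (AddMonoidHom.mk' (fun X : Matrix n n ℂ => X * M)
    (fun a b => Matrix.add_mul a b M)) (continuous_id.matrix_mul continuous_const)
  refine h1.unique (Eq.mp (congrArg (HasSum · _) ?_) h2)
  funext k
  simp [hpow]

/-- A linear map intertwining two endomorphisms intertwines their exponentials. -/
lemma expEnd_intertwine {X : Module.End ℂ V} {Y : Module.End ℂ W} (φ : V →ₗ[ℂ] W)
    (h : ∀ v, φ (X v) = Y (φ v)) (v : V) : φ (expEnd X v) = expEnd Y (φ v) := by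
  have h' : φ ∘ₗ X = Y ∘ₗ φ := LinearMap.ext h
  set b := Module.finBasis ℂ V
  set c := Module.finBasis ℂ W
  have h1 : LinearMap.toMatrix b c φ * LinearMap.toMatrix b b X =
      LinearMap.toMatrix c c Y * LinearMap.toMatrix b c φ := by
    rw [← LinearMap.toMatrix_comp, ← LinearMap.toMatrix_comp, h']
  have h2 := congrArg (Matrix.toLin b c) (matrix_mul_exp h1)
  rw [Matrix.toLin_mul b b c, Matrix.toLin_mul b c c, Matrix.toLin_toMatrix] at h2
  exact LinearMap.congr_fun h2 v

lemma expEnd_add {X Y : Module.End ℂ V} (h : Commute X Y) :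
    expEnd (X + Y) = expEnd X ∘ₗ expEnd Y := by
  simp only [expEnd]
  rw [← Matrix.toLin_mul, map_add, Matrix.exp_add_of_commute]
  have := h.eq
  rw [commute_iff_eq, ← LinearMap.toMatrix_mul, ← LinearMap.toMatrix_mul, this]

lemma expEnd_zero : expEnd (0 : Module.End ℂ V) = LinearMap.id := by
  simp [expEnd, NormedSpace.exp_zero]

lemma expEnd_neg_apply (X : Module.End ℂ V) (v : V) : expEnd (-X) (expEnd X v) = v := by
  have h := expEnd_add (X := -X) (Y := X) ((Commute.refl X).neg_left)
  rw [neg_add_cancel, expEnd_zero] at h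
  exact (LinearMap.congr_fun h v).symm

/-- The exponential of an endomorphism as an automorphism. -/
def expEquiv (X : Module.End ℂ V) : V ≃ₗ[ℂ] V :=
  LinearEquiv.ofLinearMap (expEnd X) (expEnd (-X))
    (LinearMap.ext fun v => by
      simpa using expEnd_neg_apply (-X) v)
    (LinearMap.ext fun v => expEnd_neg_apply X v)

lemma expEquiv_apply (X : Module.End ℂ V) (v : V) : expEquiv X v = expEnd X v := rfl

/-- A bilinear map for which `X`, `Y`, `Z` satisfy the Leibniz rule is equivariant for their
exponentials: this is `expEnd_intertwine` on the tensor product. -/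
lemma expEnd_bilinear {X : Module.End ℂ V} {Y : Module.End ℂ W} {Z : Module.End ℂ U}
    (F : V →ₗ[ℂ] W →ₗ[ℂ] U) (h : ∀ v w, F (X v) w + F v (Y w) = Z (F v w)) (v : V) (w : W) :
    F (expEnd X v) (expEnd Y w) = expEnd Z (F v w) := by
  let X' : Module.End ℂ (V ⊗[ℂ] W) := LinearMap.rTensor W X
  let Y' : Module.End ℂ (V ⊗[ℂ] W) := LinearMap.lTensor V Y
  have hc : Commute X' Y' := by
    rw [commute_iff_eq]
    exact TensorProduct.ext' fun a b => by simp [X', Y']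
  have h1 := expEnd_intertwine (X := X' + Y') (Y := Z) (TensorProduct.lift F) (fun t => by
    induction t using TensorProduct.induction_on with
    | zero => simp
    | add a b ha hb => rw [map_add, map_add, ha, hb, map_add, map_add]
    | tmul a b => simp [X', Y', h]) (v ⊗ₜ w)
  have hX : ∀ a b, expEnd X' (a ⊗ₜ[ℂ] b) = expEnd X a ⊗ₜ[ℂ] b := fun a b =>
    (expEnd_intertwine ((TensorProduct.mk ℂ V W).flip b) (fun a => by simp [X']) a).symm
  have hY : ∀ a b, expEnd Y' (a ⊗ₜ[ℂ] b) = a ⊗ₜ[ℂ] expEnd Y b := fun a b =>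
    (expEnd_intertwine (TensorProduct.mk ℂ V W a) (fun a => by simp [Y']) b).symm
  rw [expEnd_add hc, LinearMap.comp_apply, hY, hX] at h1
  exact h1

/-- The exponential series terminates on a vector killed by `X³`. -/
lemma expEnd_apply_of_pow_three {X : Module.End ℂ V} {v : V} (h : X (X (X v)) = 0) :
    expEnd X v = v + X v + (1 / 2 : ℂ) • X (X v) := by
  set b := Module.finBasis ℂ V with hb
  set A := LinearMap.toMatrix b b X with hA
  have hmul : ∀ n : ℕ, Matrix.mulVec (A ^ n) (b.repr v) = b.repr ((X ^ n) v) := fun n => by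
    have h1 : A ^ n = LinearMap.toMatrix b b (X ^ n) := by
      exact (map_pow (LinearMap.toMatrixAlgEquiv b) X n).symm
    rw [h1, LinearMap.toMatrix_mulVec_repr]
  have h1 := (hasSum_matrix_exp A).map (AddMonoidHom.mk' (fun Y => Matrix.mulVec Y (b.repr v))
    (fun Y Z => Matrix.add_mulVec Y Z _)) (continuous_id.matrix_mulVec continuous_const)
  have h2 := hasSum_sum_of_ne_finset_zero (L := .unconditional ℕ) (s := Finset.range 3)
    (f := (AddMonoidHom.mk' (fun Y => Matrix.mulVec Y (b.repr v))
    (fun Y Z => Matrix.add_mulVec Y Z _)) ∘ fun n : ℕ => ((n.factorial : ℂ)⁻¹) • A ^ n)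
    (fun n hn => by
      obtain ⟨k, rfl⟩ := Nat.exists_eq_add_of_le (not_lt.mp (Finset.mem_range.not.mp hn))
      have h3 : (X ^ (3 + k)) v = 0 := by
        rw [add_comm, pow_add, Module.End.mul_apply]
        have : (X ^ 3) v = X (X (X v)) := rfl
        rw [this, h, map_zero]
      simp [Matrix.smul_mulVec, hmul, h3])
  have h3 := h1.unique h2
  refine b.repr.injective (DFunLike.coe_injective ?_)
  have h4 : (b.repr (expEnd X v) : _ → ℂ) = Matrix.mulVec (NormedSpace.exp A) (b.repr v) := by
    rw [← LinearMap.toMatrix_mulVec_repr b b (expEnd X) v]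
    simp only [expEnd, ← hb, ← hA, LinearMap.toMatrix_toLin]
  rw [h4]
  refine h3.trans ?_
  simp only [Finset.sum_range_succ, Finset.sum_range_zero, Function.comp_apply,
    AddMonoidHom.mk'_apply, Matrix.smul_mulVec, hmul]
  funext i
  simp [Nat.factorial, pow_succ]

variable {𝔨 : Type*} [LieRing 𝔨] [LieAlgebra ℂ 𝔨] [FiniteDimensional ℂ 𝔨]

lemma expEquiv_ad_mem (x : 𝔨) : expEquiv (LieAlgebra.ad ℂ 𝔨 x) ∈ adjointGroup 𝔨 :=
  Subgroup.subset_closure ⟨x, rfl⟩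

/-- Induction over the generators of the adjoint group. -/
lemma adjointGroup_induction {p : (𝔨 ≃ₗ[ℂ] 𝔨) → Prop}
    (exp : ∀ x : 𝔨, p (expEquiv (LieAlgebra.ad ℂ 𝔨 x))) (one : p 1)
    (mul : ∀ g h, p g → p h → p (g * h)) (inv : ∀ g, p g → p g⁻¹) {g : 𝔨 ≃ₗ[ℂ] 𝔨}
    (hg : g ∈ adjointGroup 𝔨) : p g := by
  induction hg using Subgroup.closure_induction with
  | mem g hg =>
    obtain ⟨x, hx⟩ := hg
    have : g = expEquiv (LieAlgebra.ad ℂ 𝔨 x) := LinearEquiv.toLinearMap_injective hx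
    exact this ▸ exp x
  | one => exact one
  | mul g h _ _ hg hh => exact mul g h hg hh
  | inv g _ hg => exact inv g hg

/-- The adjoint group acts on representations up to conjugation. -/
lemma exists_equivariant_of_mem_adjointGroup (V : Type*) [AddCommGroup V] [Module ℂ V]
    [FiniteDimensional ℂ V] [LieRingModule 𝔨 V] [LieModule ℂ 𝔨 V] {g : 𝔨 ≃ₗ[ℂ] 𝔨}
    (hg : g ∈ adjointGroup 𝔨) : ∃ E : V ≃ₗ[ℂ] V, ∀ (y : 𝔨) (v : V), ⁅g y, E v⁆ = E ⁅y, v⁆ := by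
  refine adjointGroup_induction (p := fun g => ∃ E : V ≃ₗ[ℂ] V, ∀ (y : 𝔨) (v : V),
    ⁅g y, E v⁆ = E ⁅y, v⁆) (fun x => ?_) ⟨1, fun y v => rfl⟩ ?_ ?_ hg
  · refine ⟨expEquiv (LieModule.toEnd ℂ 𝔨 V x), fun y v => ?_⟩
    exact expEnd_bilinear (LieModule.toEnd ℂ 𝔨 V).toLinearMap (fun y v => by
      change ⁅⁅x, y⁆, v⁆ + ⁅y, ⁅x, v⁆⁆ = ⁅x, ⁅y, v⁆⁆
      rw [leibniz_lie x y v]) y v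
  · rintro g h ⟨E, hE⟩ ⟨F, hF⟩
    exact ⟨E * F, fun y v => by
      rw [LinearEquiv.mul_apply, LinearEquiv.mul_apply, LinearEquiv.mul_apply, hE, hF]⟩
  · rintro g ⟨E, hE⟩
    refine ⟨E⁻¹, fun y v => E.injective ?_⟩
    rw [← hE]
    change ⁅g (g.symm y), E (E.symm v)⁆ = E (E.symm ⁅y, v⁆)
    simp

lemma form_apply_of_mem_adjointGroup {B : LinearMap.BilinForm ℂ 𝔨} (hB : IsQuadratic B)
    {g : 𝔨 ≃ₗ[ℂ] 𝔨} (hg : g ∈ adjointGroup 𝔨) (y z : 𝔨) : B (g y) (g z) = B y z := by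
  revert y z
  refine adjointGroup_induction (p := fun g => ∀ y z, B (g y) (g z) = B y z)
    (fun x y z => ?_) (fun y z => rfl) ?_ ?_ hg
  · have := expEnd_bilinear (X := LieAlgebra.ad ℂ 𝔨 x) (Y := LieAlgebra.ad ℂ 𝔨 x) (Z := 0) B
      (fun y z => by
        simp only [LieAlgebra.ad_apply, LinearMap.zero_apply]
        rw [← lie_skew, map_neg, LinearMap.neg_apply, hB.invariant, neg_add_cancel]) y z
    rwa [expEnd_zero] at this
  · intro g h hg hh y z
    rw [LinearEquiv.mul_apply, LinearEquiv.mul_apply, hg, hh]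
  · intro g hg y z
    rw [← hg]
    change B (g (g.symm y)) (g (g.symm z)) = _
    simp

lemma proj_apply_of_mem_adjointGroup {r : ℕ} (dec : ReductiveDecomposition 𝔨 r) (i : Fin (r + 1))
    {g : 𝔨 ≃ₗ[ℂ] 𝔨} (hg : g ∈ adjointGroup 𝔨) (y : 𝔨) :
    dec.proj i (g y) = g (dec.proj i y) := by
  revert y
  refine adjointGroup_induction (p := fun g => ∀ y, dec.proj i (g y) = g (dec.proj i y))
    (fun x y => ?_) (fun y => rfl) ?_ ?_ hg
  · exact expEnd_intertwine (dec.proj i) (fun y => by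
      simp only [LieAlgebra.ad_apply]
      rw [dec.lie_proj]) y
  · intro g h hg hh y
    rw [LinearEquiv.mul_apply, LinearEquiv.mul_apply, hg, hh]
  · intro g hg y
    refine g.injective ?_
    rw [← hg]
    change dec.proj i (g (g.symm y)) = g (g.symm _)
    simp

lemma apply_of_mem_center {z : 𝔨} (hz : z ∈ LieAlgebra.center ℂ 𝔨) {g : 𝔨 ≃ₗ[ℂ] 𝔨}
    (hg : g ∈ adjointGroup 𝔨) : g z = z := by
  refine adjointGroup_induction (p := fun g => g z = z) (fun x => ?_) rfl ?_ ?_ hg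
  · have := expEnd_intertwine (X := 0) (Y := LieAlgebra.ad ℂ 𝔨 x) (LinearMap.toSpanSingleton ℂ 𝔨 z)
      (fun c => by
        simp only [LinearMap.zero_apply, map_zero, LinearMap.toSpanSingleton_apply,
          LieAlgebra.ad_apply, lie_smul]
        rw [(LieModule.mem_maxTrivSubmodule ℂ 𝔨 𝔨 z).mp hz x, smul_zero]) 1
    rw [expEnd_zero] at this
    rw [LinearMap.id_apply, LinearMap.toSpanSingleton_apply, one_smul] at this
    exact this.symm
  · intro g h hg hh
    rw [LinearEquiv.mul_apply, hh, hg]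
  · intro g hg
    exact g.injective (by rw [hg]; exact g.apply_symm_apply z)

/-- The element `exp(ad e) exp(-ad f) exp(ad e)` of the adjoint group acts as a reflection. -/
lemma exists_reflection {t e f : 𝔨} (hef : ⁅e, f⁆ = t) (hte : ⁅t, e⁆ = (2 : ℂ) • e)
    (htf : ⁅t, f⁆ = -(2 : ℂ) • f) : ∃ g ∈ adjointGroup 𝔨, ∀ (h : 𝔨) (a : ℂ), ⁅h, t⁆ = 0 →
      ⁅h, e⁆ = a • e → ⁅h, f⁆ = -(a • f) → g h = h - a • t := by
  refine ⟨expEquiv (LieAlgebra.ad ℂ 𝔨 e) * (expEquiv (LieAlgebra.ad ℂ 𝔨 (-f)) *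
    expEquiv (LieAlgebra.ad ℂ 𝔨 e)), mul_mem (expEquiv_ad_mem _)
      (mul_mem (expEquiv_ad_mem _) (expEquiv_ad_mem _)), fun h a hht hhe hhf => ?_⟩
  have heh : ⁅e, h⁆ = -(a • e) := by rw [← lie_skew, hhe]
  have hfh : ⁅f, h⁆ = a • f := by rw [← lie_skew, hhf, neg_neg]
  have het : ⁅e, t⁆ = -((2 : ℂ) • e) := by rw [← lie_skew, hte]
  have hft : ⁅f, t⁆ = (2 : ℂ) • f := by rw [← lie_skew, htf]; module
  have hfe : ⁅f, e⁆ = -t := by rw [← lie_skew, hef]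
  have s1 : expEnd (LieAlgebra.ad ℂ 𝔨 e) h = h - a • e := by
    rw [expEnd_apply_of_pow_three] <;>
    simp only [LieAlgebra.ad_apply, heh, lie_neg, lie_smul, lie_self, smul_zero, neg_zero, lie_zero]
    module
  have s2 : expEnd (LieAlgebra.ad ℂ 𝔨 (-f)) h = h - a • f := by
    rw [expEnd_apply_of_pow_three] <;>
    simp only [LieAlgebra.ad_apply, neg_lie, hfh, lie_neg, lie_smul, lie_self, smul_zero, neg_zero,
      lie_zero]
    module
  have s3 : expEnd (LieAlgebra.ad ℂ 𝔨 (-f)) e = e + t - f := by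
    rw [expEnd_apply_of_pow_three] <;>
    simp only [LieAlgebra.ad_apply, neg_lie, hfe, lie_neg, lie_smul, lie_self, smul_zero, neg_zero,
      neg_neg, hft]
    module
  have s4 : expEnd (LieAlgebra.ad ℂ 𝔨 e) e = e := by
    rw [expEnd_apply_of_pow_three] <;> simp
  have s5 : expEnd (LieAlgebra.ad ℂ 𝔨 e) t = t - (2 : ℂ) • e := by
    rw [expEnd_apply_of_pow_three] <;>
    simp only [LieAlgebra.ad_apply, het, lie_neg, lie_smul, lie_self, smul_zero, neg_zero, lie_zero]
    module
  simp only [LinearEquiv.mul_apply, expEquiv_apply]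
  have s6 : h - a • f - a • (e + t - f) = h - a • e - a • t := by module
  rw [s1, map_sub, map_smul, s2, s3, s6, map_sub, map_sub, map_smul, map_smul, s1, s4, s5]
  module

end Exponential

/-! ### The root space decomposition of a reductive Lie algebra -/

section Cartan

variable {𝔨 : Type*} [LieRing 𝔨] [LieAlgebra ℂ 𝔨] {r : ℕ}
  (dec : ReductiveDecomposition 𝔨 r) {𝔥 : LieSubalgebra ℂ 𝔨}

lemma exists_mem_ne_zero {R A M : Type*} [CommRing R] [LieRing A] [AddCommGroup M] [Module R M]
    [LieRingModule A M] {N : LieSubmodule R A M} (h : N ≠ ⊥) : ∃ x ∈ N, x ≠ 0 := by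
  by_contra! h'
  exact h ((LieSubmodule.eq_bot_iff N).mpr h')

lemma mem_weightSpace_iff {M : Type*} [AddCommGroup M] [Module ℂ M] [LieRingModule 𝔨 M]
    [LieModule ℂ 𝔨 M] {α : Dual ℂ 𝔥} {x : M} :
    x ∈ LieModule.weightSpace M (α : 𝔥 → ℂ) ↔ ∀ h : 𝔥, ⁅(h : 𝔨), x⁆ = α h • x :=
  LieModule.mem_weightSpace _ _

namespace ReductiveDecomposition

/-- The part of a Cartan subalgebra in a simple factor. -/
def cartan (𝔥 : LieSubalgebra ℂ 𝔨) (i : Fin r) : LieSubalgebra ℂ (dec.ideal i.succ) :=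
  𝔥.comap (dec.ideal i.succ).incl

lemma mem_cartan {i : Fin r} {x : dec.ideal i.succ} : x ∈ dec.cartan 𝔥 i ↔ (x : 𝔨) ∈ 𝔥 := Iff.rfl

end ReductiveDecomposition

variable [FiniteDimensional ℂ 𝔨] [𝔥.IsCartanSubalgebra]

/-- A Cartan subalgebra is its own generalized zero weight space. -/
lemma mem_cartan_iff {x : 𝔨} : x ∈ 𝔥 ↔ ∀ h : 𝔥, ∃ k : ℕ, ((LieAlgebra.ad ℂ 𝔨 h) ^ k) x = 0 := by
  rw [← LieSubalgebra.mem_toLieSubmodule, ← LieAlgebra.rootSpace_zero_eq ℂ 𝔨 𝔥,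
    LieModule.mem_genWeightSpace]
  simp only [Pi.zero_apply, zero_smul, sub_zero]
  rfl

namespace ReductiveDecomposition

lemma proj_mem_cartan (i : Fin (r + 1)) {x : 𝔨} (hx : x ∈ 𝔥) : dec.proj i x ∈ 𝔥 := by
  rw [mem_cartan_iff] at hx ⊢
  intro h
  obtain ⟨k, hk⟩ := hx h
  refine ⟨k, ?_⟩
  have : ∀ n : ℕ, ((LieAlgebra.ad ℂ 𝔨 h) ^ n) (dec.proj i x) =
      dec.proj i (((LieAlgebra.ad ℂ 𝔨 h) ^ n) x) := fun n => by
    induction n with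
    | zero => rfl
    | succ n ih =>
      rw [pow_succ', Module.End.mul_apply, ih, Module.End.mul_apply, LieAlgebra.ad_apply,
        LieAlgebra.ad_apply, dec.lie_proj]
  rw [this, hk, map_zero]

/-- The projection of the Cartan subalgebra onto its part in the `i`-th factor. -/
def projH (i : Fin (r + 1)) : 𝔥 →ₗ[ℂ] 𝔥 :=
  (dec.proj i).restrict fun _ hx => dec.proj_mem_cartan i hx

lemma coe_projH (i : Fin (r + 1)) (h : 𝔥) : (dec.projH i h : 𝔨) = dec.proj i (h : 𝔨) := rfl

lemma sum_projH (h : 𝔥) : ∑ i, dec.projH i h = h := by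
  refine Subtype.ext ?_
  have h1 : ((∑ i, dec.projH i h : 𝔥) : 𝔨) = ∑ i, (dec.projH i h : 𝔨) := by
    exact map_sum 𝔥.toSubmodule.subtype _ _
  rw [h1]
  exact dec.sum_proj h

lemma projH_projH (i : Fin (r + 1)) (h : 𝔥) : dec.projH i (dec.projH i h) = dec.projH i h :=
  Subtype.ext (dec.proj_proj i h)

lemma projH_projH_of_ne {i j : Fin (r + 1)} (hij : i ≠ j) (h : 𝔥) :
    dec.projH i (dec.projH j h) = 0 :=
  Subtype.ext (dec.proj_of_mem_of_ne hij (dec.proj_mem j h))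

instance isCartanSubalgebra_cartan (i : Fin r) : (dec.cartan 𝔥 i).IsCartanSubalgebra where
  nilpotent := by
    let φ : dec.cartan 𝔥 i →ₗ⁅ℂ⁆ 𝔥 :=
      { toFun := fun x => ⟨((x : dec.ideal i.succ) : 𝔨), x.2⟩
        map_add' := fun _ _ => rfl
        map_smul' := fun _ _ => rfl
        map_lie' := rfl }
    have hφ : Function.Injective φ := fun x y h =>
      Subtype.ext (Subtype.ext (congrArg (fun z : 𝔥 => (z : 𝔨)) h))
    exact hφ.lieAlgebra_isNilpotent
  self_normalizing := by
    refine le_antisymm (fun x hx => ?_) (LieSubalgebra.le_normalizer _)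
    rw [LieSubalgebra.mem_normalizer_iff] at hx
    rw [dec.mem_cartan]
    rw [← LieSubalgebra.IsCartanSubalgebra.self_normalizing (H := 𝔥),
      LieSubalgebra.mem_normalizer_iff]
    intro y hy
    have h1 := hx ⟨dec.proj i.succ y, dec.proj_mem _ _⟩ (dec.proj_mem_cartan i.succ hy)
    rw [dec.mem_cartan] at h1
    have h2 : ⁅(x : 𝔨), dec.proj i.succ y⁆ = ⁅(x : 𝔨), y⁆ := by
      rw [dec.lie_proj]
      exact dec.proj_of_mem (lie_mem_left ℂ 𝔨 _ _ _ x.2)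
    rw [← h2]
    exact h1

instance isKilling_ideal (i : Fin r) : LieAlgebra.IsKilling ℂ (dec.ideal i.succ) := by
  have := dec.simple i
  infer_instance

/-- A Cartan subalgebra is abelian: its part in a simple factor is a Cartan subalgebra of that
factor, and the remaining part is central. -/
lemma lie_eq_zero_of_mem_cartan (dec : ReductiveDecomposition 𝔨 r) {x y : 𝔨} (hx : x ∈ 𝔥)
    (hy : y ∈ 𝔥) : ⁅x, y⁆ = 0 := by
  rw [← dec.sum_proj y, lie_sum]
  refine Finset.sum_eq_zero fun i _ => ?_
  rcases Fin.eq_zero_or_eq_succ i with rfl | ⟨k, rfl⟩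
  · exact dec.lie_proj_zero x y
  · rw [← dec.proj_lie_proj]
    let a : dec.cartan 𝔥 k := ⟨⟨dec.proj k.succ x, dec.proj_mem _ _⟩, dec.proj_mem_cartan _ hx⟩
    let b : dec.cartan 𝔥 k := ⟨⟨dec.proj k.succ y, dec.proj_mem _ _⟩, dec.proj_mem_cartan _ hy⟩
    have : ⁅a, b⁆ = 0 := trivial_lie_zero _ _ a b
    exact congrArg (fun z : dec.cartan 𝔥 k => ((z : dec.ideal k.succ) : 𝔨)) this

/-- Root vectors of a simple factor are weight vectors of the whole algebra. -/
lemma coe_mem_weightSpace {k : Fin r} {χ : dec.cartan 𝔥 k → ℂ} {x : dec.ideal k.succ}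
    (hx : x ∈ LieAlgebra.rootSpace (dec.cartan 𝔥 k) χ) {α : Dual ℂ 𝔥}
    (hα : ∀ h : 𝔥, α h = χ ⟨⟨dec.proj k.succ h, dec.proj_mem _ _⟩, dec.proj_mem_cartan _ h.2⟩) :
    (x : 𝔨) ∈ LieModule.weightSpace 𝔨 (α : 𝔥 → ℂ) := by
  rw [mem_weightSpace_iff]
  intro h
  let h' : dec.cartan 𝔥 k := ⟨⟨dec.proj k.succ h, dec.proj_mem _ _⟩, dec.proj_mem_cartan _ h.2⟩
  have h1 := LieAlgebra.IsKilling.lie_eq_smul_of_mem_rootSpace hx h'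
  rw [hα]
  have h2 := congrArg (fun z : dec.ideal k.succ => (z : 𝔨)) h1
  have h3 : ⁅(h : 𝔨), (x : 𝔨)⁆ = ⁅dec.proj k.succ (h : 𝔨), (x : 𝔨)⁆ := by
    conv_lhs => rw [← dec.proj_of_mem x.2, ← dec.proj_lie_proj, dec.proj_of_mem x.2]
  rw [h3]
  exact h2

/-- The Lie algebra is spanned by its weight spaces. -/
lemma span_weightSpace_eq_top (dec : ReductiveDecomposition 𝔨 r) {p : Submodule ℂ 𝔨}
    (h0 : ∀ h : 𝔥, (h : 𝔨) ∈ p)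
    (hα : ∀ α ∈ roots 𝔥 𝔨, ∀ x ∈ LieModule.weightSpace 𝔨 (α : 𝔥 → ℂ), x ∈ p) (x : 𝔨) : x ∈ p := by
  rw [← dec.sum_proj x]
  refine sum_mem fun i _ => ?_
  rcases Fin.eq_zero_or_eq_succ i with rfl | ⟨k, rfl⟩
  · refine h0 ⟨dec.proj 0 x, mem_cartan_iff.mpr fun h => ⟨1, ?_⟩⟩
    rw [pow_one]
    exact dec.lie_proj_zero _ _
  · let y : dec.ideal k.succ := ⟨dec.proj k.succ x, dec.proj_mem _ _⟩
    have hy : y ∈ ⨆ χ : LieModule.Weight ℂ (dec.cartan 𝔥 k) (dec.ideal k.succ),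
        LieModule.genWeightSpace (dec.ideal k.succ) χ := by
      rw [LieModule.iSup_genWeightSpace_eq_top']
      trivial
    have key : (⨆ χ : LieModule.Weight ℂ (dec.cartan 𝔥 k) (dec.ideal k.succ),
        LieModule.genWeightSpace (dec.ideal k.succ) χ).toSubmodule ≤
        p.comap (dec.ideal k.succ).toSubmodule.subtype := by
      rw [LieSubmodule.iSup_toSubmodule]
      refine iSup_le fun χ z hz => ?_
      by_cases hχ : χ.IsZero
      · refine h0 ⟨(z : 𝔨), ?_⟩
        rw [hχ] at hz
        have : z ∈ LieAlgebra.rootSpace (dec.cartan 𝔥 k) (0 : dec.cartan 𝔥 k → ℂ) := hz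
        rw [LieAlgebra.rootSpace_zero_eq] at this
        exact this
      · let α : Dual ℂ 𝔥 :=
          { toFun := fun h => χ ⟨⟨dec.proj k.succ h, dec.proj_mem _ _⟩,
              dec.proj_mem_cartan _ h.2⟩
            map_add' := fun a b => by
              rw [← map_add]
              congr 1
              exact Subtype.ext (Subtype.ext (map_add _ _ _))
            map_smul' := fun c a => by
              rw [RingHom.id_apply, ← map_smul]
              congr 1
              exact Subtype.ext (Subtype.ext (map_smul _ _ _)) }
        have hmem := fun (z : dec.ideal k.succ) hz =>
          dec.coe_mem_weightSpace (x := z) (χ := χ) (α := α) hz fun h => rfl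
        refine hα α ⟨?_, ?_⟩ _ (hmem z hz)
        · intro h
          refine hχ (funext fun a => ?_)
          have h1 := LinearMap.congr_fun h ⟨((a : dec.ideal k.succ) : 𝔨), a.2⟩
          refine Eq.trans ?_ h1
          change _ = χ _
          congr 1
          exact Subtype.ext (Subtype.ext (dec.proj_of_mem (a : dec.ideal k.succ).2).symm)
        · obtain ⟨w, hw, hw0⟩ := χ.exists_ne_zero
          intro hbot
          have h1 := hmem w hw
          rw [hbot, LieSubmodule.mem_bot] at h1
          exact hw0 (Subtype.ext h1)
    exact key hy

/-- A root is supported on one simple factor, which contains its root space. -/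
lemma exists_factor (dec : ReductiveDecomposition 𝔨 r) {α : Dual ℂ 𝔥} (hα : α ∈ roots 𝔥 𝔨) :
    ∃ k : Fin r,
    (∀ h, α h = α (dec.projH k.succ h)) ∧
    ∀ x ∈ LieModule.weightSpace 𝔨 (α : 𝔥 → ℂ), x ∈ dec.ideal k.succ := by
  obtain ⟨hα0, hαw⟩ := hα
  have main : ∀ i, ∀ x ∈ LieModule.weightSpace 𝔨 (α : 𝔥 → ℂ), dec.proj i x ≠ 0 →
      i ≠ 0 ∧ ∀ h, α h = α (dec.projH i h) := by
    intro i x hx hne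
    have hx' : ∀ h : 𝔥, ⁅(h : 𝔨), dec.proj i x⁆ = α h • dec.proj i x := fun h => by
      rw [dec.lie_proj, mem_weightSpace_iff.mp hx, map_smul]
    constructor
    · rintro rfl
      refine hα0 (LinearMap.ext fun h => ?_)
      have := hx' h
      rw [dec.lie_proj_zero] at this
      exact (smul_eq_zero.mp this.symm).resolve_right hne
    · intro h
      have h1 := hx' (dec.projH i h)
      rw [dec.coe_projH, dec.proj_lie_proj, hx'] at h1
      exact smul_left_injective ℂ hne h1
  obtain ⟨x, hx, hx0⟩ := exists_mem_ne_zero hαw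
  obtain ⟨i, hi⟩ : ∃ i, dec.proj i x ≠ 0 := by
    by_contra! h
    refine hx0 ?_
    rw [← dec.sum_proj x]
    exact Finset.sum_eq_zero fun i _ => h i
  obtain ⟨hi0, hih⟩ := main i x hx hi
  obtain ⟨k, rfl⟩ := Fin.exists_succ_eq.mpr hi0
  refine ⟨k, hih, fun y hy => ?_⟩
  have : y = dec.proj k.succ y := by
    conv_lhs => rw [← dec.sum_proj y]
    refine Finset.sum_eq_single _ (fun j _ hj => ?_) fun h => absurd (Finset.mem_univ _) h
    by_contra hne
    refine hα0 (LinearMap.ext fun h => ?_)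
    rw [(main j y hy hne).2 h, hih, dec.projH_projH_of_ne (Ne.symm hj), map_zero,
      LinearMap.zero_apply]
  rw [this]
  exact dec.proj_mem _ _

/-- The `sl₂`-triple of a root, and the fact that the root spaces are lines. -/
lemma exists_sl2 (dec : ReductiveDecomposition 𝔨 r) {α : Dual ℂ 𝔥} (hα : α ∈ roots 𝔥 𝔨) :
    ∃ (t : 𝔥) (e f : 𝔨), IsSl2Triple (t : 𝔨) e f ∧ α t = 2 ∧
      e ∈ LieModule.weightSpace 𝔨 (α : 𝔥 → ℂ) ∧
      f ∈ LieModule.weightSpace 𝔨 ((-α : Dual ℂ 𝔥) : 𝔥 → ℂ) ∧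
      (∀ x ∈ LieModule.weightSpace 𝔨 (α : 𝔥 → ℂ), ∃ c : ℂ, x = c • e) := by
  obtain ⟨k, hk, hmem⟩ := dec.exists_factor hα
  let H := dec.cartan 𝔥 k
  let I := dec.ideal k.succ
  let res : H → 𝔥 := fun a => ⟨((a : I) : 𝔨), a.2⟩
  have hres : ∀ x : 𝔨, ∀ hx : x ∈ LieModule.weightSpace 𝔨 (α : 𝔥 → ℂ),
      (⟨x, hmem x hx⟩ : I) ∈ LieAlgebra.rootSpace H (fun a => α (res a)) := by
    intro x hx
    refine LieModule.weightSpace_le_genWeightSpace I _ ?_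
    rw [LieModule.mem_weightSpace]
    intro a
    exact Subtype.ext (mem_weightSpace_iff.mp hx (res a))
  obtain ⟨x, hx, hx0⟩ := exists_mem_ne_zero hα.2
  let χ : LieModule.Weight ℂ H I :=
    { toFun := fun a => α (res a)
      genWeightSpace_ne_bot' := fun h => hx0 (by
        have := hres x hx
        change _ ∈ LieModule.genWeightSpace I _ at this
        rw [h, LieSubmodule.mem_bot] at this
        exact congrArg Subtype.val this) }
  have hχα : ∀ h : 𝔥, α h = χ ⟨⟨dec.proj k.succ h, dec.proj_mem _ _⟩,
      dec.proj_mem_cartan _ h.2⟩ := fun h => hk h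
  have hχ0 : χ.IsNonZero := fun h => hα.1 (LinearMap.ext fun a => by
    rw [hχα, h]
    rfl)
  obtain ⟨t, e, f, hsl, he, hf⟩ := LieAlgebra.IsKilling.exists_isSl2Triple_of_weight_isNonZero hχ0
  have ht := hsl.h_eq_coroot hχ0 he hf
  let t' : 𝔥 := res (LieAlgebra.IsKilling.coroot χ)
  have htt' : (t' : 𝔨) = (t : 𝔨) := by rw [ht]
  refine ⟨t', (e : 𝔨), (f : 𝔨), ⟨?_, ?_, ?_, ?_⟩, ?_, ?_, ?_, ?_⟩
  · rw [htt']
    exact fun h => hsl.h_ne_zero (Subtype.ext h)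
  · rw [htt']
    exact congrArg Subtype.val hsl.lie_e_f
  · rw [htt']
    exact congrArg Subtype.val hsl.lie_h_e_nsmul
  · rw [htt']
    exact congrArg Subtype.val hsl.lie_h_f_nsmul
  · exact LieAlgebra.IsKilling.root_apply_coroot hχ0
  · exact dec.coe_mem_weightSpace he hχα
  · refine dec.coe_mem_weightSpace hf fun h => ?_
    rw [LinearMap.neg_apply, hχα]
    rfl
  · intro x hx
    have h1 := LieAlgebra.IsKilling.finrank_rootSpace_eq_one χ hχ0
    have he0 : (⟨e, he⟩ : LieAlgebra.rootSpace H χ) ≠ 0 := fun h =>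
      hsl.e_ne_zero (congrArg Subtype.val h)
    obtain ⟨c, hc⟩ := (finrank_eq_one_iff_of_nonzero' _ he0).mp h1 ⟨⟨x, hmem x hx⟩, hres x hx⟩
    exact ⟨c, (congrArg (fun z : LieAlgebra.rootSpace H χ => ((z : I) : 𝔨)) hc).symm⟩

end ReductiveDecomposition

end Cartan

/-! ### Root triples, real weights and the real form of the root system -/

section RootTriple

variable {𝔨 : Type*} [LieRing 𝔨] [LieAlgebra ℂ 𝔨] {𝔥 : LieSubalgebra ℂ 𝔨}

/-- An `sl₂`-triple `(t, e, f)` of the root `α`; thus `t` is the coroot of `α`. -/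
structure IsRootTriple (α : Dual ℂ 𝔥) (t : 𝔥) (e f : 𝔨) : Prop where
  sl2 : IsSl2Triple (t : 𝔨) e f
  apply_coroot : α t = 2
  mem_e : e ∈ LieModule.weightSpace 𝔨 (α : 𝔥 → ℂ)
  mem_f : f ∈ LieModule.weightSpace 𝔨 ((-α : Dual ℂ 𝔥) : 𝔥 → ℂ)

lemma IsRootTriple.mem_roots {α : Dual ℂ 𝔥} {t : 𝔥} {e f : 𝔨} (h : IsRootTriple α t e f) :
    α ∈ roots 𝔥 𝔨 := by
  refine ⟨fun h0 => ?_, fun h0 => ?_⟩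
  · have := h.apply_coroot
    rw [h0, LinearMap.zero_apply] at this
    norm_num at this
  · have := h.mem_e
    rw [h0, LieSubmodule.mem_bot] at this
    exact h.sl2.e_ne_zero this

lemma IsRootTriple.neg {α : Dual ℂ 𝔥} {t : 𝔥} {e f : 𝔨} (h : IsRootTriple α t e f) :
    IsRootTriple (-α) (-t) f e where
  sl2 := h.sl2.symm
  apply_coroot := by rw [LinearMap.neg_apply, map_neg, neg_neg, h.apply_coroot]
  mem_e := h.mem_f
  mem_f := by rw [neg_neg]; exact h.mem_e

lemma neg_mem_roots_of_isRootTriple {α : Dual ℂ 𝔥} {t : 𝔥} {e f : 𝔨} (h : IsRootTriple α t e f) :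
    -α ∈ roots 𝔥 𝔨 := h.neg.mem_roots

/-- The eigenvalues of the semisimple element of an `sl₂`-triple in a finite-dimensional module are
integers. -/
lemma exists_int_of_isSl2Triple {V : Type*} [AddCommGroup V] [Module ℂ V] [LieRingModule 𝔨 V]
    [LieModule ℂ 𝔨 V] [FiniteDimensional ℂ V] {t e f : 𝔨} (h : IsSl2Triple t e f) {v : V}
    (hv : v ≠ 0) {c : ℂ} (hc : ⁅t, v⁆ = c • v) : ∃ n : ℤ, c = n := by
  have h_exists_zero : ∃ k : ℕ, ((LieModule.toEnd ℂ 𝔨 V e) ^ k) v = 0 := by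
    by_contra! contra
    have hinf : (Set.range fun n : ℕ => c + 2 * (n : ℂ)).Infinite :=
      Set.infinite_range_of_injective fun a b hab => by
        simpa using hab
    refine hinf ((LieModule.toEnd ℂ 𝔨 V t).finite_hasEigenvalue.subset ?_)
    rintro _ ⟨n, rfl⟩
    exact Module.End.hasEigenvalue_of_hasEigenvector
      ⟨Module.End.mem_eigenspace_iff.mpr (h.lie_h_pow_toEnd_e hc n), contra n⟩
  obtain ⟨n, hn, hn'⟩ := Nat.exists_not_and_succ_of_not_zero_of_exists hv h_exists_zero
  have hp : h.HasPrimitiveVectorWith (((LieModule.toEnd ℂ 𝔨 V e) ^ n) v) (c + 2 * n) :=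
    ⟨hn, h.lie_h_pow_toEnd_e hc n, by rwa [IsSl2Triple.lie_e_pow_toEnd_e (R := ℂ) n]⟩
  obtain ⟨m, hm⟩ := hp.exists_nat
  refine ⟨m - 2 * n, ?_⟩
  push_cast
  linear_combination hm

variable (𝔥) in
/-- The functionals on the Cartan subalgebra that are real on all coroots. -/
def realWeights : Submodule ℝ (Dual ℂ 𝔥) where
  carrier := {η | ∀ α t e f, IsRootTriple (𝔨 := 𝔨) α t e f → (η t).im = 0}
  add_mem' ha hb α t e f h := by
    rw [LinearMap.add_apply, Complex.add_im, ha α t e f h, hb α t e f h, add_zero]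
  zero_mem' _ _ _ _ _ := rfl
  smul_mem' c η hη α t e f h := by
    rw [LinearMap.smul_apply, Complex.real_smul, Complex.im_ofReal_mul, hη α t e f h, mul_zero]

lemma eq_re_of_mem_realWeights {η : Dual ℂ 𝔥} (hη : η ∈ realWeights 𝔥) {α : Dual ℂ 𝔥} {t : 𝔥}
    {e f : 𝔨} (h : IsRootTriple α t e f) : η t = ((η t).re : ℂ) :=
  Complex.ext rfl (by rw [Complex.ofReal_im]; exact hη α t e f h)

lemma mem_realWeights_of_weightSpace_ne_bot {V : Type*} [AddCommGroup V] [Module ℂ V]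
    [LieRingModule 𝔨 V] [LieModule ℂ 𝔨 V] [FiniteDimensional ℂ V] {χ : Dual ℂ 𝔥}
    (hχ : LieModule.weightSpace V (χ : 𝔥 → ℂ) ≠ ⊥) : χ ∈ realWeights 𝔥 := by
  intro α t e f h
  obtain ⟨v, hv, hv0⟩ := exists_mem_ne_zero hχ
  obtain ⟨n, hn⟩ := exists_int_of_isSl2Triple h.sl2 hv0 (mem_weightSpace_iff.mp hv t)
  rw [hn, Complex.intCast_im]

lemma realRootSpan_le_realWeights (𝔤₁ : Type*) [AddCommGroup 𝔤₁] [Module ℂ 𝔤₁]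
    [LieRingModule 𝔨 𝔤₁] [LieModule ℂ 𝔨 𝔤₁] [FiniteDimensional ℂ 𝔨] [FiniteDimensional ℂ 𝔤₁] :
    realRootSpan 𝔥 𝔤₁ ≤ realWeights 𝔥 := by
  refine Submodule.span_le.mpr ?_
  rintro α (hα | hα)
  · exact mem_realWeights_of_weightSpace_ne_bot hα.2
  · exact mem_realWeights_of_weightSpace_ne_bot hα.2

variable {P : Finset (Dual ℂ 𝔥)}

lemma IsPositiveSystem.mem_roots (hP : IsPositiveSystem 𝔥 P) {α : Dual ℂ 𝔥} (hα : α ∈ P) :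
    α ∈ roots 𝔥 𝔨 := by
  obtain ⟨f, -, hf⟩ := hP
  exact ((hf α).mp hα).1

lemma IsPositiveSystem.neg_notMem (hP : IsPositiveSystem 𝔥 P) {α : Dual ℂ 𝔥} (hα : α ∈ P) :
    -α ∉ P := by
  obtain ⟨f, -, hf⟩ := hP
  intro h
  have h1 := ((hf _).mp h).2
  rw [map_neg] at h1
  linarith [((hf α).mp hα).2]

lemma killingForm_coroot {α : Dual ℂ 𝔥} {t : 𝔥} {e f : 𝔨} (h : IsRootTriple α t e f) (x : 𝔥) :
    killingForm ℂ 𝔨 x t = α x * killingForm ℂ 𝔨 e f := by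
  rw [← h.sl2.lie_e_f]
  have := LieModule.traceForm_apply_lie_apply ℂ 𝔨 𝔨 (x : 𝔨) e f
  rw [mem_weightSpace_iff.mp h.mem_e, map_smul, LinearMap.smul_apply, smul_eq_mul] at this
  exact this.symm

variable {r : ℕ}

lemma killingForm_proj (dec : ReductiveDecomposition 𝔨 r) (i : Fin (r + 1)) (x y : 𝔨) :
    killingForm ℂ 𝔨 (dec.proj i x) y = killingForm ℂ 𝔨 (dec.proj i x) (dec.proj i y) := by
  have : LieAlgebra.ad ℂ 𝔨 (dec.proj i x) ∘ₗ LieAlgebra.ad ℂ 𝔨 y =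
      LieAlgebra.ad ℂ 𝔨 (dec.proj i x) ∘ₗ LieAlgebra.ad ℂ 𝔨 (dec.proj i y) := by
    ext z
    simp only [LinearMap.comp_apply, LieAlgebra.ad_apply]
    rw [dec.proj_lie i y z, dec.lie_proj, ← dec.proj_lie, dec.proj_proj]
  change LinearMap.trace ℂ 𝔨 (_ ∘ₗ _) = LinearMap.trace ℂ 𝔨 (_ ∘ₗ _)
  exact congrArg _ this

variable [FiniteDimensional ℂ 𝔨] [𝔥.IsCartanSubalgebra]

lemma ReductiveDecomposition.exists_isRootTriple (dec : ReductiveDecomposition 𝔨 r)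
    {α : Dual ℂ 𝔥} (hα : α ∈ roots 𝔥 𝔨) : ∃ t e f, IsRootTriple α t e f := by
  obtain ⟨t, e, f, h1, h2, h3, h4, -⟩ := dec.exists_sl2 hα
  exact ⟨t, e, f, h1, h2, h3, h4⟩

lemma ReductiveDecomposition.neg_mem_roots (dec : ReductiveDecomposition 𝔨 r)
    {α : Dual ℂ 𝔥} (hα : α ∈ roots 𝔥 𝔨) : -α ∈ roots 𝔥 𝔨 := by
  obtain ⟨t, e, f, h⟩ := dec.exists_isRootTriple hα
  exact neg_mem_roots_of_isRootTriple h

lemma IsPositiveSystem.mem_or_neg_mem (hP : IsPositiveSystem 𝔥 P)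
    (dec : ReductiveDecomposition 𝔨 r) {α : Dual ℂ 𝔥} (hα : α ∈ roots 𝔥 𝔨) : α ∈ P ∨ -α ∈ P := by
  obtain ⟨f, hf0, hf⟩ := hP
  rcases lt_or_gt_of_ne (hf0 α hα) with h | h
  · exact Or.inr ((hf _).mpr ⟨dec.neg_mem_roots hα, by rw [map_neg]; linarith⟩)
  · exact Or.inl ((hf _).mpr ⟨hα, h⟩)

variable {B : LinearMap.BilinForm ℂ 𝔨}

lemma form_sharp (hB : IsQuadratic B) (ξ : Dual ℂ 𝔥) (h : 𝔥) :
    B (sharp hB ξ : 𝔨) (h : 𝔨) = ξ h :=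
  LinearMap.BilinForm.apply_toDual_symm_apply
    (hB := restrict_cartan_nondegenerate hB) (f := ξ) (v := h)

lemma eq_of_form_cartan (hB : IsQuadratic B) {x y : 𝔥} (h : ∀ z : 𝔥, B (x : 𝔨) z = B (y : 𝔨) z) :
    x = y := by
  refine sub_eq_zero.mp ((restrict_cartan_nondegenerate (𝔥 := 𝔥) hB).1 _ fun z => ?_)
  rw [map_sub, LinearMap.sub_apply]
  exact sub_eq_zero.mpr (h z)

/-- `sharp` as a linear equivalence. -/
def sharpEquiv (hB : IsQuadratic B) : Dual ℂ 𝔥 ≃ₗ[ℂ] 𝔥 :=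
  (LinearMap.BilinForm.toDual (B.restrict 𝔥.toSubmodule) (restrict_cartan_nondegenerate hB)).symm

lemma sharpEquiv_apply (hB : IsQuadratic B) (ξ : Dual ℂ 𝔥) : sharpEquiv hB ξ = sharp hB ξ := rfl

lemma lie_mem_cartan {α : Dual ℂ 𝔥} {x y : 𝔨}
    (hx : x ∈ LieModule.weightSpace 𝔨 (α : 𝔥 → ℂ))
    (hy : y ∈ LieModule.weightSpace 𝔨 ((-α : Dual ℂ 𝔥) : 𝔥 → ℂ)) : ⁅x, y⁆ ∈ 𝔥 := by
  refine mem_cartan_iff.mpr fun h => ⟨1, ?_⟩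
  rw [pow_one, LieAlgebra.ad_apply, leibniz_lie, mem_weightSpace_iff.mp hx,
    mem_weightSpace_iff.mp hy, smul_lie, lie_smul, LinearMap.neg_apply]
  module

lemma lie_eq_smul_sharp (hB : IsQuadratic B) {α : Dual ℂ 𝔥}
    {x y : 𝔨} (hx : x ∈ LieModule.weightSpace 𝔨 (α : 𝔥 → ℂ))
    (hy : y ∈ LieModule.weightSpace 𝔨 ((-α : Dual ℂ 𝔥) : 𝔥 → ℂ)) :
    ⁅x, y⁆ = B x y • (sharp hB α : 𝔨) := by
  have : (⟨⁅x, y⁆, lie_mem_cartan hx hy⟩ : 𝔥) = B x y • sharp hB α := by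
    refine eq_of_form_cartan hB fun z => ?_
    change B ⁅x, y⁆ z = B (B x y • (sharp hB α : 𝔨)) z
    rw [map_smul, LinearMap.smul_apply, form_sharp, hB.symm, ← hB.invariant,
      mem_weightSpace_iff.mp hx, map_smul, LinearMap.smul_apply, smul_eq_mul, smul_eq_mul, mul_comm]
  exact congrArg Subtype.val this

lemma IsRootTriple.coe_coroot (hB : IsQuadratic B)
    {α : Dual ℂ 𝔥} {t : 𝔥} {e f : 𝔨} (h : IsRootTriple α t e f) : t = B e f • sharp hB α :=
  Subtype.ext (h.sl2.lie_e_f.symm.trans (lie_eq_smul_sharp hB h.mem_e h.mem_f))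

lemma IsRootTriple.form_ne_zero (hB : IsQuadratic B)
    {α : Dual ℂ 𝔥} {t : 𝔥} {e f : 𝔨} (h : IsRootTriple α t e f) : B e f ≠ 0 := fun h0 => by
  have h1 := h.coe_coroot hB
  rw [h0, zero_smul] at h1
  have h2 := h.apply_coroot
  rw [h1, map_zero] at h2
  norm_num at h2

/-- The antidominance condition in terms of the coroots. -/
lemma IsAntidominant.apply_coroot_nonpos {hB : IsQuadratic B}
    {ξ : Dual ℂ 𝔥} (hξ : IsAntidominant hB P ξ) {α : Dual ℂ 𝔥} (hα : α ∈ P) {t : 𝔥} {e f : 𝔨}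
    (h : IsRootTriple α t e f) : (ξ t).re ≤ 0 := by
  have h1 := hξ α hα
  have hc := h.form_ne_zero hB
  have h2 : α t = 2 := h.apply_coroot
  rw [h.coe_coroot hB, map_smul, smul_eq_mul] at h2
  have hs : α (sharp hB α) ≠ 0 := right_ne_zero_of_mul (h2.trans_ne two_ne_zero)
  have h3 : 2 * ξ (sharp hB α) / α (sharp hB α) = ξ t := by
    rw [h.coe_coroot hB, map_smul, smul_eq_mul, div_eq_iff hs]
    linear_combination -ξ (sharp hB α) * h2
  rwa [h3] at h1

/-- Coroots are brackets, so they have no central component. -/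
lemma projH_zero_coroot (dec : ReductiveDecomposition 𝔨 r) {α : Dual ℂ 𝔥} {t : 𝔥} {e f : 𝔨}
    (h : IsRootTriple α t e f) : dec.projH 0 t = 0 :=
  Subtype.ext (by rw [dec.coe_projH, ← h.sl2.lie_e_f, ← dec.lie_proj, dec.lie_proj_zero]; rfl)

/-! #### The invariant form on the dual of the Cartan subalgebra, factor by factor -/

/-- The form `(η, ζ) ↦ B(pᵢ h_η, pᵢ h_ζ)` on `𝔥^*` attached to the `i`-th factor. -/
def factorForm (dec : ReductiveDecomposition 𝔨 r) (hB : IsQuadratic B) (i : Fin (r + 1)) :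
    LinearMap.BilinForm ℂ (Dual ℂ 𝔥) :=
  Module.Dual.eval ℂ 𝔥 ∘ₗ dec.projH i ∘ₗ (sharpEquiv hB).toLinearMap

lemma factorForm_apply (dec : ReductiveDecomposition 𝔨 r) (hB : IsQuadratic B) (i : Fin (r + 1))
    (η ζ : Dual ℂ 𝔥) : factorForm dec hB i η ζ = ζ (dec.projH i (sharp hB η)) := rfl

lemma factorForm_eq (dec : ReductiveDecomposition 𝔨 r) (hB : IsQuadratic B) (i : Fin (r + 1))
    (η ζ : Dual ℂ 𝔥) : factorForm dec hB i η ζ =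
      B (dec.proj i (sharp hB η)) (dec.proj i (sharp hB ζ)) := by
  rw [factorForm_apply, ← form_sharp hB, dec.coe_projH, hB.symm, dec.form_proj_left hB, ←
    dec.form_proj hB, dec.form_proj_left hB]

lemma factorForm_symm (dec : ReductiveDecomposition 𝔨 r) (hB : IsQuadratic B) (i : Fin (r + 1))
    (η ζ : Dual ℂ 𝔥) : factorForm dec hB i η ζ = factorForm dec hB i ζ η := by
  rw [factorForm_eq, factorForm_eq, hB.symm]

/-- By Schur's lemma the Killing form is a multiple of the given form on each simple factor. -/
lemma exists_killingForm_eq (dec : ReductiveDecomposition 𝔨 r) (hB : IsQuadratic B) (i : Fin r) :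
    ∃ c : ℂ, c ≠ 0 ∧ ∀ x ∈ dec.ideal i.succ, ∀ y ∈ dec.ideal i.succ,
      killingForm ℂ 𝔨 x y = c * B x y := by
  let I := dec.ideal i.succ
  have hnd := dec.nondegenerate hB i.succ
  let φ : Module.End ℂ I :=
    ((restrictForm B I).toDual hnd).symm.toLinearMap ∘ₗ killingForm ℂ I
  have hφ : ∀ x y, restrictForm B I (φ x) y = killingForm ℂ I x y := fun x y =>
    LinearMap.BilinForm.apply_toDual_symm_apply (hB := hnd) (f := killingForm ℂ I x) (v := y)
  have hI := dec.isQuadratic_restrictForm hB i.succ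
  have hlie : ∀ x y, φ ⁅x, y⁆ = ⁅x, φ y⁆ := fun x y => by
    refine sub_eq_zero.mp (hnd.1 _ fun z => ?_)
    rw [map_sub, LinearMap.sub_apply, hφ, ← lie_skew x (φ y), map_neg, LinearMap.neg_apply,
      hI.invariant, hφ, ← lie_skew, map_neg, LinearMap.neg_apply,
      LieModule.traceForm_apply_lie_apply]
    ring
  have hs := dec.simple i
  have : Nontrivial I := by
    by_contra h
    rw [not_nontrivial_iff_subsingleton] at h
    exact hs.non_abelian ⟨fun a b => Subsingleton.elim _ _⟩
  obtain ⟨c, hc⟩ := Module.End.exists_eigenvalue φ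
  let N : LieIdeal ℂ I :=
    { φ.eigenspace c with
      lie_mem := fun {x m} hm => by
        change m ∈ φ.eigenspace c at hm
        change ⁅x, m⁆ ∈ φ.eigenspace c
        rw [Module.End.mem_eigenspace_iff] at hm ⊢
        rw [hlie, hm, lie_smul] }
  have hN : N = ⊤ := (hs.eq_bot_or_eq_top N).resolve_left fun h => by
    obtain ⟨x, hx⟩ := hc.exists_hasEigenvector
    have hx1 : x ∈ N := hx.1
    rw [h, LieSubmodule.mem_bot] at hx1
    exact hx.2 hx1
  have hκ : ∀ x y, killingForm ℂ I x y = c * restrictForm B I x y := fun x y => by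
    have : x ∈ N := by rw [hN]; trivial
    rw [← hφ, Module.End.mem_eigenspace_iff.mp (show x ∈ φ.eigenspace c from this), map_smul,
      LinearMap.smul_apply, smul_eq_mul]
  refine ⟨c, fun h => ?_, fun x hx y hy => ?_⟩
  · obtain ⟨x, hx⟩ := exists_ne (0 : I)
    refine hx ((LieAlgebra.IsKilling.killingForm_nondegenerate ℂ I).1 x fun y => ?_)
    rw [hκ, h, zero_mul]
  · have h1 := hκ ⟨x, hx⟩ ⟨y, hy⟩
    rw [LieIdeal.killingForm_eq] at h1
    exact h1

/-- The ratio of the Killing form and the given form on a simple factor. -/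
def killingScale (dec : ReductiveDecomposition 𝔨 r) (hB : IsQuadratic B) (i : Fin r) : ℂ :=
  (exists_killingForm_eq dec hB i).choose

lemma killingScale_ne_zero (dec : ReductiveDecomposition 𝔨 r) (hB : IsQuadratic B) (i : Fin r) :
    killingScale dec hB i ≠ 0 := (exists_killingForm_eq dec hB i).choose_spec.1

lemma killingForm_eq_killingScale_mul (dec : ReductiveDecomposition 𝔨 r) (hB : IsQuadratic B)
    (i : Fin r) {x y : 𝔨} (hx : x ∈ dec.ideal i.succ) (hy : y ∈ dec.ideal i.succ) :
    killingForm ℂ 𝔨 x y = killingScale dec hB i * B x y :=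
  (exists_killingForm_eq dec hB i).choose_spec.2 x hx y hy

/-- The element of the semisimple part of `𝔥` that represents a functional for the Killing form. -/
def killingSharp (dec : ReductiveDecomposition 𝔨 r) (hB : IsQuadratic B) : Dual ℂ 𝔥 →ₗ[ℂ] 𝔥 :=
  ∑ i : Fin r, (killingScale dec hB i)⁻¹ • dec.projH i.succ ∘ₗ (sharpEquiv hB).toLinearMap

lemma killingSharp_apply (dec : ReductiveDecomposition 𝔨 r) (hB : IsQuadratic B) (η : Dual ℂ 𝔥) :
    killingSharp dec hB η =
      ∑ i : Fin r, (killingScale dec hB i)⁻¹ • dec.projH i.succ (sharp hB η) := by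
  rw [killingSharp, LinearMap.sum_apply]
  rfl

lemma apply_killingSharp (dec : ReductiveDecomposition 𝔨 r) (hB : IsQuadratic B)
    (η ζ : Dual ℂ 𝔥) : ζ (killingSharp dec hB η) =
      ∑ i : Fin r, (killingScale dec hB i)⁻¹ * factorForm dec hB i.succ η ζ := by
  rw [killingSharp_apply, map_sum]
  simp only [map_smul, smul_eq_mul, factorForm_apply]

lemma killingForm_killingSharp (dec : ReductiveDecomposition 𝔨 r) (hB : IsQuadratic B)
    (η : Dual ℂ 𝔥) (x : 𝔥) : killingForm ℂ 𝔨 (killingSharp dec hB η) x =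
      η (x - dec.projH 0 x) := by
  have h1 : x - dec.projH 0 x = ∑ i : Fin r, dec.projH i.succ x := by
    conv_lhs => rw [← dec.sum_projH x, Fin.sum_univ_succ, map_add, dec.projH_projH, map_sum,
      Finset.sum_eq_zero fun j _ => dec.projH_projH_of_ne (Fin.succ_ne_zero j).symm x, add_zero,
      add_sub_cancel_left]
  have h2 : ((killingSharp dec hB η : 𝔥) : 𝔨) =
      ∑ i : Fin r, (killingScale dec hB i)⁻¹ • dec.proj i.succ (sharp hB η : 𝔨) := by
    rw [killingSharp_apply]
    exact map_sum 𝔥.toSubmodule.subtype _ _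
  rw [h1, h2, map_sum, map_sum, LinearMap.sum_apply]
  refine Finset.sum_congr rfl fun i _ => ?_
  rw [map_smul, LinearMap.smul_apply, killingForm_proj,
    killingForm_eq_killingScale_mul dec hB i (dec.proj_mem _ _) (dec.proj_mem _ _), smul_eq_mul,
    ← mul_assoc, inv_mul_cancel₀ (killingScale_ne_zero dec hB i), one_mul, ← dec.form_proj hB,
    dec.form_proj_left hB, ← dec.coe_projH, form_sharp]

/-- The Killing form on the Cartan subalgebra as a sum over the weights of `𝔨`. -/
lemma killingForm_cartan (x y : 𝔥) : killingForm ℂ 𝔨 x y =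
    ∑ χ : LieModule.Weight ℂ 𝔥 𝔨,
      finrank ℂ (LieModule.genWeightSpace 𝔨 χ) • (χ x * χ y) :=
  LieModule.traceForm_eq_sum_finrank_nsmul_mul ℂ 𝔥 𝔨 x y

/-- Any weight of `𝔨` is zero or a root. -/
lemma weight_eq_zero_or_mem_roots (χ : LieModule.Weight ℂ 𝔥 𝔨) :
    χ.toLinear = 0 ∨ χ.toLinear ∈ roots 𝔥 𝔨 := by
  refine or_iff_not_imp_left.mpr fun h0 => ⟨h0, fun h => ?_⟩
  obtain ⟨m, hm, hχ⟩ := LieModule.exists_forall_lie_eq_smul ℂ 𝔥 𝔨 χ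
  have : m ∈ LieModule.weightSpace 𝔨 (χ.toLinear : 𝔥 → ℂ) := mem_weightSpace_iff.mpr hχ
  rw [h, LieSubmodule.mem_bot] at this
  exact hm this

/-- The Killing form is a sum of squares of the roots, so it is positive on elements of `𝔥` with
real root values, and zero only on those in its radical. -/
lemma exists_killingForm_cartan_self {x : 𝔥}
    (hx : ∀ α ∈ roots 𝔥 𝔨, (α x).im = 0) :
    ∃ c : ℝ, 0 ≤ c ∧ killingForm ℂ 𝔨 x x = c ∧ (c = 0 → (∀ α ∈ roots 𝔥 𝔨, α x = 0) ∧
      ∀ y : 𝔥, killingForm ℂ 𝔨 x y = 0) := by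
  have hre : ∀ χ : LieModule.Weight ℂ 𝔥 𝔨, χ x = ((χ x).re : ℂ) := fun χ => by
    refine Complex.ext rfl ?_
    rw [Complex.ofReal_im]
    rcases weight_eq_zero_or_mem_roots χ with h | h
    · have : χ x = 0 := LinearMap.congr_fun h x
      rw [this, Complex.zero_im]
    · exact hx _ h
  refine ⟨∑ χ : LieModule.Weight ℂ 𝔥 𝔨,
    (finrank ℂ (LieModule.genWeightSpace 𝔨 χ) : ℝ) * ((χ x).re * (χ x).re), ?_, ?_, ?_⟩
  · exact Finset.sum_nonneg fun χ _ => mul_nonneg (Nat.cast_nonneg _) (mul_self_nonneg _)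
  · rw [killingForm_cartan, Complex.ofReal_sum]
    refine Finset.sum_congr rfl fun χ _ => ?_
    rw [hre χ]
    simp
  · intro h
    rw [Finset.sum_eq_zero_iff_of_nonneg
      fun χ _ => mul_nonneg (Nat.cast_nonneg _) (mul_self_nonneg _)] at h
    have h0 : ∀ χ : LieModule.Weight ℂ 𝔥 𝔨, χ x = 0 := fun χ => by
      have hpos : (finrank ℂ (LieModule.genWeightSpace 𝔨 χ) : ℝ) ≠ 0 := by
        rw [Nat.cast_ne_zero]
        intro hz
        exact χ.genWeightSpace_ne_bot'
          ((LieSubmodule.toSubmodule_eq_bot _).mp (Submodule.finrank_eq_zero.mp hz))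
      have := (mul_eq_zero.mp (h χ (Finset.mem_univ _))).resolve_left hpos
      rw [hre χ, mul_self_eq_zero.mp this, Complex.ofReal_zero]
    refine ⟨fun α hα => ?_, fun y => ?_⟩
    · obtain ⟨m, hm, hm0⟩ := exists_mem_ne_zero hα.2
      exact h0 ⟨α, fun hb => hm0 (by
        have := LieModule.weightSpace_le_genWeightSpace 𝔨 (α : 𝔥 → ℂ) hm
        rwa [hb, LieSubmodule.mem_bot] at this)⟩
    · rw [killingForm_cartan]
      exact Finset.sum_eq_zero fun χ _ => by rw [h0 χ, zero_mul, smul_zero]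

/-- The values of a root on the elements representing functionals. -/
lemma exists_root_killingSharp (dec : ReductiveDecomposition 𝔨 r) (hB : IsQuadratic B)
    {α : Dual ℂ 𝔥} {t : 𝔥} {e f : 𝔨} (h : IsRootTriple α t e f) :
    ∃ c : ℝ, 0 < c ∧ ∀ η : Dual ℂ 𝔥, α (killingSharp dec hB η) = c * η t := by
  obtain ⟨N, hN, hN1, hN2⟩ := exists_killingForm_cartan_self (x := t) fun β hβ =>
    mem_realWeights_of_weightSpace_ne_bot hβ.2 α t e f h
  have hN0 : N ≠ 0 := fun h0 => by
    have := (hN2 h0).1 α h.mem_roots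
    rw [h.apply_coroot] at this
    norm_num at this
  rw [killingForm_coroot h, h.apply_coroot] at hN1
  refine ⟨2 / N, by positivity, fun η => ?_⟩
  have h1 := killingForm_coroot h (killingSharp dec hB η)
  rw [killingForm_killingSharp, projH_zero_coroot dec h, sub_zero] at h1
  have hN0' : (N : ℂ) ≠ 0 := Complex.ofReal_ne_zero.mpr hN0
  push_cast
  rw [h1]
  field_simp
  linear_combination -α (killingSharp dec hB η) * hN1

lemma root_killingSharp_im (dec : ReductiveDecomposition 𝔨 r) (hB : IsQuadratic B) {η : Dual ℂ 𝔥}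
    (hη : η ∈ realWeights 𝔥) {α : Dual ℂ 𝔥} (hα : α ∈ roots 𝔥 𝔨) :
    (α (killingSharp dec hB η)).im = 0 := by
  obtain ⟨t, e, f, h⟩ := dec.exists_isRootTriple hα
  obtain ⟨c, -, hc⟩ := exists_root_killingSharp dec hB h
  rw [hc, Complex.im_ofReal_mul, hη α t e f h, mul_zero]

/-- The real part of the form on `𝔥^*` that is dual to the Killing form on the semisimple part of
`𝔥`. On functionals in `realWeights` that form is itself real. -/
def rootForm (dec : ReductiveDecomposition 𝔨 r) (hB : IsQuadratic B) :
    LinearMap.BilinForm ℝ (Dual ℂ 𝔥) :=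
  LinearMap.mk₂ ℝ (fun η ζ => (ζ (killingSharp dec hB η)).re)
    (fun a b c => by rw [map_add, map_add, Complex.add_re])
    (fun s a c => by
      have : s • a = (s : ℂ) • a := by ext x; simp
      rw [this, map_smul, map_smul, smul_eq_mul, Complex.re_ofReal_mul, smul_eq_mul])
    (fun a b c => by rw [LinearMap.add_apply, Complex.add_re])
    (fun s a c => by rw [LinearMap.smul_apply, Complex.smul_re])

lemma rootForm_apply (dec : ReductiveDecomposition 𝔨 r) (hB : IsQuadratic B) (η ζ : Dual ℂ 𝔥) :
    rootForm dec hB η ζ = (ζ (killingSharp dec hB η)).re := rfl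

lemma rootForm_symm (dec : ReductiveDecomposition 𝔨 r) (hB : IsQuadratic B) (η ζ : Dual ℂ 𝔥) :
    rootForm dec hB η ζ = rootForm dec hB ζ η := by
  rw [rootForm_apply, rootForm_apply, apply_killingSharp, apply_killingSharp]
  simp_rw [factorForm_symm dec hB _ η ζ]

lemma projH_zero_killingSharp (dec : ReductiveDecomposition 𝔨 r) (hB : IsQuadratic B)
    (η : Dual ℂ 𝔥) : dec.projH 0 (killingSharp dec hB η) = 0 := by
  rw [killingSharp_apply, map_sum]
  refine Finset.sum_eq_zero fun i _ => ?_
  rw [map_smul, dec.projH_projH_of_ne (Fin.succ_ne_zero i).symm, smul_zero]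

/-- Positivity of the form on real functionals; the null vectors are the functionals that vanish on
the semisimple part of `𝔥`. -/
lemma rootForm_self (dec : ReductiveDecomposition 𝔨 r) (hB : IsQuadratic B) {η : Dual ℂ 𝔥}
    (hη : η ∈ realWeights 𝔥) : 0 ≤ rootForm dec hB η η ∧
      (rootForm dec hB η η = 0 → ∀ x : 𝔥, η (x - dec.projH 0 x) = 0) := by
  obtain ⟨c, hc, hc1, hc2⟩ := exists_killingForm_cartan_self
    (x := killingSharp dec hB η) fun α hα => root_killingSharp_im dec hB hη hα
  have h1 := hc1
  rw [killingForm_killingSharp, projH_zero_killingSharp, sub_zero] at h1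
  have h2 : rootForm dec hB η η = c := by rw [rootForm_apply, h1, Complex.ofReal_re]
  rw [h2]
  refine ⟨hc, fun h0 x => ?_⟩
  rw [← killingForm_killingSharp dec hB]
  exact (hc2 h0).2 x

end RootTriple

/-! ### Reflections, and the weights of `L ⊗ S` -/

section Weights

variable {𝔨 : Type*} [LieRing 𝔨] [LieAlgebra ℂ 𝔨] {𝔥 : LieSubalgebra ℂ 𝔨}
  {P : Finset (Dual ℂ 𝔥)}

/-- The reflection `η ↦ η - η(t) α` of a root `α` with coroot `t`. -/
def rootReflection {α : Dual ℂ 𝔥} {t : 𝔥} {e f : 𝔨} (h : IsRootTriple α t e f) :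
    Dual ℂ 𝔥 ≃ₗ[ℂ] Dual ℂ 𝔥 :=
  Module.reflection (x := α) (f := Module.Dual.eval ℂ 𝔥 t) h.apply_coroot

lemma rootReflection_apply {α : Dual ℂ 𝔥} {t : 𝔥} {e f : 𝔨} (h : IsRootTriple α t e f)
    (η : Dual ℂ 𝔥) : rootReflection h η = η - η t • α := rfl

/-- The weights `ρ - ∑_{α ∈ T} α`, `T ⊆ P`, of the spin module: the half sums of the systems of
representatives of the roots modulo sign. -/
def spinWeights (P : Finset (Dual ℂ 𝔥)) : Set (Dual ℂ 𝔥) :=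
  {σ | ∃ T ⊆ P, σ = weylVector P - ∑ α ∈ T, α}

lemma finite_spinWeights (P : Finset (Dual ℂ 𝔥)) : (spinWeights P).Finite := by
  refine ((P.powerset.finite_toSet).image fun T => weylVector P - ∑ α ∈ T, α).subset ?_
  rintro _ ⟨T, hT, rfl⟩
  exact ⟨T, Finset.mem_coe.mpr (Finset.mem_powerset.mpr hT), rfl⟩

lemma half_sum_mem_spinWeights {ε : Dual ℂ 𝔥 → ℂ} (hε : ∀ β ∈ P, ε β = 1 ∨ ε β = -1) :
    (1 / 2 : ℂ) • ∑ β ∈ P, ε β • β ∈ spinWeights P := by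
  classical
  refine ⟨P.filter fun β => ε β = -1, Finset.filter_subset _ _, ?_⟩
  rw [weylVector, Finset.sum_filter, Finset.smul_sum, Finset.smul_sum, ← Finset.sum_sub_distrib]
  refine Finset.sum_congr rfl fun β hβ => ?_
  rcases hε β hβ with h | h
  · rw [h, if_neg (by norm_num)]
    module
  · rw [h, if_pos rfl]
    module

/-- The cone of sums of positive roots. -/
def posCone (P : Finset (Dual ℂ 𝔥)) : AddSubmonoid (Dual ℂ 𝔥) :=
  AddSubmonoid.closure (P : Set (Dual ℂ 𝔥))

lemma weylVector_sub_mem_posCone {σ : Dual ℂ 𝔥} (hσ : σ ∈ spinWeights P) :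
    weylVector P - σ ∈ posCone P := by
  obtain ⟨T, hT, rfl⟩ := hσ
  rw [sub_sub_cancel]
  exact sum_mem fun β hβ => AddSubmonoid.subset_closure (hT hβ)

lemma IsPositiveSystem.exists_pos (hP : IsPositiveSystem 𝔥 P) : ∃ f : Dual ℂ 𝔥 →ₗ[ℝ] ℝ,
    (∀ α ∈ P, 0 < f α) ∧ ∀ η ∈ posCone P, 0 ≤ f η := by
  obtain ⟨f, -, hf⟩ := hP
  have hpos : ∀ α ∈ P, 0 < f α := fun α hα => ((hf α).mp hα).2
  refine ⟨f, hpos, fun η hη => ?_⟩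
  induction hη using AddSubmonoid.closure_induction with
  | mem α hα => exact (hpos α hα).le
  | zero => rw [map_zero]
  | add a b _ _ ha hb => rw [map_add]; exact add_nonneg ha hb

variable {L : Type*} [AddCommGroup L] [Module ℂ L] [LieRingModule 𝔨 L] [LieModule ℂ 𝔨 L]
  {Λ : Dual ℂ 𝔥}

lemma weightSpace_highestWeight_ne_bot (hL : HasHighestWeight P L Λ) :
    LieModule.weightSpace L (Λ : 𝔥 → ℂ) ≠ ⊥ := by
  obtain ⟨v, hv0, -, hvh, -⟩ := hL
  intro h
  have : v ∈ LieModule.weightSpace L (Λ : 𝔥 → ℂ) := mem_weightSpace_iff.mpr hvh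
  rw [h, LieSubmodule.mem_bot] at this
  exact hv0 this

/-- Dominance of the highest weight, by the representation theory of the `sl₂`-triple of the root.
-/
lemma highestWeight_apply_coroot_nonneg [FiniteDimensional ℂ L] (hL : HasHighestWeight P L Λ)
    {α : Dual ℂ 𝔥} (hα : α ∈ P) {t : 𝔥} {e f : 𝔨} (h : IsRootTriple α t e f) :
    0 ≤ (Λ t).re := by
  obtain ⟨v, hv0, hvn, hvh, -⟩ := hL
  have hp : h.sl2.HasPrimitiveVectorWith v (Λ t) := ⟨hv0, hvh t, hvn e
    ((le_iSup₂ (f := fun (α : Dual ℂ 𝔥) (_ : α ∈ P) =>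
      (LieModule.weightSpace 𝔨 (α : 𝔥 → ℂ)).toSubmodule) α hα) h.mem_e)⟩
  obtain ⟨n, hn⟩ := hp.exists_nat
  rw [hn, Complex.natCast_re]
  exact Nat.cast_nonneg n

/-- The weights `ν + σ` of `L ⊗ S`. -/
def tensorSpinWeights (P : Finset (Dual ℂ 𝔥)) (L : Type*) [AddCommGroup L] [Module ℂ L]
    [LieRingModule 𝔨 L] [LieModule ℂ 𝔨 L] : Set (Dual ℂ 𝔥) :=
  {μ | ∃ ν σ : Dual ℂ 𝔥, LieModule.weightSpace L (ν : 𝔥 → ℂ) ≠ ⊥ ∧ σ ∈ spinWeights P ∧ μ = ν + σ}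

lemma finite_tensorSpinWeights [𝔥.IsCartanSubalgebra] [FiniteDimensional ℂ L] :
    (tensorSpinWeights (𝔨 := 𝔨) P L).Finite := by
  have h1 : {ν : Dual ℂ 𝔥 | LieModule.weightSpace L (ν : 𝔥 → ℂ) ≠ ⊥}.Finite := by
    refine Set.Finite.of_finite_image (f := fun ν : Dual ℂ 𝔥 => (ν : 𝔥 → ℂ))
      ((LieModule.finite_genWeightSpace_ne_bot ℂ 𝔥 L).subset ?_)
      (DFunLike.coe_injective.injOn)
    rintro _ ⟨ν, hν, rfl⟩ hbot
    exact hν (le_bot_iff.mp (hbot ▸ LieModule.weightSpace_le_genWeightSpace L (ν : 𝔥 → ℂ)))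
  refine (h1.add (finite_spinWeights P)).subset ?_
  rintro _ ⟨ν, σ, hν, hσ, rfl⟩
  exact Set.add_mem_add hν hσ

variable [FiniteDimensional ℂ 𝔨]

lemma weylVector_mem_realWeights (hP : IsPositiveSystem 𝔥 P) : weylVector P ∈ realWeights 𝔥 := by
  intro α t e f h
  have h1 : ((∑ β ∈ P, β) t).im = 0 :=
    (sum_mem fun β hβ => mem_realWeights_of_weightSpace_ne_bot (hP.mem_roots hβ).2 :
      (∑ β ∈ P, β) ∈ realWeights 𝔥) α t e f h
  rw [weylVector, LinearMap.smul_apply, smul_eq_mul, Complex.mul_im, h1]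
  norm_num

lemma posCone_le_realWeights (hP : IsPositiveSystem 𝔥 P) {η : Dual ℂ 𝔥} (hη : η ∈ posCone P) :
    η ∈ realWeights 𝔥 := by
  have : posCone P ≤ (realWeights 𝔥).toAddSubmonoid := AddSubmonoid.closure_le.mpr
    fun β hβ => mem_realWeights_of_weightSpace_ne_bot (hP.mem_roots hβ).2
  exact this hη

lemma tensorSpinWeights_subset_realWeights [FiniteDimensional ℂ L] (hP : IsPositiveSystem 𝔥 P)
    {μ : Dual ℂ 𝔥}
    (hμ : μ ∈ tensorSpinWeights P L) : μ ∈ realWeights 𝔥 := by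
  obtain ⟨ν, σ, hν, hσ, rfl⟩ := hμ
  refine add_mem (mem_realWeights_of_weightSpace_ne_bot hν) ?_
  rw [← sub_sub_cancel (weylVector P) σ]
  exact sub_mem (weylVector_mem_realWeights hP)
    (posCone_le_realWeights hP (weylVector_sub_mem_posCone hσ))

variable [𝔥.IsCartanSubalgebra] {r : ℕ} {B : LinearMap.BilinForm ℂ 𝔨}

/-! #### Coadjoint orbits of functionals on the Cartan subalgebra -/

lemma extend_apply (hB : IsQuadratic B) (η : Dual ℂ 𝔥) (y : 𝔨) :
    extend hB η y = B (sharp hB η : 𝔨) y := rfl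

lemma extend_mem_coadjointOrbit_iff (hB : IsQuadratic B) {η ζ : Dual ℂ 𝔥} :
    extend hB ζ ∈ coadjointOrbit (extend hB η) ↔
      ∃ g ∈ adjointGroup 𝔨, (sharp hB ζ : 𝔨) = g (sharp hB η : 𝔨) := by
  refine exists_congr fun g => and_congr_right fun hg => ?_
  have key : ∀ y, B (sharp hB η : 𝔨) (g.symm y) = B (g (sharp hB η : 𝔨)) y := fun y => by
    rw [← form_apply_of_mem_adjointGroup hB hg, LinearEquiv.apply_symm_apply]
  constructor
  · intro h
    refine sub_eq_zero.mp (hB.nondegenerate.1 _ fun y => ?_)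
    have h1 := LinearMap.congr_fun h y
    rw [map_sub, LinearMap.sub_apply, ← key, sub_eq_zero]
    exact h1
  · intro h
    refine LinearMap.ext fun y => ?_
    rw [extend_apply, h, ← key]
    rfl

lemma extend_mem_coadjointOrbit_trans (hB : IsQuadratic B) {η ζ θ : Dual ℂ 𝔥}
    (h₁ : extend hB ζ ∈ coadjointOrbit (extend hB η))
    (h₂ : extend hB θ ∈ coadjointOrbit (extend hB ζ)) :
    extend hB θ ∈ coadjointOrbit (extend hB η) := by
  rw [extend_mem_coadjointOrbit_iff] at *
  obtain ⟨g, hg, h₁⟩ := h₁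
  obtain ⟨k, hk, h₂⟩ := h₂
  exact ⟨k * g, mul_mem hk hg, by rw [h₂, h₁, LinearEquiv.mul_apply]⟩

lemma extend_mem_coadjointOrbit_symm (hB : IsQuadratic B) {η ζ : Dual ℂ 𝔥}
    (h : extend hB ζ ∈ coadjointOrbit (extend hB η)) :
    extend hB η ∈ coadjointOrbit (extend hB ζ) := by
  rw [extend_mem_coadjointOrbit_iff] at *
  obtain ⟨g, hg, h⟩ := h
  exact ⟨g⁻¹, inv_mem hg, by rw [h]; exact (g.symm_apply_apply _).symm⟩

lemma sharp_neg (hB : IsQuadratic B) (η : Dual ℂ 𝔥) : sharp hB (-η) = -sharp hB η :=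
  map_neg (sharpEquiv hB) η

lemma extend_neg_mem_coadjointOrbit (hB : IsQuadratic B) {η ζ : Dual ℂ 𝔥}
    (h : extend hB ζ ∈ coadjointOrbit (extend hB η)) :
    extend hB (-ζ) ∈ coadjointOrbit (extend hB (-η)) := by
  rw [extend_mem_coadjointOrbit_iff] at *
  obtain ⟨g, hg, h⟩ := h
  refine ⟨g, hg, ?_⟩
  rw [sharp_neg, sharp_neg]
  change -(sharp hB ζ : 𝔨) = g (-(sharp hB η : 𝔨))
  rw [h, map_neg]

lemma factorForm_of_mem_coadjointOrbit (dec : ReductiveDecomposition 𝔨 r) (hB : IsQuadratic B)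
    (i : Fin (r + 1)) {η ζ : Dual ℂ 𝔥} (h : extend hB ζ ∈ coadjointOrbit (extend hB η)) :
    factorForm dec hB i ζ ζ = factorForm dec hB i η η := by
  obtain ⟨g, hg, h⟩ := (extend_mem_coadjointOrbit_iff hB).mp h
  rw [factorForm_eq, factorForm_eq, h, proj_apply_of_mem_adjointGroup dec i hg,
    form_apply_of_mem_adjointGroup hB hg]

lemma rootForm_of_mem_coadjointOrbit (dec : ReductiveDecomposition 𝔨 r) (hB : IsQuadratic B)
    {η ζ : Dual ℂ 𝔥} (h : extend hB ζ ∈ coadjointOrbit (extend hB η)) :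
    rootForm dec hB ζ ζ = rootForm dec hB η η := by
  rw [rootForm_apply, rootForm_apply, apply_killingSharp, apply_killingSharp]
  simp_rw [factorForm_of_mem_coadjointOrbit dec hB _ h]

/-! #### The adjoint group and root reflections -/

/-- A root reflection is induced by an element of the adjoint group. -/
lemma exists_mem_adjointGroup_reflection (dec : ReductiveDecomposition 𝔨 r) {α : Dual ℂ 𝔥}
    {t : 𝔥} {e f : 𝔨} (h : IsRootTriple α t e f) :
    ∃ g ∈ adjointGroup 𝔨, ∀ x : 𝔥, g (x : 𝔨) = (x : 𝔨) - α x • (t : 𝔨) := by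
  obtain ⟨g, hg, H⟩ := exists_reflection h.sl2.lie_e_f (h.sl2.lie_h_e_smul ℂ)
    ((h.sl2.lie_lie_smul_f ℂ).trans (neg_smul _ _).symm)
  refine ⟨g, hg, fun x => H x (α x) (dec.lie_eq_zero_of_mem_cartan x.2 t.2)
    (mem_weightSpace_iff.mp h.mem_e x) ?_⟩
  rw [mem_weightSpace_iff.mp h.mem_f x, LinearMap.neg_apply, neg_smul]

/-- The weights of a representation are permuted by the root reflections, because these are realized
in the adjoint group, which acts on representations up to conjugation. -/
lemma weightSpace_rootReflection_ne_bot (dec : ReductiveDecomposition 𝔨 r) {α : Dual ℂ 𝔥}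
    {t : 𝔥} {e f : 𝔨} (h : IsRootTriple α t e f) {V : Type*} [AddCommGroup V] [Module ℂ V]
    [LieRingModule 𝔨 V] [LieModule ℂ 𝔨 V] [FiniteDimensional ℂ V] {ν : Dual ℂ 𝔥}
    (hν : LieModule.weightSpace V (ν : 𝔥 → ℂ) ≠ ⊥) :
    LieModule.weightSpace V (rootReflection h ν : 𝔥 → ℂ) ≠ ⊥ := by
  obtain ⟨g, hg, H⟩ := exists_mem_adjointGroup_reflection dec h
  obtain ⟨E, hE⟩ := exists_equivariant_of_mem_adjointGroup V hg
  obtain ⟨v, hv, hv0⟩ := exists_mem_ne_zero hν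
  intro hbot
  have : E v ∈ LieModule.weightSpace V (rootReflection h ν : 𝔥 → ℂ) := by
    rw [mem_weightSpace_iff]
    intro x
    -- `x = g (x - α(x) t)`, as the reflection is an involution
    have hx : (x : 𝔨) = g ((x - α x • t : 𝔥) : 𝔨) := by
      rw [H, map_sub, map_smul, h.apply_coroot]
      change (x : 𝔨) = ((x : 𝔨) - α x • (t : 𝔨)) - _
      rw [smul_eq_mul]
      module
    rw [hx, hE, mem_weightSpace_iff.mp hv, map_smul, rootReflection_apply]
    congr 1
    simp only [map_sub, map_smul, LinearMap.sub_apply, LinearMap.smul_apply, smul_eq_mul]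
    ring
  rw [hbot, LieSubmodule.mem_bot] at this
  exact hv0 (E.map_eq_zero_iff.mp this)

lemma rootReflection_mem_roots (dec : ReductiveDecomposition 𝔨 r) {α β : Dual ℂ 𝔥}
    {t : 𝔥} {e f : 𝔨} (h : IsRootTriple α t e f) (hβ : β ∈ roots 𝔥 𝔨) :
    rootReflection h β ∈ roots 𝔥 𝔨 :=
  ⟨fun h0 => hβ.1 ((rootReflection h).map_eq_zero_iff.mp h0),
    weightSpace_rootReflection_ne_bot dec h hβ.2⟩

/-- A functional on `𝔥` and its reflection lie in the same coadjoint orbit. -/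
lemma extend_rootReflection_mem (dec : ReductiveDecomposition 𝔨 r) (hB : IsQuadratic B)
    {α : Dual ℂ 𝔥} {t : 𝔥} {e f : 𝔨} (h : IsRootTriple α t e f) (η : Dual ℂ 𝔥) :
    extend hB (rootReflection h η) ∈ coadjointOrbit (extend hB η) := by
  obtain ⟨g, hg, H⟩ := exists_mem_adjointGroup_reflection dec h
  refine (extend_mem_coadjointOrbit_iff hB).mpr ⟨g, hg, ?_⟩
  have h1 : sharp hB (rootReflection h η) = sharp hB η - η t • sharp hB α := by
    rw [rootReflection_apply, ← sharpEquiv_apply, map_sub, map_smul]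
    rfl
  have h2 : η t • sharp hB α = α (sharp hB η) • t := by
    have hs : η (sharp hB α) = α (sharp hB η) := by
      rw [← form_sharp hB, ← form_sharp hB, hB.symm]
    rw [h.coe_coroot hB, map_smul, hs, smul_smul, smul_eq_mul, mul_comm]
  rw [h1, h2, H]
  rfl

/-- The sum of an even function over the positive roots is invariant under permutations of the
roots. -/
lemma IsPositiveSystem.sum_comp_eq (hP : IsPositiveSystem 𝔥 P) (dec : ReductiveDecomposition 𝔨 r)
    {M : Type*} [AddCommGroup M] [Module ℂ M] {F : Dual ℂ 𝔥 → M}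
    (hF : ∀ β ∈ roots 𝔥 𝔨, F (-β) = F β) {s : Dual ℂ 𝔥 ≃ₗ[ℂ] Dual ℂ 𝔥}
    (hs : ∀ β ∈ roots 𝔥 𝔨, s β ∈ roots 𝔥 𝔨) : ∑ β ∈ P, F (s β) = ∑ β ∈ P, F β := by
  classical
  let R : Finset (Dual ℂ 𝔥) := P ∪ P.image (fun β => -β)
  have hR : ∀ β, β ∈ R ↔ β ∈ roots 𝔥 𝔨 := fun β => by
    rw [Finset.mem_union, Finset.mem_image]
    constructor
    · rintro (h | ⟨γ, h, rfl⟩)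
      · exact hP.mem_roots h
      · exact dec.neg_mem_roots (hP.mem_roots h)
    · intro h
      exact (hP.mem_or_neg_mem dec h).imp id fun h => ⟨-β, h, neg_neg β⟩
  have hdisj : Disjoint P (P.image fun β => -β) := by
    rw [Finset.disjoint_left]
    intro β hβ hβ'
    obtain ⟨γ, hγ, rfl⟩ := Finset.mem_image.mp hβ'
    exact hP.neg_notMem hγ hβ
  have hsum : ∀ G : Dual ℂ 𝔥 → M, (∀ β ∈ roots 𝔥 𝔨, G (-β) = G β) →
      ∑ β ∈ R, G β = (2 : ℂ) • ∑ β ∈ P, G β := fun G hG => by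
    rw [Finset.sum_union hdisj, Finset.sum_image fun a _ b _ h => neg_injective h,
      Finset.sum_congr rfl fun β hβ => hG β (hP.mem_roots hβ), two_smul]
  have himg : R.image s = R := by
    refine Finset.eq_of_subset_of_card_le (fun γ hγ => ?_) ?_
    · obtain ⟨β, hβ, rfl⟩ := Finset.mem_image.mp hγ
      exact (hR _).mpr (hs β ((hR β).mp hβ))
    · rw [Finset.card_image_of_injective _ s.injective]
  have h2 : ∑ β ∈ R, F (s β) = ∑ β ∈ R, F β := by
    conv_rhs => rw [← himg, Finset.sum_image fun a _ b _ h => s.injective h]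
  rw [hsum F hF, hsum (fun β => F (s β)) fun β hβ => by rw [map_neg]; exact hF _ (hs β hβ)] at h2
  exact smul_right_injective M (two_ne_zero (α := ℂ)) h2

/-- The set of weights of the spin module is stable under the reflections. -/
lemma rootReflection_mem_spinWeights (hP : IsPositiveSystem 𝔥 P)
    (dec : ReductiveDecomposition 𝔨 r) {α : Dual ℂ 𝔥} {t : 𝔥} {e f : 𝔨}
    (h : IsRootTriple α t e f) {σ : Dual ℂ 𝔥} (hσ : σ ∈ spinWeights P) :
    rootReflection h σ ∈ spinWeights P := by
  classical
  obtain ⟨T, hT, rfl⟩ := hσ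
  -- the odd sign function with `σ = ½ ∑ ε(β) β`
  let ε : Dual ℂ 𝔥 → ℂ := fun β =>
    if β ∈ P then (if β ∈ T then -1 else 1) else (if -β ∈ T then 1 else -1)
  have hε : ∀ β, ε β = 1 ∨ ε β = -1 := fun β => by
    simp only [ε]
    split_ifs <;> simp
  have hodd : ∀ β ∈ roots 𝔥 𝔨, ε (-β) = -ε β := fun β hβ => by
    have h1 := hP.mem_or_neg_mem dec hβ
    have h2 : β ∈ P → -β ∉ P := hP.neg_notMem
    by_cases hp : β ∈ P
    · simp only [ε, if_pos hp, if_neg (h2 hp), neg_neg]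
      split_ifs <;> simp
    · have hn := h1.resolve_left hp
      simp only [ε, if_neg hp, if_pos hn]
      split_ifs <;> simp
  let s := rootReflection h
  have hs : ∀ β, s (s β) = β := fun β => by
    change rootReflection h (rootReflection h β) = β
    simp only [rootReflection_apply, LinearMap.sub_apply, LinearMap.smul_apply, h.apply_coroot,
      smul_eq_mul]
    module
  have hσ : weylVector P - ∑ α ∈ T, α = (1 / 2 : ℂ) • ∑ β ∈ P, ε β • β := by
    have hTf : T = P.filter (· ∈ T) := by
      ext β
      simp only [Finset.mem_filter]
      exact ⟨fun h => ⟨hT h, h⟩, fun h => h.2⟩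
    conv_lhs => rw [hTf]
    rw [weylVector, Finset.sum_filter, Finset.smul_sum, Finset.smul_sum, ← Finset.sum_sub_distrib]
    refine Finset.sum_congr rfl fun β hβ => ?_
    simp only [ε, if_pos hβ]
    split_ifs <;> module
  have hsr : ∀ β ∈ roots 𝔥 𝔨, s β ∈ roots 𝔥 𝔨 := fun β hβ => rootReflection_mem_roots dec h hβ
  have key := hP.sum_comp_eq dec (F := fun β => ε (s β) • β) (fun β hβ => by
    rw [map_neg, hodd _ (hsr β hβ), smul_neg, neg_smul, neg_neg]) hsr
  have : rootReflection h (weylVector P - ∑ α ∈ T, α) =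
      (1 / 2 : ℂ) • ∑ β ∈ P, ε (s β) • β := by
    rw [hσ, map_smul, map_sum, ← key]
    congr 1
    refine Finset.sum_congr rfl fun β _ => ?_
    rw [hs, map_smul]
  rw [this]
  exact half_sum_mem_spinWeights fun β _ => hε _

/-- `⟨ρ, α^∨⟩ > 0`: as `ρ - α` is a weight of the spin module, so is its reflection
`ρ - (⟨ρ, α^∨⟩ - 1) α`. -/
lemma weylVector_apply_coroot_pos (hP : IsPositiveSystem 𝔥 P) (dec : ReductiveDecomposition 𝔨 r)
    {α : Dual ℂ 𝔥} (hα : α ∈ P) {t : 𝔥} {e f : 𝔨} (h : IsRootTriple α t e f) :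
    0 < (weylVector P t).re := by
  obtain ⟨F, hF, hF0⟩ := hP.exists_pos
  have h1 : weylVector P - α ∈ spinWeights P :=
    ⟨{α}, Finset.singleton_subset_iff.mpr hα, by rw [Finset.sum_singleton]⟩
  have h2 := hF0 _ (weylVector_sub_mem_posCone (rootReflection_mem_spinWeights hP dec h h1))
  have h3 : weylVector P - rootReflection h (weylVector P - α) =
      ((weylVector P t).re - 1) • α := by
    rw [rootReflection_apply, LinearMap.sub_apply, h.apply_coroot,
      eq_re_of_mem_realWeights (weylVector_mem_realWeights hP) h]
    ext x
    simp only [LinearMap.sub_apply, LinearMap.smul_apply, smul_eq_mul, Complex.ofReal_re,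
      Complex.real_smul, Complex.ofReal_sub, Complex.ofReal_one]
    ring
  rw [h3, map_smul, smul_eq_mul] at h2
  linarith [nonneg_of_mul_nonneg_left h2 (hF α hα)]

/-! #### Weights of a highest weight module -/

/-- A highest weight module is spanned by weight vectors of weights below the highest weight: the
smallest subspace that contains the highest weight vector and is stable under `𝔫⁻` is a
submodule. -/
lemma mem_span_weightVectors (hP : IsPositiveSystem 𝔥 P) (dec : ReductiveDecomposition 𝔨 r)
    (hL : HasHighestWeight P L Λ) (x : L) : x ∈ Submodule.span ℂ
      {w : L | ∃ ν : Dual ℂ 𝔥, Λ - ν ∈ posCone P ∧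
        w ∈ LieModule.weightSpace L (ν : 𝔥 → ℂ)} := by
  obtain ⟨v, hv0, hvn, hvh, hgen⟩ := hL
  let IsStable : Submodule ℂ L → Prop := fun N =>
    v ∈ N ∧ ∀ α ∈ P, ∀ y ∈ LieModule.weightSpace 𝔨 ((-α : Dual ℂ 𝔥) : 𝔥 → ℂ), ∀ w ∈ N, ⁅y, w⁆ ∈ N
  let U : Submodule ℂ L := sInf {N | IsStable N}
  have hU : IsStable U := by
    refine ⟨Submodule.mem_sInf.mpr fun N hN => hN.1, fun α hα y hy w hw =>
      Submodule.mem_sInf.mpr fun N hN => hN.2 α hα y hy w (Submodule.mem_sInf.mp hw N hN)⟩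
  let U' : Submodule ℂ L :=
    { carrier := {w | w ∈ U ∧ ∀ y : 𝔨, ⁅y, w⁆ ∈ U}
      add_mem' := fun ha hb => ⟨U.add_mem ha.1 hb.1, fun y => by
        rw [lie_add]; exact U.add_mem (ha.2 y) (hb.2 y)⟩
      zero_mem' := ⟨U.zero_mem, fun y => by rw [lie_zero]; exact U.zero_mem⟩
      smul_mem' := fun c a ha => ⟨U.smul_mem c ha.1, fun y => by
        rw [lie_smul]; exact U.smul_mem c (ha.2 y)⟩ }
  have hU' : IsStable U' := by
    refine ⟨⟨hU.1, fun y => ?_⟩, fun α hα y hy w hw => ⟨hU.2 α hα y hy w hw.1, fun z => ?_⟩⟩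
    · refine dec.span_weightSpace_eq_top (𝔥 := 𝔥)
        (p := U.comap ((LieModule.toEnd ℂ 𝔨 L : 𝔨 →ₗ[ℂ] Module.End ℂ L).flip v))
        (fun h => ?_) (fun α hα z hz => ?_) y
      · change ⁅(h : 𝔨), v⁆ ∈ U
        rw [hvh]
        exact U.smul_mem _ hU.1
      · change ⁅z, v⁆ ∈ U
        rcases hP.mem_or_neg_mem dec hα with h | h
        · rw [hvn z]
          · exact U.zero_mem
          · exact (le_iSup₂ (f := fun (α : Dual ℂ 𝔥) (_ : α ∈ P) =>
              (LieModule.weightSpace 𝔨 (α : 𝔥 → ℂ)).toSubmodule) α h) hz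
        · exact hU.2 (-α) h z (by rwa [neg_neg]) v hU.1
    · rw [leibniz_lie]
      exact U.add_mem (hw.2 _) (hU.2 α hα y hy _ (hw.2 z))
  have hUU' : U ≤ U' := sInf_le hU'
  have hUtop : ∀ x : L, x ∈ U := by
    let N : LieSubmodule ℂ 𝔨 L := { U with lie_mem := fun {y w} hw => (hUU' hw).2 y }
    have : N = ⊤ := top_le_iff.mp (hgen ▸ LieSubmodule.lieSpan_le.mpr
      (Set.singleton_subset_iff.mpr hU.1))
    intro x
    have h : x ∈ N := by rw [this]; trivial
    exact h
  refine Submodule.mem_sInf.mp (hUtop x) _ ⟨Submodule.subset_span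
    ⟨Λ, by rw [sub_self]; exact zero_mem _, mem_weightSpace_iff.mpr hvh⟩, ?_⟩
  intro α hα y hy w hw
  induction hw using Submodule.span_induction with
  | mem w hw =>
    obtain ⟨ν, hν, hw⟩ := hw
    refine Submodule.subset_span ⟨ν - α, ?_, ?_⟩
    · rw [sub_sub_eq_add_sub, add_sub_right_comm]
      exact add_mem hν (AddSubmonoid.subset_closure hα)
    · rw [mem_weightSpace_iff] at hw hy ⊢
      intro h
      rw [leibniz_lie, hw, hy, lie_smul, smul_lie, LinearMap.sub_apply, LinearMap.neg_apply]
      module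
  | zero => rw [lie_zero]; exact zero_mem _
  | add a b _ _ ha hb => rw [lie_add]; exact add_mem ha hb
  | smul c a _ ha => rw [lie_smul]; exact Submodule.smul_mem _ _ ha

/-- Since `L` is spanned by weight vectors whose weights lie below `Λ`, independence of the weight
spaces excludes other weights. -/
lemma highestWeight_sub_mem_posCone (hP : IsPositiveSystem 𝔥 P) (dec : ReductiveDecomposition 𝔨 r)
    (hL : HasHighestWeight P L Λ) {ν : Dual ℂ 𝔥}
    (hν : LieModule.weightSpace L (ν : 𝔥 → ℂ) ≠ ⊥) : Λ - ν ∈ posCone P := by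
  by_contra hcon
  obtain ⟨w, hw, hw0⟩ := exists_mem_ne_zero hν
  have hind := LieModule.iSupIndep_genWeightSpace ℂ 𝔥 L
  have hdis := hind (ν : 𝔥 → ℂ)
  refine hw0 ?_
  have h1 := LieModule.weightSpace_le_genWeightSpace L (ν : 𝔥 → ℂ) hw
  have h2 : w ∈ ⨆ (χ : 𝔥 → ℂ) (_ : χ ≠ (ν : 𝔥 → ℂ)), LieModule.genWeightSpace L χ := by
    refine (Submodule.span_le (p := (⨆ (χ : 𝔥 → ℂ) (_ : χ ≠ (ν : 𝔥 → ℂ)),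
      LieModule.genWeightSpace L χ).toSubmodule)).mpr ?_ (mem_span_weightVectors hP dec hL w)
    rintro z ⟨χ, hχ, hz⟩
    have hne : (χ : 𝔥 → ℂ) ≠ (ν : 𝔥 → ℂ) := fun h => hcon (by
      rwa [DFunLike.coe_injective h] at hχ)
    exact (le_iSup₂ (f := fun (χ : 𝔥 → ℂ) (_ : χ ≠ (ν : 𝔥 → ℂ)) => LieModule.genWeightSpace L χ)
      (χ : 𝔥 → ℂ) hne) (LieModule.weightSpace_le_genWeightSpace L _ hz)
  have h3 : w ∈ (⊥ : LieSubmodule ℂ 𝔥 L) := (disjoint_iff_inf_le.mp hdis) ⟨h1, h2⟩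
  exact (LieSubmodule.mem_bot w).mp h3

lemma sub_mem_posCone_of_mem_tensorSpinWeights (hP : IsPositiveSystem 𝔥 P)
    (dec : ReductiveDecomposition 𝔨 r) (hL : HasHighestWeight P L Λ) {μ : Dual ℂ 𝔥}
    (hμ : μ ∈ tensorSpinWeights P L) : Λ + weylVector P - μ ∈ posCone P := by
  obtain ⟨ν, σ, hν, hσ, rfl⟩ := hμ
  rw [add_sub_add_comm]
  exact add_mem (highestWeight_sub_mem_posCone hP dec hL hν) (weylVector_sub_mem_posCone hσ)

variable [FiniteDimensional ℂ L]

lemma rootReflection_mem_tensorSpinWeights (hP : IsPositiveSystem 𝔥 P)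
    (dec : ReductiveDecomposition 𝔨 r) {α : Dual ℂ 𝔥} {t : 𝔥} {e f : 𝔨}
    (h : IsRootTriple α t e f) {μ : Dual ℂ 𝔥} (hμ : μ ∈ tensorSpinWeights P L) :
    rootReflection h μ ∈ tensorSpinWeights P L := by
  obtain ⟨ν, σ, hν, hσ, rfl⟩ := hμ
  exact ⟨_, _, weightSpace_rootReflection_ne_bot dec h hν,
    rootReflection_mem_spinWeights hP dec h hσ, map_add _ _ _⟩

/-- A functional is dominant if its values at the positive coroots are nonnegative. -/
def IsDominant (P : Finset (Dual ℂ 𝔥)) (μ : Dual ℂ 𝔥) : Prop :=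
  ∀ α ∈ P, ∀ t e f, IsRootTriple (𝔨 := 𝔨) α t e f → 0 ≤ (μ t).re

/-- A strictly dominant functional pairs positively with the nonzero elements of the positive
cone. -/
lemma rootForm_pos_of_mem_posCone (dec : ReductiveDecomposition 𝔨 r) (hB : IsQuadratic B)
    (hP : IsPositiveSystem 𝔥 P) {η : Dual ℂ 𝔥}
    (hη : ∀ α ∈ P, ∀ t e f, IsRootTriple (𝔨 := 𝔨) α t e f → 0 < (η t).re) {ζ : Dual ℂ 𝔥}
    (hζ : ζ ∈ posCone P) : ζ = 0 ∨ 0 < rootForm dec hB η ζ := by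
  induction hζ using AddSubmonoid.closure_induction with
  | mem α hα =>
    obtain ⟨t, e, f, h⟩ := dec.exists_isRootTriple (hP.mem_roots hα)
    obtain ⟨c, hc, hc'⟩ := exists_root_killingSharp dec hB h
    refine Or.inr ?_
    rw [rootForm_apply, hc', Complex.re_ofReal_mul]
    exact mul_pos hc (hη α hα t e f h)
  | zero => exact Or.inl rfl
  | add a b _ _ ha hb =>
    rcases ha with rfl | ha
    · rwa [zero_add]
    · refine Or.inr ?_
      rw [map_add]
      rcases hb with rfl | hb
      · rwa [map_zero, add_zero]
      · exact add_pos ha hb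

/-- Among the weights of `L ⊗ S`, the dominant ones are at most as long as `Λ + ρ`, with equality
only for `Λ + ρ`. -/
lemma IsDominant.rootForm_le (dec : ReductiveDecomposition 𝔨 r) (hB : IsQuadratic B)
    (hP : IsPositiveSystem 𝔥 P) (hL : HasHighestWeight P L Λ) {μ : Dual ℂ 𝔥}
    (hμ : μ ∈ tensorSpinWeights P L) (hd : IsDominant P μ) :
    rootForm dec hB μ μ ≤ rootForm dec hB (Λ + weylVector P) (Λ + weylVector P) ∧
      (rootForm dec hB μ μ = rootForm dec hB (Λ + weylVector P) (Λ + weylVector P) →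
        μ = Λ + weylVector P) := by
  obtain ⟨l, hl⟩ : ∃ l, l = Λ + weylVector P := ⟨_, rfl⟩
  rw [← hl]
  have h1 : rootForm dec hB l l - rootForm dec hB μ μ = rootForm dec hB (l + μ) (l - μ) := by
    simp only [map_add, LinearMap.add_apply, map_sub, rootForm_symm dec hB l μ]
    ring
  have h2 := rootForm_pos_of_mem_posCone dec hB hP (η := l + μ) (fun α hα t e f h => by
    rw [hl, LinearMap.add_apply, LinearMap.add_apply, Complex.add_re, Complex.add_re]
    linarith [weylVector_apply_coroot_pos hP dec hα h, hd α hα t e f h,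
      highestWeight_apply_coroot_nonneg hL hα h])
    (hl ▸ sub_mem_posCone_of_mem_tensorSpinWeights hP dec hL hμ)
  rcases h2 with h2 | h2
  · rw [sub_eq_zero] at h2
    exact ⟨by rw [← h2], fun _ => h2.symm⟩
  · exact ⟨by linarith, fun h => by linarith⟩

/-- Every weight of `L ⊗ S` is conjugate to a dominant one, namely to a highest one among those
conjugate to it. -/
lemma exists_isDominant (dec : ReductiveDecomposition 𝔨 r) (hB : IsQuadratic B)
    (hP : IsPositiveSystem 𝔥 P) {μ : Dual ℂ 𝔥}
    (hμ : μ ∈ tensorSpinWeights P L) : ∃ μ' ∈ tensorSpinWeights P L, IsDominant P μ' ∧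
      extend hB μ' ∈ coadjointOrbit (extend hB μ) := by
  obtain ⟨F, hF, -⟩ := hP.exists_pos
  let O : Set (Dual ℂ 𝔥) :=
    {μ' | μ' ∈ tensorSpinWeights P L ∧ extend hB μ' ∈ coadjointOrbit (extend hB μ)}
  have hO : O.Finite := finite_tensorSpinWeights.subset fun _ h => h.1
  have hμO : μ ∈ O := ⟨hμ, 1, one_mem _, rfl⟩
  obtain ⟨μ', hμ', hmax⟩ := hO.exists_maximalFor F O ⟨μ, hμO⟩
  refine ⟨μ', hμ'.1, fun α hα t e f h => ?_, hμ'.2⟩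
  have h1 : rootReflection h μ' ∈ O := ⟨rootReflection_mem_tensorSpinWeights hP dec h hμ'.1,
    extend_mem_coadjointOrbit_trans hB hμ'.2 (extend_rootReflection_mem dec hB h μ')⟩
  have h2 : rootReflection h μ' = μ' - (μ' t).re • α := by
    rw [rootReflection_apply,
      eq_re_of_mem_realWeights (tensorSpinWeights_subset_realWeights hP hμ'.1) h]
    rfl
  by_contra! hneg
  have h3 : F μ' < F (rootReflection h μ') := by
    rw [h2, map_sub, map_smul, smul_eq_mul]
    linarith [mul_neg_of_neg_of_pos hneg (hF α hα)]
  exact absurd (hmax h1 h3.le) (not_le.mpr h3)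

/-- Every weight of `L ⊗ S` is at most as long as `Λ + ρ`; those of maximal length are conjugate to
`Λ + ρ`. -/
lemma rootForm_le_of_mem_tensorSpinWeights (dec : ReductiveDecomposition 𝔨 r) (hB : IsQuadratic B)
    (hP : IsPositiveSystem 𝔥 P) (hL : HasHighestWeight P L Λ) {μ : Dual ℂ 𝔥}
    (hμ : μ ∈ tensorSpinWeights P L) :
    rootForm dec hB μ μ ≤ rootForm dec hB (Λ + weylVector P) (Λ + weylVector P) ∧
      (rootForm dec hB μ μ = rootForm dec hB (Λ + weylVector P) (Λ + weylVector P) →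
        extend hB μ ∈ coadjointOrbit (extend hB (Λ + weylVector P))) := by
  obtain ⟨μ', hμ', hd, ho⟩ := exists_isDominant dec hB hP hμ
  rw [← rootForm_of_mem_coadjointOrbit dec hB ho]
  obtain ⟨h1, h2⟩ := hd.rootForm_le dec hB hP hL hμ'
  refine ⟨h1, fun h => ?_⟩
  rw [h2 h] at ho
  exact extend_mem_coadjointOrbit_symm hB ho

end Weights

/-! ### Normalized root vectors, Casimir elements and the constants of the Laplace family -/

section RootBasis

variable {𝔨 : Type*} [LieRing 𝔨] [LieAlgebra ℂ 𝔨] {𝔥 : LieSubalgebra ℂ 𝔨}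
  {B : LinearMap.BilinForm ℂ 𝔨} {P : Finset (Dual ℂ 𝔥)}

/-- Root vectors `e α`, `f α` for the positive roots and their negatives, with `B(e α, f α) = 1`,
that span the root spaces. -/
structure IsRootBasis (B : LinearMap.BilinForm ℂ 𝔨) (e f : P → 𝔨) : Prop where
  mem_e : ∀ α : P, e α ∈ LieModule.weightSpace 𝔨 ((α : Dual ℂ 𝔥) : 𝔥 → ℂ)
  mem_f : ∀ α : P, f α ∈ LieModule.weightSpace 𝔨 ((-(α : Dual ℂ 𝔥) : Dual ℂ 𝔥) : 𝔥 → ℂ)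
  form_e_f : ∀ α : P, B (e α) (f α) = 1
  exists_smul_e : ∀ α : P, ∀ x ∈ LieModule.weightSpace 𝔨 ((α : Dual ℂ 𝔥) : 𝔥 → ℂ),
    ∃ c : ℂ, x = c • e α
  exists_smul_f : ∀ α : P,
    ∀ x ∈ LieModule.weightSpace 𝔨 ((-(α : Dual ℂ 𝔥) : Dual ℂ 𝔥) : 𝔥 → ℂ), ∃ c : ℂ, x = c • f α

lemma weightSpace_le_nPos {α : Dual ℂ 𝔥} (hα : α ∈ P) {x : 𝔨}
    (hx : x ∈ LieModule.weightSpace 𝔨 (α : 𝔥 → ℂ)) : x ∈ nPos P :=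
  (le_iSup₂ (f := fun (α : Dual ℂ 𝔥) (_ : α ∈ P) =>
    (LieModule.weightSpace 𝔨 (α : 𝔥 → ℂ)).toSubmodule) α hα) hx

lemma weightSpace_le_nNeg {α : Dual ℂ 𝔥} (hα : α ∈ P) {x : 𝔨}
    (hx : x ∈ LieModule.weightSpace 𝔨 ((-α : Dual ℂ 𝔥) : 𝔥 → ℂ)) : x ∈ nNeg P :=
  (le_iSup₂ (f := fun (α : Dual ℂ 𝔥) (_ : α ∈ P) =>
    (LieModule.weightSpace 𝔨 ((-α : Dual ℂ 𝔥) : 𝔥 → ℂ)).toSubmodule) α hα) hx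

/-- A basis of the Cartan subalgebra followed by positive and negative root vectors. -/
def cartanWeylSystem {J : Type*} (b : J → 𝔥) (e f : P → 𝔨) : (J ⊕ P) ⊕ P → 𝔨 :=
  Sum.elim (Sum.elim (fun j => (b j : 𝔨)) e) f

lemma sum_cartanWeylSystem {J : Type*} [Fintype J] {b b' : J → 𝔥} {e f : P → 𝔨} {M : Type*}
    [AddCommGroup M] (F : 𝔨 → 𝔨 → M) :
    ∑ j, F (cartanWeylSystem b e f j) (cartanWeylSystem b' f e j) =
      ∑ j, F (b j) (b' j) + ∑ α, F (e α) (f α) + ∑ α, F (f α) (e α) := by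
  rw [Fintype.sum_sum_type, Fintype.sum_sum_type]
  rfl

variable {e f : P → 𝔨}

lemma IsRootBasis.form_e_e (hef : IsRootBasis B e f) (hB : IsQuadratic B)
    (hP : IsPositiveSystem 𝔥 P) (α β : P) :
    B (e α) (e β) = 0 :=
  form_nPos_eq_zero hB hP (weightSpace_le_nPos α.2 (hef.mem_e α))
    (weightSpace_le_nPos β.2 (hef.mem_e β))

lemma IsRootBasis.form_f_f (hef : IsRootBasis B e f) (hB : IsQuadratic B)
    (hP : IsPositiveSystem 𝔥 P) (α β : P) :
    B (f α) (f β) = 0 :=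
  form_nNeg_eq_zero hB hP (weightSpace_le_nNeg α.2 (hef.mem_f α))
    (weightSpace_le_nNeg β.2 (hef.mem_f β))

lemma IsRootBasis.form_e_f_of_ne (hef : IsRootBasis B e f) (hB : IsQuadratic B) {α β : P}
    (h : α ≠ β) : B (e α) (f β) = 0 :=
  form_eq_zero_of_add_ne_zero hB (fun h0 => h (Subtype.ext (add_neg_eq_zero.mp h0)))
    (hef.mem_e α) (hef.mem_f β)

lemma IsRootBasis.form_e_f_eq (hef : IsRootBasis B e f) (hB : IsQuadratic B) (α β : P)
    [Decidable (α = β)] : B (e α) (f β) = if α = β then 1 else 0 := by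
  split_ifs with h
  · rw [h, hef.form_e_f]
  · exact hef.form_e_f_of_ne hB h

lemma proj_mem_weightSpace {r : ℕ} (dec : ReductiveDecomposition 𝔨 r) (i : Fin (r + 1))
    {α : Dual ℂ 𝔥} {x : 𝔨} (hx : x ∈ LieModule.weightSpace 𝔨 (α : 𝔥 → ℂ)) :
    dec.proj i x ∈ LieModule.weightSpace 𝔨 (α : 𝔥 → ℂ) := by
  rw [mem_weightSpace_iff] at hx ⊢
  intro h
  rw [dec.lie_proj, hx, map_smul]

/-- A nonzero element of the Clifford algebra killed by left multiplication with `𝔫⁺`: the product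
of the positive root vectors. -/
lemma exists_clifford_vacuum (hB : IsQuadratic B) (hP : IsPositiveSystem 𝔥 P)
    (hef : IsRootBasis B e f) : ∃ w : Cl B, w ≠ 0 ∧ ∀ α, cl B (e α) * w = 0 := by
  classical
  have key : ∀ T : Finset P, ∃ w : Cl B, w ≠ 0 ∧ (∀ α ∈ T, cl B (e α) * w = 0) ∧
      ∀ α ∉ T, CliffordAlgebra.contractLeft (B (f α)) w = 0 := by
    intro T
    induction T using Finset.induction_on with
    | empty =>
      refine ⟨1, one_ne_zero, fun α h => absurd h (Finset.notMem_empty α), fun α _ => ?_⟩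
      rw [CliffordAlgebra.contractLeft_one]
    | insert β T hβ ih =>
      obtain ⟨w, hw0, hw1, hw2⟩ := ih
      have hc : ∀ α, α ∉ T → CliffordAlgebra.contractLeft (B (f α)) (cl B (e β) * w) =
          B (f α) (e β) • w := fun α hα => by
        rw [CliffordAlgebra.contractLeft_ι_mul, hw2 α hα, mul_zero, sub_zero]
      refine ⟨cl B (e β) * w, fun h0 => hw0 ?_, fun α hα => ?_, fun α hα => ?_⟩
      · have := hc β hβ
        rwa [h0, map_zero, hB.symm, hef.form_e_f, one_smul, eq_comm] at this
      · have h1 := cl_mul_add hB.symm (e α) (e β)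
        rw [hef.form_e_e hB hP, mul_zero, map_zero] at h1
        rw [← mul_assoc]
        rcases Finset.mem_insert.mp hα with rfl | h
        · rw [cl_mul_self, hef.form_e_e hB hP, map_zero, zero_mul]
        · rw [eq_neg_of_add_eq_zero_left h1, neg_mul, mul_assoc, hw1 α h, mul_zero, neg_zero]
      · rw [Finset.mem_insert, not_or] at hα
        rw [hc α hα.2, hB.symm, hef.form_e_f_of_ne hB (Ne.symm hα.1), zero_smul]
  obtain ⟨w, h0, h1, -⟩ := key Finset.univ
  exact ⟨w, h0, fun α => h1 α (Finset.mem_univ α)⟩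

variable [FiniteDimensional ℂ 𝔨] [𝔥.IsCartanSubalgebra] {r : ℕ}

lemma coe_mem_weightSpace_zero (dec : ReductiveDecomposition 𝔨 r) (h : 𝔥) :
    (h : 𝔨) ∈ LieModule.weightSpace 𝔨 ((0 : Dual ℂ 𝔥) : 𝔥 → ℂ) := by
  rw [mem_weightSpace_iff]
  intro x
  rw [LinearMap.zero_apply, zero_smul]
  exact dec.lie_eq_zero_of_mem_cartan x.2 h.2

lemma form_cartan_root (dec : ReductiveDecomposition 𝔨 r) (hB : IsQuadratic B) (h : 𝔥)
    {α : Dual ℂ 𝔥} (hα : α ≠ 0) {x : 𝔨} (hx : x ∈ LieModule.weightSpace 𝔨 (α : 𝔥 → ℂ)) :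
    B h x = 0 :=
  form_eq_zero_of_add_ne_zero hB (by rwa [zero_add]) (coe_mem_weightSpace_zero dec h) hx

/-- The root spaces are one-dimensional, so the root vectors of two opposite triples can be rescaled
to dual ones. -/
lemma exists_isRootBasis (dec : ReductiveDecomposition 𝔨 r) (hB : IsQuadratic B)
    (hP : IsPositiveSystem 𝔥 P) : ∃ e f : P → 𝔨, IsRootBasis B e f := by
  have key : ∀ α : P, ∃ x y : 𝔨, x ∈ LieModule.weightSpace 𝔨 ((α : Dual ℂ 𝔥) : 𝔥 → ℂ) ∧
      y ∈ LieModule.weightSpace 𝔨 ((-(α : Dual ℂ 𝔥) : Dual ℂ 𝔥) : 𝔥 → ℂ) ∧ B x y = 1 ∧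
      (∀ z ∈ LieModule.weightSpace 𝔨 ((α : Dual ℂ 𝔥) : 𝔥 → ℂ), ∃ c : ℂ, z = c • x) ∧
      ∀ z ∈ LieModule.weightSpace 𝔨 ((-(α : Dual ℂ 𝔥) : Dual ℂ 𝔥) : 𝔥 → ℂ),
        ∃ c : ℂ, z = c • y := by
    intro α
    obtain ⟨t, x, y, h1, h2, h3, h4, h5⟩ := dec.exists_sl2 (hP.mem_roots α.2)
    obtain ⟨-, y', -, -, -, -, -, h6⟩ := dec.exists_sl2 (dec.neg_mem_roots (hP.mem_roots α.2))
    have h : IsRootTriple (α : Dual ℂ 𝔥) t x y := ⟨h1, h2, h3, h4⟩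
    have hne := h.form_ne_zero hB
    refine ⟨x, (B x y)⁻¹ • y, h3, Submodule.smul_mem _ _ h4, ?_, h5, fun z hz => ?_⟩
    · rw [map_smul, smul_eq_mul, inv_mul_cancel₀ hne]
    · obtain ⟨c, hc⟩ := h6 z hz
      obtain ⟨d, hd⟩ := h6 y h4
      have hd0 : d ≠ 0 := fun h0 => h1.f_ne_zero (by rw [hd, h0, zero_smul])
      refine ⟨c * d⁻¹ * B x y, ?_⟩
      rw [smul_smul, mul_assoc, mul_inv_cancel₀ hne, mul_one, hc, hd, smul_smul, mul_assoc,
        inv_mul_cancel₀ hd0, mul_one]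
  choose e f h1 h2 h3 h4 h5 using key
  exact ⟨e, f, h1, h2, h3, h4, h5⟩

lemma exists_cartan_dualSystem (hB : IsQuadratic B) :
    ∃ b b' : Fin (finrank ℂ 𝔥) → 𝔥, (∀ h : 𝔥, ∑ j, B (h : 𝔨) (b' j) • b j = h) ∧
      ∀ j, B (b j : 𝔨) (b' j) = 1 := by
  have hnd := restrict_cartan_nondegenerate (𝔥 := 𝔥) hB
  refine ⟨Module.finBasis ℂ 𝔥, (B.restrict 𝔥.toSubmodule).dualBasis hnd (Module.finBasis ℂ 𝔥),
    isDualSystem_dualBasis (B := B.restrict 𝔥.toSubmodule) (fun a b => hB.symm a b) hnd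
      (Module.finBasis ℂ 𝔥), fun j => ?_⟩
  rw [hB.symm]
  exact (LinearMap.BilinForm.apply_dualBasis_left (B := B.restrict 𝔥.toSubmodule) hnd
    (Module.finBasis ℂ 𝔥) j j).trans (if_pos rfl)

variable {J : Type*} [Fintype J] {b b' : J → 𝔥}

lemma isDualSystem_cartanWeylSystem (dec : ReductiveDecomposition 𝔨 r) (hB : IsQuadratic B)
    (hP : IsPositiveSystem 𝔥 P) (hef : IsRootBasis B e f)
    (hb : ∀ h : 𝔥, ∑ j, B (h : 𝔨) (b' j) • b j = h) :
    IsDualSystem B (cartanWeylSystem b e f) (cartanWeylSystem b' f e) := by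
  classical
  have h0 : ∀ α : P, (α : Dual ℂ 𝔥) ≠ 0 := fun α => (hP.mem_roots α.2).1
  let T : 𝔨 →ₗ[ℂ] 𝔨 :=
    ∑ j, (B.flip (cartanWeylSystem b' f e j)).smulRight (cartanWeylSystem b e f j)
  have hT : ∀ x, T x = ∑ j, B x (b' j) • (b j : 𝔨) + ∑ α, B x (f α) • e α +
      ∑ α, B x (e α) • f α := fun x => by
    rw [← sum_cartanWeylSystem fun y z => B x z • y]
    simp [T, LinearMap.sum_apply]
  suffices h : ∀ x, T x = x by
    intro x
    rw [sum_cartanWeylSystem fun y z => B x z • y, ← hT, h]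
  have hE : ∀ α : P, T (e α) = e α := fun α => by
    rw [hT, Finset.sum_eq_zero, Finset.sum_eq_single α, Finset.sum_eq_zero, hef.form_e_f,
      one_smul, zero_add, add_zero]
    · intro β _
      rw [hef.form_e_e hB hP, zero_smul]
    · intro β _ hβ
      rw [hef.form_e_f_of_ne hB hβ.symm, zero_smul]
    · exact fun h => absurd (Finset.mem_univ _) h
    · intro j _
      rw [hB.symm, form_cartan_root dec hB _ (h0 α) (hef.mem_e α), zero_smul]
  have hF : ∀ α : P, T (f α) = f α := fun α => by
    rw [hT, Finset.sum_eq_zero, Finset.sum_eq_zero, Finset.sum_eq_single α, hB.symm,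
      hef.form_e_f, one_smul, zero_add, zero_add]
    · intro β _ hβ
      rw [hB.symm, hef.form_e_f_of_ne hB hβ, zero_smul]
    · exact fun h => absurd (Finset.mem_univ _) h
    · intro β _
      rw [hef.form_f_f hB hP, zero_smul]
    · intro j _
      rw [hB.symm, form_cartan_root dec hB _ (neg_ne_zero.mpr (h0 α)) (hef.mem_f α), zero_smul]
  refine dec.span_weightSpace_eq_top (𝔥 := 𝔥) (p := LinearMap.eqLocus T LinearMap.id)
    (fun h => ?_) fun α hα x hx => ?_
  · change T h = h
    rw [hT, Finset.sum_eq_zero (s := (Finset.univ : Finset P)),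
      Finset.sum_eq_zero (s := (Finset.univ : Finset P)), add_zero, add_zero]
    · refine Eq.trans ?_ (congrArg Subtype.val (hb h))
      exact (map_sum 𝔥.toSubmodule.subtype (fun j => B (h : 𝔨) (b' j) • b j) Finset.univ).symm
    · intro β _
      rw [form_cartan_root dec hB _ (h0 β) (hef.mem_e β), zero_smul]
    · intro β _
      rw [form_cartan_root dec hB _ (neg_ne_zero.mpr (h0 β)) (hef.mem_f β), zero_smul]
  · change T x = x
    rcases hP.mem_or_neg_mem dec hα with h | h
    · obtain ⟨c, rfl⟩ := hef.exists_smul_e ⟨α, h⟩ x hx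
      rw [map_smul, hE]
    · obtain ⟨c, rfl⟩ := hef.exists_smul_f ⟨-α, h⟩ x (by rwa [neg_neg])
      rw [map_smul, hF]

/-! #### Casimir elements on highest weight vectors -/

/-- The partial Casimir element of the `i`-th factor acts on a highest weight vector of weight `χ`
by `(χ, χ + 2ρ)ᵢ`. -/
lemma casimir_apply (dec : ReductiveDecomposition 𝔨 r) (hB : IsQuadratic B)
    (hef : IsRootBasis B e f) (hb : ∀ h : 𝔥, ∑ j, B (h : 𝔨) (b' j) • b j = h)
    (i : Fin (r + 1)) {V : Type*} [AddCommGroup V] [Module ℂ V] {π : 𝔨 →ₗ[ℂ] Module.End ℂ V}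
    (hπ : ∀ x y, π ⁅x, y⁆ = π x * π y - π y * π x) {w : V} {χ : Dual ℂ 𝔥}
    (hw : ∀ α, π (e α) w = 0) (hχ : ∀ h : 𝔥, π h w = χ h • w) :
    (∑ j, π (dec.proj i (cartanWeylSystem b' f e j)) *
      π (dec.proj i (cartanWeylSystem b e f j))) w =
      (factorForm dec hB i χ χ + 2 * factorForm dec hB i χ (weylVector P)) • w := by
  have hw' : ∀ α, π (dec.proj i (e α)) w = 0 := fun α => by
    obtain ⟨c, hc⟩ := hef.exists_smul_e α _ (proj_mem_weightSpace dec i (hef.mem_e α))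
    rw [hc, map_smul, LinearMap.smul_apply, hw, smul_zero]
  have hχ' : ∀ h : 𝔥, π (dec.proj i h) w = χ (dec.projH i h) • w := fun h => hχ (dec.projH i h)
  rw [sum_cartanWeylSystem fun y z => π (dec.proj i z) * π (dec.proj i y)]
  have h1 : (∑ j, π (dec.proj i (b' j)) * π (dec.proj i (b j))) w =
      factorForm dec hB i χ χ • w := by
    rw [LinearMap.sum_apply, factorForm_apply, ← dec.projH_projH]
    conv_rhs => rw [← hb (dec.projH i (sharp hB χ))]
    simp only [map_sum, map_smul, Finset.sum_smul]
    refine Finset.sum_congr rfl fun j _ => ?_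
    rw [Module.End.mul_apply, hχ', map_smul, hχ', smul_smul, dec.coe_projH,
      dec.form_proj_left hB, ← dec.coe_projH, form_sharp, smul_eq_mul, mul_comm]
  have h2 : (∑ α, π (dec.proj i (f α)) * π (dec.proj i (e α))) w = 0 := by
    rw [LinearMap.sum_apply]
    refine Finset.sum_eq_zero fun α _ => ?_
    rw [Module.End.mul_apply, hw', map_zero]
  have h3 : (∑ α, π (dec.proj i (e α)) * π (dec.proj i (f α))) w =
      (2 * factorForm dec hB i χ (weylVector P)) • w := by
    have h4 : ∀ α : P, π (dec.proj i (e α)) * π (dec.proj i (f α)) =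
        π (dec.projH i (sharp hB (α : Dual ℂ 𝔥))) +
          π (dec.proj i (f α)) * π (dec.proj i (e α)) := fun α => by
      have h5 := lie_eq_smul_sharp hB (hef.mem_e α) (hef.mem_f α)
      rw [hef.form_e_f, one_smul] at h5
      rw [dec.coe_projH, ← h5, ← dec.lie_proj, ← dec.proj_lie_proj, hπ, sub_add_cancel]
    simp_rw [h4]
    rw [Finset.sum_add_distrib, LinearMap.add_apply, h2, add_zero, LinearMap.sum_apply]
    simp_rw [hχ]
    rw [← Finset.sum_smul]
    congr 1
    rw [weylVector, map_smul, smul_eq_mul, ← mul_assoc, mul_one_div_cancel two_ne_zero, one_mul,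
      map_sum, ← Finset.sum_coe_sort P]
    exact Finset.sum_congr rfl fun α _ => by rw [factorForm_symm, factorForm_apply]
  rw [LinearMap.add_apply, LinearMap.add_apply, h1, h2, h3, add_zero, ← add_smul]

/-- The partial Casimir element of the `i`-th factor acts on a highest weight module by a scalar. -/
lemma casimir_apply_highestWeight (dec : ReductiveDecomposition 𝔨 r) (hB : IsQuadratic B)
    (hP : IsPositiveSystem 𝔥 P)
    (hef : IsRootBasis B e f) (hb : ∀ h : 𝔥, ∑ j, B (h : 𝔨) (b' j) • b j = h)
    (i : Fin (r + 1)) {L : Type*} [AddCommGroup L] [Module ℂ L] [LieRingModule 𝔨 L]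
    [LieModule ℂ 𝔨 L] {Λ : Dual ℂ 𝔥} (hL : HasHighestWeight P L Λ) (x : L) :
    (∑ j, LieModule.toEnd ℂ 𝔨 L (dec.proj i (cartanWeylSystem b' f e j)) *
      LieModule.toEnd ℂ 𝔨 L (dec.proj i (cartanWeylSystem b e f j))) x =
      (factorForm dec hB i Λ Λ + 2 * factorForm dec hB i Λ (weylVector P)) • x := by
  obtain ⟨v, -, hvn, hvh, hgen⟩ := hL
  let π : 𝔨 →ₗ[ℂ] Module.End ℂ L := (LieModule.toEnd ℂ 𝔨 L : 𝔨 →ₗ[ℂ] Module.End ℂ L)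
  have hπ : ∀ x y, π ⁅x, y⁆ = π x * π y - π y * π x := fun x y =>
    (LieModule.toEnd ℂ 𝔨 L).map_lie x y
  have h := isDualSystem_cartanWeylSystem dec hB hP hef hb
  let u := cartanWeylSystem b e f
  let v' := cartanWeylSystem b' f e
  let K : Module.End ℂ L := ∑ j, π (dec.proj i (v' j)) * π (dec.proj i (u j))
  have hcomm : ∀ y, π y * K = K * π y := fun y => by
    let F : 𝔨 →ₗ[ℂ] 𝔨 →ₗ[ℂ] Module.End ℂ L :=
      ((LinearMap.mul ℂ (Module.End ℂ L)).compl₁₂ (π ∘ₗ dec.proj i) (π ∘ₗ dec.proj i)).flip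
    have h1 : ∑ j, π (dec.proj i (v' j)) * π (dec.proj i ⁅y, u j⁆) =
        -∑ j, π (dec.proj i ⁅y, v' j⁆) * π (dec.proj i (u j)) := h.sum_lie hB F y
    rw [← sub_eq_zero]
    have h2 : π y * K - K * π y = ∑ j, π (dec.proj i ⁅y, v' j⁆) * π (dec.proj i (u j)) +
        ∑ j, π (dec.proj i (v' j)) * π (dec.proj i ⁅y, u j⁆) := by
      simp only [K, Finset.mul_sum, Finset.sum_mul, ← Finset.sum_sub_distrib,
        ← Finset.sum_add_distrib]
      refine Finset.sum_congr rfl fun j _ => ?_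
      rw [← dec.lie_proj, ← dec.lie_proj, hπ, hπ]
      noncomm_ring
    rw [h2, h1, add_neg_cancel]
  set c := factorForm dec hB i Λ Λ + 2 * factorForm dec hB i Λ (weylVector P) with hc
  let N : LieSubmodule ℂ 𝔨 L :=
    { LinearMap.eqLocus K (c • LinearMap.id) with
      lie_mem := fun {y m} hm => by
        change K m = c • m at hm
        change K (π y m) = c • π y m
        rw [← Module.End.mul_apply, ← hcomm, Module.End.mul_apply, hm, map_smul] }
  have hN : N = ⊤ := top_le_iff.mp (hgen ▸ LieSubmodule.lieSpan_le.mpr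
    (Set.singleton_subset_iff.mpr (show K v = c • v from
      casimir_apply dec hB hef hb i hπ
        (fun α => hvn _ (weightSpace_le_nPos α.2 (hef.mem_e α))) hvh)))
  have hx : x ∈ N := by rw [hN]; trivial
  exact hx

/-! #### The spin representation on the Cartan subalgebra, and the constants -/

/-- On the Cartan subalgebra the spin representation involves only the root vectors, hence takes
values in the subalgebra `Cl(𝔭)`; the constant `ρ(h)` arises from normal ordering. -/
lemma spinElement_cartan (dec : ReductiveDecomposition 𝔨 r) (hB : IsQuadratic B)
    (hef : IsRootBasis B e f) (h : 𝔥) :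
    spinElement B (cartanWeylSystem b e f) (cartanWeylSystem b' f e) (h : 𝔨) =
      algebraMap ℂ (Cl B) (weylVector P h) -
        (1 / 2 : ℂ) • ∑ α : P, (α : Dual ℂ 𝔥) h • (cl B (f α) * cl B (e α)) := by
  rw [spinElement_apply, sum_cartanWeylSystem fun y z => cl B z * cl B ⁅(h : 𝔨), y⁆]
  have h1 : ∑ j, cl B (b' j) * cl B ⁅(h : 𝔨), (b j : 𝔨)⁆ = 0 := Finset.sum_eq_zero fun j _ => by
    rw [dec.lie_eq_zero_of_mem_cartan h.2 (b j).2, map_zero, mul_zero]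
  have h2 : ∀ α : P, cl B (f α) * cl B ⁅(h : 𝔨), e α⁆ =
      (α : Dual ℂ 𝔥) h • (cl B (f α) * cl B (e α)) := fun α => by
    rw [mem_weightSpace_iff.mp (hef.mem_e α), map_smul, mul_smul_comm]
  have h3 : ∀ α : P, cl B (e α) * cl B ⁅(h : 𝔨), f α⁆ =
      (α : Dual ℂ 𝔥) h • (cl B (f α) * cl B (e α)) -
        algebraMap ℂ (Cl B) (2 * (α : Dual ℂ 𝔥) h) := fun α => by
    have h4 := cl_mul_add hB.symm (e α) (f α)
    rw [hef.form_e_f, mul_one] at h4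
    rw [mem_weightSpace_iff.mp (hef.mem_f α), map_smul, mul_smul_comm, LinearMap.neg_apply,
      eq_sub_of_add_eq h4, mul_comm (2 : ℂ), map_mul, ← Algebra.smul_def]
    module
  simp_rw [h1, h2, h3]
  have h5 : algebraMap ℂ (Cl B) (weylVector P h) =
      (1 / 4 : ℂ) • ∑ α : P, algebraMap ℂ (Cl B) (2 * (α : Dual ℂ 𝔥) h) := by
    rw [← map_sum, ← Finset.mul_sum, Algebra.smul_def, ← map_mul, weylVector,
      LinearMap.smul_apply, LinearMap.sum_apply, Finset.sum_coe_sort P fun α => α h, smul_eq_mul]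
    congr 1
    ring
  rw [h5, Finset.sum_sub_distrib]
  module

/-- The constant term of the Laplace family of a factor is `(ρ, ρ)ᵢ`: the spin representation has a
highest weight vector of weight `ρ`. -/
lemma spinElement_casimir (dec : ReductiveDecomposition 𝔨 r) (hB : IsQuadratic B)
    (hP : IsPositiveSystem 𝔥 P)
    (hef : IsRootBasis B e f) (hb : ∀ h : 𝔥, ∑ j, B (h : 𝔨) (b' j) • b j = h)
    (i : Fin (r + 1)) {c : ℂ}
    (hc : algebraMap ℂ (Cl B) c = (1 / 3 : ℂ) • ∑ j,
      spinElement B (cartanWeylSystem b e f) (cartanWeylSystem b' f e)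
        (dec.proj i (cartanWeylSystem b' f e j)) *
      spinElement B (cartanWeylSystem b e f) (cartanWeylSystem b' f e)
        (dec.proj i (cartanWeylSystem b e f j))) :
    c = factorForm dec hB i (weylVector P) (weylVector P) := by
  obtain ⟨F, hF, -⟩ := hP.exists_pos
  obtain ⟨w, hw0, hw⟩ := exists_clifford_vacuum hB hP hef
  have hdual := isDualSystem_cartanWeylSystem dec hB hP hef hb
  set u := cartanWeylSystem b e f with hu
  set v := cartanWeylSystem b' f e with hv
  have hpos : ∀ (α β : P), cl B ⁅e α, e β⁆ * w = 0 := fun α β => by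
    have hmem : ⁅e α, e β⁆ ∈ LieModule.weightSpace 𝔨
        (((α : Dual ℂ 𝔥) + β : Dual ℂ 𝔥) : 𝔥 → ℂ) := by
      rw [mem_weightSpace_iff]
      intro h
      rw [leibniz_lie, mem_weightSpace_iff.mp (hef.mem_e α), mem_weightSpace_iff.mp (hef.mem_e β),
        smul_lie, lie_smul, ← add_smul, LinearMap.add_apply]
    by_cases h0 : ⁅e α, e β⁆ = 0
    · rw [h0, map_zero, zero_mul]
    · have hFpos : 0 < F ((α : Dual ℂ 𝔥) + β) := by
        rw [map_add]
        exact add_pos (hF _ α.2) (hF _ β.2)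
      have hroot : (α : Dual ℂ 𝔥) + β ∈ roots 𝔥 𝔨 := by
        refine ⟨fun hz => ?_, fun hz => h0 ?_⟩
        · rw [hz, map_zero] at hFpos
          exact lt_irrefl _ hFpos
        · rwa [hz, LieSubmodule.mem_bot] at hmem
      have hP' : (α : Dual ℂ 𝔥) + β ∈ P := by
        refine (hP.mem_or_neg_mem dec hroot).resolve_right fun hn => ?_
        have := hF _ hn
        rw [map_neg] at this
        linarith
      obtain ⟨c, hc⟩ := hef.exists_smul_e ⟨_, hP'⟩ _ hmem
      rw [hc, map_smul, smul_mul_assoc, hw, smul_zero]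
  let π : 𝔨 →ₗ[ℂ] Module.End ℂ (Cl B) := LinearMap.mul ℂ (Cl B) ∘ₗ spinElement B u v
  have hπ : ∀ x y, π ⁅x, y⁆ = π x * π y - π y * π x := fun x y => by
    refine LinearMap.ext fun z => ?_
    change spinElement B u v ⁅x, y⁆ * z = spinElement B u v x * (spinElement B u v y * z) -
      spinElement B u v y * (spinElement B u v x * z)
    rw [← spinElement_lie hB hdual, sub_mul, mul_assoc, mul_assoc]
  have he : ∀ α, π (e α) w = 0 := fun α => by
    change spinElement B u v (e α) * w = 0
    rw [spinElement_apply, sum_cartanWeylSystem fun y z => cl B z * cl B ⁅e α, y⁆, smul_mul_assoc,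
      add_mul, add_mul, Finset.sum_mul, Finset.sum_mul, Finset.sum_mul, Finset.sum_eq_zero,
      Finset.sum_eq_zero, Finset.sum_eq_zero, add_zero, add_zero, smul_zero]
    · intro β _
      have hlie : ⁅e α, f β⁆ ∈ LieModule.weightSpace 𝔨
          (((α : Dual ℂ 𝔥) - β : Dual ℂ 𝔥) : 𝔥 → ℂ) := by
        rw [mem_weightSpace_iff]
        intro h
        rw [leibniz_lie, mem_weightSpace_iff.mp (hef.mem_e α),
          mem_weightSpace_iff.mp (hef.mem_f β), smul_lie, lie_smul, ← add_smul, LinearMap.sub_apply,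
          LinearMap.neg_apply, sub_eq_add_neg]
      have h1 := cl_mul_add hB.symm (e β) ⁅e α, f β⁆
      rw [form_eq_zero_of_add_ne_zero hB
        (by rw [add_sub_cancel]; exact (hP.mem_roots α.2).1) (hef.mem_e β) hlie, mul_zero,
        map_zero] at h1
      rw [eq_neg_of_add_eq_zero_left h1, neg_mul, mul_assoc, hw, mul_zero, neg_zero]
    · intro β _
      rw [mul_assoc, hpos, mul_zero]
    · intro j _
      rw [← lie_skew, mem_weightSpace_iff.mp (hef.mem_e α), map_neg, map_smul, mul_assoc, neg_mul,
        smul_mul_assoc, hw, smul_zero, neg_zero, mul_zero]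
  have hh : ∀ h : 𝔥, π h w = weylVector P h • w := fun h => by
    change spinElement B u v h * w = _
    rw [hu, hv, spinElement_cartan dec hB hef, sub_mul, smul_mul_assoc, Finset.sum_mul,
      Finset.sum_eq_zero, smul_zero, sub_zero, Algebra.smul_def]
    intro α _
    rw [smul_mul_assoc, mul_assoc, hw, mul_zero, smul_zero]
  have hcas := casimir_apply dec hB hef hb i hπ he hh
  have h1 : c • w = (1 / 3 : ℂ) • ((∑ j, π (dec.proj i (v j)) * π (dec.proj i (u j))) w) := by
    rw [Algebra.smul_def, hc, smul_mul_assoc, LinearMap.sum_apply, Finset.sum_mul]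
    refine congrArg _ (Finset.sum_congr rfl fun j _ => ?_)
    exact mul_assoc _ _ _
  rw [hcas, smul_smul] at h1
  rw [smul_left_injective ℂ hw0 h1]
  ring

end RootBasis

/-! ### The Laplace operators on `L ⊗ S` and their common eigenvectors -/

section Kernel

/-- Simultaneously diagonal operators with a common null vector annihilate one of the common
eigenvectors that span the space. -/
lemma exists_mem_of_ker {V ι : Type*} [AddCommGroup V] [Module ℂ V] {Δ : ι → Module.End ℂ V}
    {S : Set V} (hS : ∀ x, x ∈ Submodule.span ℂ S)
    (hΔ : ∀ s ∈ S, ∀ i, ∃ c : ℂ, Δ i s = c • s) {x : V} (hx0 : x ≠ 0) (hx : ∀ i, Δ i x = 0) :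
    ∃ s ∈ S, s ≠ 0 ∧ ∀ i, Δ i s = 0 := by
  classical
  have htop : ⊤ ≤ Submodule.span ℂ S := fun y _ => hS y
  let b := Basis.ofSpan htop
  have hb : ∀ j, b j ∈ S := fun j => Basis.ofSpan_subset htop ⟨j, rfl⟩
  choose c hc using fun j => hΔ (b j) (hb j)
  obtain ⟨j, hj⟩ : ∃ j, b.repr x j ≠ 0 := by
    by_contra! h
    exact hx0 (b.repr.map_eq_zero_iff.mp (Finsupp.ext h))
  refine ⟨b j, hb j, b.ne_zero j, fun i => ?_⟩
  have h1 : ∀ y, b.repr (Δ i y) j = c j i * b.repr y j := fun y => by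
    have h2 : (Finsupp.lapply j ∘ₗ b.repr.toLinearMap ∘ₗ Δ i : V →ₗ[ℂ] ℂ) =
        c j i • (Finsupp.lapply j ∘ₗ b.repr.toLinearMap) := by
      refine b.ext fun k => ?_
      simp only [LinearMap.comp_apply, LinearEquiv.coe_coe, hc, map_smul, LinearMap.smul_apply,
        Basis.repr_self, Finsupp.lapply_apply, smul_eq_mul]
      by_cases hk : k = j
      · rw [hk]
      · rw [Finsupp.single_eq_of_ne (Ne.symm hk), mul_zero, mul_zero]
    exact LinearMap.congr_fun h2 y
  have h3 := h1 x
  rw [hx i, map_zero, Finsupp.zero_apply] at h3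
  rw [hc, (mul_eq_zero.mp h3.symm).resolve_right hj, zero_smul]

lemma apply_eq_zero_of_sum_adjoint {E ι : Type*} [NormedAddCommGroup E] [InnerProductSpace ℂ E]
    [FiniteDimensional ℂ E] [Fintype ι] {T : ι → Module.End ℂ E} {x : E}
    (h0 : ∑ i, LinearMap.adjoint (T i) (T i x) = 0) (i : ι) : T i x = 0 := by
  have h1 : ∑ i, inner ℂ (T i x) (T i x) = 0 := by
    rw [← inner_zero_left (𝕜 := ℂ) x, ← h0, sum_inner]
    exact Finset.sum_congr rfl fun i _ => (LinearMap.adjoint_inner_left (T i) x (T i x)).symm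
  have h2 : ∑ i, ‖T i x‖ ^ 2 = 0 := by
    simp_rw [inner_self_eq_norm_sq_to_K] at h1
    norm_cast at h1
    exact (RCLike.ofReal_eq_zero (K := ℂ)).mp h1
  rw [Finset.sum_eq_zero_iff_of_nonneg fun i _ => sq_nonneg _] at h2
  exact norm_eq_zero.mp (pow_eq_zero_iff two_ne_zero |>.mp (h2 i (Finset.mem_univ i)))

/-- The kernel of `∑ Tᵢ† Tᵢ` is the common kernel of the `Tᵢ`, since `⟨∑ Tᵢ† Tᵢ x, x⟩ = ∑ ‖Tᵢ x‖²`.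
-/
lemma ker_sumAdjointMul {V W : Type*} [AddCommGroup V] [Module ℂ V] [FiniteDimensional ℂ V]
    [AddCommGroup W] [Module ℂ W] [FiniteDimensional ℂ W] (cV : InnerProductSpace.Core ℂ V)
    (cW : InnerProductSpace.Core ℂ W) {ι : Type*} [Fintype ι]
    (T : ι → Module.End ℂ (V ⊗[ℂ] W)) (x : V ⊗[ℂ] W) :
    x ∈ LinearMap.ker (sumAdjointMul cV cW T) ↔ ∀ i, T i x = 0 := by
  let := cV.toNormedAddCommGroup
  let := InnerProductSpace.ofCore cV.toCore
  let := cW.toNormedAddCommGroup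
  let := InnerProductSpace.ofCore cW.toCore
  have h : sumAdjointMul cV cW T x = ∑ i, LinearMap.adjoint (T i) (T i x) := by
    rw [sumAdjointMul, LinearMap.sum_apply]
    rfl
  rw [LinearMap.mem_ker, h]
  constructor
  · exact fun h0 => apply_eq_zero_of_sum_adjoint h0
  · intro h0
    exact Finset.sum_eq_zero fun i _ => by rw [h0 i, map_zero]

end Kernel

section SpinModule

variable {𝔨 : Type*} [LieRing 𝔨] [LieAlgebra ℂ 𝔨] {𝔥 : LieSubalgebra ℂ 𝔨}
  {B : LinearMap.BilinForm ℂ 𝔨} {P : Finset (Dual ℂ 𝔥)} {e f : P → 𝔨}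

namespace IsRootBasis

/-- The vector `e α` of `𝔭`. -/
def posVec (hef : IsRootBasis B e f) (α : P) : nPos P × nNeg P :=
  (⟨e α, weightSpace_le_nPos α.2 (hef.mem_e α)⟩, 0)

/-- The vector `f α` of `𝔫⁻`. -/
def negVec (hef : IsRootBasis B e f) (α : P) : nNeg P :=
  ⟨f α, weightSpace_le_nNeg α.2 (hef.mem_f α)⟩

lemma span_negVec (hef : IsRootBasis B e f) (x : nNeg P) :
    x ∈ Submodule.span ℂ (Set.range hef.negVec) := by
  have h : nNeg P ≤ (Submodule.span ℂ (Set.range hef.negVec)).map (nNeg P).subtype := by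
    refine iSup₂_le fun α hα y hy => ?_
    obtain ⟨c, rfl⟩ := hef.exists_smul_f ⟨α, hα⟩ y hy
    exact Submodule.smul_mem _ _ ⟨_, Submodule.subset_span ⟨⟨α, hα⟩, rfl⟩, rfl⟩
  obtain ⟨y, hy, hyx⟩ := h x.2
  rwa [← Subtype.ext hyx]

/-- The functional `B(e α, ·)` on `𝔫⁻`. -/
def posFunctional (_ : IsRootBasis B e f) (α : P) : Dual ℂ (nNeg P) :=
  B (e α) ∘ₗ (nNeg P).subtype

lemma posFunctional_negVec [DecidableEq P] (hef : IsRootBasis B e f) (hB : IsQuadratic B)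
    (α β : P) : hef.posFunctional α (hef.negVec β) = if α = β then 1 else 0 :=
  hef.form_e_f_eq hB α β

/-- The operator on `S = ⋀ 𝔫⁻` counting the factor `f α`: contraction with `B(e α, ·)` followed by
exterior multiplication with `f α`. -/
def number (hef : IsRootBasis B e f) (α : P) : Module.End ℂ (Spin P) :=
  LinearMap.mulLeft ℂ (ExteriorAlgebra.ι ℂ (hef.negVec α)) ∘ₗ
    CliffordAlgebra.contractLeft (Q := (0 : QuadraticForm ℂ (nNeg P))) (hef.posFunctional α)

lemma contractLeft_negVec_mul [DecidableEq P] (hef : IsRootBasis B e f) (hB : IsQuadratic B)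
    (α β : P) (s : Spin P) :
    CliffordAlgebra.contractLeft (Q := (0 : QuadraticForm ℂ (nNeg P))) (hef.posFunctional α)
      (ExteriorAlgebra.ι ℂ (hef.negVec β) * s) = (if α = β then (1 : ℂ) else 0) • s -
        ExteriorAlgebra.ι ℂ (hef.negVec β) * CliffordAlgebra.contractLeft
          (Q := (0 : QuadraticForm ℂ (nNeg P))) (hef.posFunctional α) s := by
  rw [← hef.posFunctional_negVec hB]
  exact CliffordAlgebra.contractLeft_ι_mul _ _ _

lemma negVec_mul_self (hef : IsRootBasis B e f) (α : P) (s : Spin P) :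
    ExteriorAlgebra.ι ℂ (hef.negVec α) * (ExteriorAlgebra.ι ℂ (hef.negVec α) * s) = 0 := by
  rw [← mul_assoc, ExteriorAlgebra.ι_sq_zero, zero_mul]

lemma negVec_mul_comm (hef : IsRootBasis B e f) (α β : P) (s : Spin P) :
    ExteriorAlgebra.ι ℂ (hef.negVec α) * (ExteriorAlgebra.ι ℂ (hef.negVec β) * s) =
      -(ExteriorAlgebra.ι ℂ (hef.negVec β) * (ExteriorAlgebra.ι ℂ (hef.negVec α) * s)) := by
  rw [← mul_assoc, ← mul_assoc, ← neg_mul]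
  congr 1
  exact eq_neg_of_add_eq_zero_left (ExteriorAlgebra.ι_add_mul_swap _ _)

/-- `s` is a combination of terms in which exactly the factors `f α`, `α ∈ T`, occur. -/
def HasSupport (hef : IsRootBasis B e f) (T : Finset P) (s : Spin P) : Prop :=
  (∀ α ∈ T, hef.number α s = s) ∧ ∀ α ∉ T, hef.number α s = 0

/-- Multiplication with `f β` adds `β` to the support, or gives zero. -/
lemma HasSupport.mul_negVec [DecidableEq P] {hef : IsRootBasis B e f} (hB : IsQuadratic B)
    {T : Finset P} {s : Spin P} (h : hef.HasSupport T s) (β : P) :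
    (β ∈ T → ExteriorAlgebra.ι ℂ (hef.negVec β) * s = 0) ∧
      hef.HasSupport (insert β T) (ExteriorAlgebra.ι ℂ (hef.negVec β) * s) := by
  have hnum : ∀ α, α ≠ β → hef.number α (ExteriorAlgebra.ι ℂ (hef.negVec β) * s) =
      ExteriorAlgebra.ι ℂ (hef.negVec β) * hef.number α s := fun α hα => by
    change ExteriorAlgebra.ι ℂ (hef.negVec α) * CliffordAlgebra.contractLeft _ _ = _
    rw [hef.contractLeft_negVec_mul hB, if_neg hα, zero_smul, zero_sub, mul_neg,
      hef.negVec_mul_comm, neg_neg]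
    rfl
  have hself : hef.number β (ExteriorAlgebra.ι ℂ (hef.negVec β) * s) =
      ExteriorAlgebra.ι ℂ (hef.negVec β) * s := by
    change ExteriorAlgebra.ι ℂ (hef.negVec β) * CliffordAlgebra.contractLeft _ _ = _
    rw [hef.contractLeft_negVec_mul hB, if_pos rfl, one_smul, mul_sub, hef.negVec_mul_self,
      sub_zero]
  refine ⟨fun hβ => ?_, fun α hα => ?_, fun α hα => ?_⟩
  · rw [← h.1 β hβ]
    exact hef.negVec_mul_self β _
  · by_cases hαβ : α = β
    · rw [hαβ, hself]
    · rw [hnum α hαβ, h.1 α ((Finset.mem_insert.mp hα).resolve_left hαβ)]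
  · rw [Finset.mem_insert, not_or] at hα
    rw [hnum α hα.1, h.2 α hα.2, mul_zero]

lemma hasSupport_one (hef : IsRootBasis B e f) : hef.HasSupport ∅ 1 :=
  ⟨fun α h => absurd h (Finset.notMem_empty α), fun α _ => by
    change ExteriorAlgebra.ι ℂ (hef.negVec α) * CliffordAlgebra.contractLeft
      (Q := (0 : QuadraticForm ℂ (nNeg P))) (hef.posFunctional α) 1 = 0
    rw [CliffordAlgebra.contractLeft_one, mul_zero]⟩

/-- Every set of positive roots is a support: of the product of the `f α` over the set. -/
lemma exists_hasSupport (hef : IsRootBasis B e f) (hB : IsQuadratic B) (T : Finset P) :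
    ∃ s : Spin P, s ≠ 0 ∧ hef.HasSupport T s := by
  classical
  have key : ∃ s : Spin P, s ≠ 0 ∧ hef.HasSupport T s ∧ ∀ α ∉ T, CliffordAlgebra.contractLeft
      (Q := (0 : QuadraticForm ℂ (nNeg P))) (hef.posFunctional α) s = 0 := by
    induction T using Finset.induction_on with
    | empty => exact ⟨1, one_ne_zero, hef.hasSupport_one, fun α _ =>
        CliffordAlgebra.contractLeft_one (Q := (0 : QuadraticForm ℂ (nNeg P))) _⟩
    | insert β T hβ ih =>
      obtain ⟨s, hs0, hs, hc⟩ := ih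
      refine ⟨ExteriorAlgebra.ι ℂ (hef.negVec β) * s, fun h0 => hs0 ?_, (hs.mul_negVec hB β).2,
        fun α hα => ?_⟩
      · have := hef.contractLeft_negVec_mul hB β β s
        rwa [h0, map_zero, hc β hβ, mul_zero, sub_zero, if_pos rfl, one_smul, eq_comm] at this
      · rw [Finset.mem_insert, not_or] at hα
        rw [hef.contractLeft_negVec_mul hB, hc α hα.2, if_neg hα.1, mul_zero, zero_smul, sub_zero]
  obtain ⟨s, h0, h, -⟩ := key
  exact ⟨s, h0, h⟩

lemma span_hasSupport (hef : IsRootBasis B e f) (hB : IsQuadratic B) (s : Spin P) :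
    s ∈ Submodule.span ℂ {s : Spin P | ∃ T, hef.HasSupport T s} := by
  classical
  induction s using CliffordAlgebra.left_induction with
  | algebraMap c =>
    rw [Algebra.algebraMap_eq_smul_one]
    exact Submodule.smul_mem _ _ (Submodule.subset_span ⟨∅, hef.hasSupport_one⟩)
  | add a b ha hb => exact add_mem ha hb
  | ι_mul x m hx =>
    induction hef.span_negVec m using Submodule.span_induction with
    | mem m hm =>
      obtain ⟨β, rfl⟩ := hm
      induction hx using Submodule.span_induction with
      | mem s hs =>
        obtain ⟨T, hs⟩ := hs
        exact Submodule.subset_span ⟨_, (hs.mul_negVec hB β).2⟩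
      | zero => rw [mul_zero]; exact zero_mem _
      | add a b _ _ ha hb => rw [mul_add]; exact add_mem ha hb
      | smul c a _ ha => rw [mul_smul_comm]; exact Submodule.smul_mem _ _ ha
    | zero => rw [map_zero, zero_mul]; exact zero_mem _
    | add a b _ _ ha hb => rw [map_add, add_mul]; exact add_mem ha hb
    | smul c a _ ha => rw [map_smul, smul_mul_assoc]; exact Submodule.smul_mem _ _ ha

/-- The element of `Cl(𝔭)` by which `h ∈ 𝔥` acts in the spin representation. -/
def spinCartan (hef : IsRootBasis B e f) (h : 𝔥) : Cl (formP B P) :=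
  algebraMap ℂ _ (weylVector P h) - (1 / 2 : ℂ) • ∑ α : P, (α : Dual ℂ 𝔥) h •
    (cl (formP B P) (0, hef.negVec α) * cl (formP B P) (hef.posVec α))

/-- The normally ordered product of root vectors acts on `S` as twice a number operator; the factor
comes from the convention `u ↦ 2 ι_u` for the spin module. -/
lemma spinAction_number (hef : IsRootBasis B e f) (hB : IsQuadratic B)
    (hP : IsPositiveSystem 𝔥 P) (α : P) (s : Spin P) :
    spinAction hB hP (cl (formP B P) (0, hef.negVec α) * cl (formP B P) (hef.posVec α)) s =
      (2 : ℂ) • hef.number α s := by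
  rw [map_mul, Module.End.mul_apply]
  have h : ∀ m : nPos P × nNeg P, spinAction hB hP (cl (formP B P) m) = spinVector B P m :=
    fun m => CliffordAlgebra.lift_ι_apply _ _ _
  rw [h, h, spinVector_apply, spinVector_apply]
  have h1 : (B (((0 : nPos P), hef.negVec α).1 : 𝔨)) ∘ₗ (nNeg P).subtype = 0 := by
    ext x
    simp
  rw [h1, map_zero, LinearMap.zero_apply, smul_zero, zero_add]
  have h2 : ExteriorAlgebra.ι ℂ (hef.posVec α).2 = 0 := by
    rw [posVec, map_zero]
  rw [h2, zero_mul, add_zero, mul_smul_comm]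
  rfl

/-- Vectors of support `T` have weight `ρ - ∑_{α ∈ T} α`. -/
lemma spinAction_spinCartan (hef : IsRootBasis B e f) (hB : IsQuadratic B)
    (hP : IsPositiveSystem 𝔥 P) {T : Finset P} {s : Spin P} (hs : hef.HasSupport T s) (h : 𝔥) :
    spinAction hB hP (hef.spinCartan h) s =
      (weylVector P - ∑ α ∈ T, (α : Dual ℂ 𝔥)) h • s := by
  classical
  rw [spinCartan, map_sub, LinearMap.sub_apply, AlgHom.commutes, Module.algebraMap_end_apply,
    map_smul, LinearMap.smul_apply, map_sum, LinearMap.sum_apply]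
  simp_rw [map_smul, LinearMap.smul_apply, hef.spinAction_number hB hP]
  have h1 : ∑ α : P, (α : Dual ℂ 𝔥) h • (2 : ℂ) • hef.number α s =
      (2 : ℂ) • (∑ α ∈ T, (α : Dual ℂ 𝔥)) h • s := by
    rw [LinearMap.sum_apply, Finset.sum_smul, Finset.smul_sum, ← Finset.sum_subset
      (Finset.subset_univ T)]
    · exact Finset.sum_congr rfl fun α hα => by rw [hs.1 α hα, smul_comm]
    · intro α _ hα
      rw [hs.2 α hα, smul_zero, smul_zero]
  rw [h1, LinearMap.sub_apply]
  module

end IsRootBasis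

lemma weylVector_sub_mem_spinWeights (T : Finset P) :
    weylVector P - ∑ α ∈ T, (α : Dual ℂ 𝔥) ∈ spinWeights P :=
  ⟨T.map (Function.Embedding.subtype _), fun α hα => by
    obtain ⟨β, -, rfl⟩ := Finset.mem_map.mp hα
    exact β.2, by rw [Finset.sum_map]; rfl⟩

lemma exists_eq_of_mem_spinWeights {σ : Dual ℂ 𝔥} (hσ : σ ∈ spinWeights P) :
    ∃ T : Finset P, σ = weylVector P - ∑ α ∈ T, (α : Dual ℂ 𝔥) := by
  classical
  obtain ⟨T, hT, rfl⟩ := hσ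
  refine ⟨T.subtype (· ∈ P), ?_⟩
  rw [Finset.sum_subtype_of_mem (fun α => α) fun α hα => hT hα]

/-! #### The inclusion of `𝔘(𝔨) ⊗ Cl(𝔭)` -/

/-- The inclusion of `𝔭` as an isometry. -/
def polarizationIsometry (B : LinearMap.BilinForm ℂ 𝔨) (P : Finset (Dual ℂ 𝔥)) :
    LinearMap.BilinMap.toQuadraticMap (formP B P) →qᵢ LinearMap.BilinMap.toQuadraticMap B :=
  { toLinearMap := polarization P
    map_app' := fun _ => rfl }

lemma weilPInclusion_tmul (a : UniversalEnvelopingAlgebra ℂ 𝔨) (b : Cl (formP B P)) :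
    weilPInclusion B P (a ⊗ₜ b) = a ⊗ₜ CliffordAlgebra.map (polarizationIsometry B P) b := rfl

variable (L : Type*) [AddCommGroup L] [Module ℂ L] [LieRingModule 𝔨 L] [LieModule ℂ 𝔨 L] in
lemma weilPAction_tmul (hB : IsQuadratic B) (hP : IsPositiveSystem 𝔥 P)
    (a : UniversalEnvelopingAlgebra ℂ 𝔨) (b : Cl (formP B P)) (l : L) (s : Spin P) :
    weilPAction L hB hP (a ⊗ₜ b) (l ⊗ₜ s) =
      (UniversalEnvelopingAlgebra.lift ℂ (LieModule.toEnd ℂ 𝔨 L) a l) ⊗ₜ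
        (spinAction hB hP b s) := rfl

variable [FiniteDimensional ℂ 𝔨] [𝔥.IsCartanSubalgebra] {r : ℕ}

lemma polarization_injective (dec : ReductiveDecomposition 𝔨 r) (hB : IsQuadratic B)
    (hP : IsPositiveSystem 𝔥 P) : Function.Injective (polarization P) := by
  rw [← LinearMap.ker_eq_bot, LinearMap.ker_eq_bot']
  rintro ⟨x, y⟩ hxy
  have h1 : (x : 𝔨) + (y : 𝔨) = 0 := hxy
  have hx : (x : 𝔨) = 0 := by
    refine hB.nondegenerate.1 _ fun z => ?_
    refine dec.span_weightSpace_eq_top (𝔥 := 𝔥) (p := LinearMap.ker (B (x : 𝔨))) (fun h => ?_)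
      (fun α hα z hz => ?_) z
    · have : nPos P ≤ LinearMap.ker (B (h : 𝔨)) := iSup₂_le fun α hα y hy =>
        form_cartan_root dec hB h (hP.mem_roots hα).1 hy
      rw [LinearMap.mem_ker, hB.symm]
      exact this x.2
    · rw [LinearMap.mem_ker]
      rcases hP.mem_or_neg_mem dec hα with h | h
      · exact form_nPos_eq_zero hB hP x.2 (weightSpace_le_nPos h hz)
      · rw [eq_neg_of_add_eq_zero_left h1, map_neg, LinearMap.neg_apply,
          form_nNeg_eq_zero hB hP y.2 (weightSpace_le_nNeg h (by rwa [neg_neg])), neg_zero]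
  rw [hx, zero_add] at h1
  exact Prod.ext (Subtype.ext hx) (Subtype.ext h1)

/-- Uniqueness of the operators on `L ⊗ S` rests on this injectivity. -/
lemma weilPInclusion_injective (dec : ReductiveDecomposition 𝔨 r) (hB : IsQuadratic B)
    (hP : IsPositiveSystem 𝔥 P) : Function.Injective (weilPInclusion B P) := by
  have h1 : Function.Injective (CliffordAlgebra.map (polarizationIsometry B P)) :=
    cliffordMap_injective (B₁ := formP B P) (fun _ _ => hB.symm _ _) hB.symm _
      (polarization_injective dec hB hP)
  exact Module.Flat.lTensor_preserves_injective_linearMap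
    (M := UniversalEnvelopingAlgebra ℂ 𝔨)
    (CliffordAlgebra.map (polarizationIsometry B P)).toLinearMap h1

variable {J : Type*} [Fintype J] {b b' : J → 𝔥}

/-- The inclusion of `Cl(𝔭)` into `Cl(𝔨)` carries `spinCartan h` to the spin representation at `h`.
-/
lemma map_spinCartan (dec : ReductiveDecomposition 𝔨 r) (hB : IsQuadratic B)
    (hef : IsRootBasis B e f) (h : 𝔥) :
    CliffordAlgebra.map (polarizationIsometry B P) (hef.spinCartan h) =
      spinElement B (cartanWeylSystem b e f) (cartanWeylSystem b' f e) (h : 𝔨) := by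
  rw [spinElement_cartan dec hB hef, IsRootBasis.spinCartan, map_sub, map_smul, map_sum,
    AlgHom.commutes]
  simp_rw [map_smul, map_mul, CliffordAlgebra.map_apply_ι]
  have h1 : ∀ α, polarizationIsometry B P (hef.posVec α) = e α := fun α => add_zero _
  have h2 : ∀ α, polarizationIsometry B P (0, hef.negVec α) = f α := fun α => zero_add _
  simp_rw [h1, h2]

/-- The preimage of the Laplace family of a factor in `𝔘(𝔨) ⊗ Cl(𝔭)`. -/
def laplaceP (dec : ReductiveDecomposition 𝔨 r) (hB : IsQuadratic B)
    (hef : IsRootBasis B e f) (b b' : J → 𝔥) (ξ : Dual ℂ 𝔥) (i : Fin (r + 1)) : WeilP B P :=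
  (∑ j, UniversalEnvelopingAlgebra.ι ℂ (dec.proj i (cartanWeylSystem b' f e j)) *
      UniversalEnvelopingAlgebra.ι ℂ (dec.proj i (cartanWeylSystem b e f j))) ⊗ₜ[ℂ] 1 +
    algebraMap ℂ _ (factorForm dec hB i (weylVector P) (weylVector P)) +
    (2 : ℂ) • (UniversalEnvelopingAlgebra.ι ℂ (dec.projH i (sharp hB ξ) : 𝔨) ⊗ₜ[ℂ] 1 +
      1 ⊗ₜ[ℂ] hef.spinCartan (dec.projH i (sharp hB ξ))) +
    algebraMap ℂ _ (factorForm dec hB i ξ ξ)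

/-- The Laplace families lie in `𝔘(𝔨) ⊗ Cl(𝔭)`. -/
lemma weilPInclusion_laplaceP (dec : ReductiveDecomposition 𝔨 r) (hB : IsQuadratic B)
    (hP : IsPositiveSystem 𝔥 P) (hef : IsRootBasis B e f)
    (hb : ∀ h : 𝔥, ∑ j, B (h : 𝔨) (b' j) • b j = h) (ξ : Dual ℂ 𝔥) (i : Fin (r + 1)) :
    weilPInclusion B P (laplaceP dec hB hef b b' ξ i) =
      laplaceFactor dec hB (extend hB ξ) i := by
  obtain ⟨c, hc, hΔ⟩ := laplaceFactor_eq dec hB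
    (isDualSystem_cartanWeylSystem dec hB hP hef hb) i
  have hc' := spinElement_casimir dec hB hP hef hb i hc
  rw [extend, hΔ, hc', ← factorForm_eq, laplaceP, map_add, map_add, map_add, map_smul, map_add,
    AlgHom.commutes, AlgHom.commutes, weilPInclusion_tmul, weilPInclusion_tmul,
    weilPInclusion_tmul, map_one, map_spinCartan (b := b) (b' := b') dec hB, TensorProduct.sum_tmul]
  rfl

variable {L : Type*} [AddCommGroup L] [Module ℂ L] [LieRingModule 𝔨 L] [LieModule ℂ 𝔨 L]
  {Λ : Dual ℂ 𝔥}

/-- The `i`-th Laplace operator is a scalar on the tensor product of a weight vector of `L` and a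
weight vector of `S`. -/
lemma weilPAction_laplaceP (dec : ReductiveDecomposition 𝔨 r) (hB : IsQuadratic B)
    (hP : IsPositiveSystem 𝔥 P) (hef : IsRootBasis B e f)
    (hb : ∀ h : 𝔥, ∑ j, B (h : 𝔨) (b' j) • b j = h) (hL : HasHighestWeight P L Λ)
    (ξ : Dual ℂ 𝔥) (i : Fin (r + 1)) {ν : Dual ℂ 𝔥} {l : L}
    (hl : l ∈ LieModule.weightSpace L (ν : 𝔥 → ℂ)) {T : Finset P} {s : Spin P}
    (hs : hef.HasSupport T s) :
    weilPAction L hB hP (laplaceP dec hB hef b b' ξ i) (l ⊗ₜ s) =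
      (factorForm dec hB i (Λ + weylVector P) (Λ + weylVector P) +
        2 * factorForm dec hB i ξ (ν + (weylVector P - ∑ α ∈ T, (α : Dual ℂ 𝔥))) +
        factorForm dec hB i ξ ξ) • l ⊗ₜ[ℂ] s := by
  have hcas : UniversalEnvelopingAlgebra.lift ℂ (LieModule.toEnd ℂ 𝔨 L)
      (∑ j, UniversalEnvelopingAlgebra.ι ℂ (dec.proj i (cartanWeylSystem b' f e j)) *
        UniversalEnvelopingAlgebra.ι ℂ (dec.proj i (cartanWeylSystem b e f j))) l =
      (factorForm dec hB i Λ Λ + 2 * factorForm dec hB i Λ (weylVector P)) • l := by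
    rw [← casimir_apply_highestWeight dec hB hP hef hb i hL l, map_sum]
    simp_rw [map_mul, UniversalEnvelopingAlgebra.lift_ι_apply]
  have hlw : UniversalEnvelopingAlgebra.lift ℂ (LieModule.toEnd ℂ 𝔨 L)
      (UniversalEnvelopingAlgebra.ι ℂ (dec.projH i (sharp hB ξ) : 𝔨)) l =
      factorForm dec hB i ξ ν • l := by
    rw [UniversalEnvelopingAlgebra.lift_ι_apply]
    exact mem_weightSpace_iff.mp hl _
  rw [laplaceP, map_add, map_add, map_add, map_smul, map_add, AlgHom.commutes, AlgHom.commutes]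
  simp only [LinearMap.add_apply, LinearMap.smul_apply, Module.algebraMap_end_apply,
    weilPAction_tmul, map_one, Module.End.one_apply, hcas, hlw,
    hef.spinAction_spinCartan hB hP hs, TensorProduct.smul_tmul', TensorProduct.tmul_smul]
  rw [← factorForm_apply]
  simp only [map_add, LinearMap.add_apply, factorForm_symm dec hB i (weylVector P) Λ]
  simp only [← TensorProduct.smul_tmul']
  module

/-- The common kernel of the Laplace operators on `L ⊗ S` is nonzero if and only if all of them
vanish on some weight of `L ⊗ S`. -/
lemma exists_ker_iff (dec : ReductiveDecomposition 𝔨 r) (hB : IsQuadratic B)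
    (hP : IsPositiveSystem 𝔥 P) (hef : IsRootBasis B e f)
    (hb : ∀ h : 𝔥, ∑ j, B (h : 𝔨) (b' j) • b j = h) (hL : HasHighestWeight P L Λ)
    (ξ : Dual ℂ 𝔥) :
    (∃ x : L ⊗[ℂ] Spin P, x ≠ 0 ∧
      ∀ i, weilPAction L hB hP (laplaceP dec hB hef b b' ξ i) x = 0) ↔
    ∃ μ ∈ tensorSpinWeights P L, ∀ i, factorForm dec hB i (Λ + weylVector P) (Λ + weylVector P) +
      2 * factorForm dec hB i ξ μ + factorForm dec hB i ξ ξ = 0 := by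
  constructor
  · rintro ⟨x, hx0, hx⟩
    let S : Set (L ⊗[ℂ] Spin P) := {x | ∃ (ν : Dual ℂ 𝔥) (T : Finset P) (l : L) (s : Spin P),
      l ∈ LieModule.weightSpace L (ν : 𝔥 → ℂ) ∧ hef.HasSupport T s ∧ x = l ⊗ₜ s}
    have hspan : ∀ x, x ∈ Submodule.span ℂ S := fun x => by
      induction x using TensorProduct.induction_on with
      | zero => exact zero_mem _
      | add a b ha hb => exact add_mem ha hb
      | tmul l s =>
        induction mem_span_weightVectors hP dec hL l using Submodule.span_induction with
        | mem l hl =>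
          obtain ⟨ν, -, hl⟩ := hl
          induction hef.span_hasSupport hB s using Submodule.span_induction with
          | mem s hs =>
            obtain ⟨T, hs⟩ := hs
            exact Submodule.subset_span ⟨ν, T, l, s, hl, hs, rfl⟩
          | zero => rw [TensorProduct.tmul_zero]; exact zero_mem _
          | add a b _ _ ha hb => rw [TensorProduct.tmul_add]; exact add_mem ha hb
          | smul c a _ ha => rw [TensorProduct.tmul_smul]; exact Submodule.smul_mem _ _ ha
        | zero => rw [TensorProduct.zero_tmul]; exact zero_mem _
        | add a b _ _ ha hb => rw [TensorProduct.add_tmul]; exact add_mem ha hb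
        | smul c a _ ha =>
          rw [← TensorProduct.smul_tmul']
          exact Submodule.smul_mem _ _ ha
    obtain ⟨_, ⟨ν, T, l, s, hl, hs, rfl⟩, h0, hz⟩ := exists_mem_of_ker hspan
      (fun y hy i => by
        obtain ⟨ν, T, l, s, hl, hs, rfl⟩ := hy
        exact ⟨_, weilPAction_laplaceP dec hB hP hef hb hL ξ i hl hs⟩) hx0 hx
    refine ⟨ν + (weylVector P - ∑ α ∈ T, (α : Dual ℂ 𝔥)), ⟨ν, _, fun hbot => h0 ?_,
      weylVector_sub_mem_spinWeights T, rfl⟩, fun i => ?_⟩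
    · rw [hbot, LieSubmodule.mem_bot] at hl
      rw [hl, TensorProduct.zero_tmul]
    · have := hz i
      rw [weilPAction_laplaceP dec hB hP hef hb hL ξ i hl hs] at this
      exact (smul_eq_zero.mp this).resolve_right h0
  · rintro ⟨μ, ⟨ν, σ, hν, hσ, rfl⟩, hz⟩
    obtain ⟨l, hl, hl0⟩ := exists_mem_ne_zero hν
    obtain ⟨T, rfl⟩ := exists_eq_of_mem_spinWeights hσ
    obtain ⟨s, hs0, hs⟩ := hef.exists_hasSupport hB T
    refine ⟨l ⊗ₜ s, fun h => ?_, fun i => ?_⟩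
    · refine hl0 ((Module.forall_dual_apply_eq_zero_iff ℂ l).mp fun φ => ?_)
      by_contra hφ
      refine hs0 ((Module.forall_dual_apply_eq_zero_iff ℂ s).mp fun ψ => ?_)
      have h1 := congrArg (LinearMap.mul' ℂ ℂ ∘ₗ TensorProduct.map φ ψ) h
      rw [LinearMap.comp_apply, TensorProduct.map_tmul, LinearMap.mul'_apply, map_zero] at h1
      exact (mul_eq_zero.mp h1).resolve_left hφ
    · rw [weilPAction_laplaceP dec hB hP hef hb hL ξ i hl hs, hz i, zero_smul]

end SpinModule

/-! ### Zeros of the Laplace family and coadjoint orbits -/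

section Orbit

variable {𝔨 : Type*} [LieRing 𝔨] [LieAlgebra ℂ 𝔨] {𝔥 : LieSubalgebra ℂ 𝔨}
  [FiniteDimensional ℂ 𝔨] [𝔥.IsCartanSubalgebra] {r : ℕ} {B : LinearMap.BilinForm ℂ 𝔨}
  {P : Finset (Dual ℂ 𝔥)} {e f : P → 𝔨}

/-! #### The eigenvalues of a Cartan element in the adjoint representation -/

/-- A dual system whose members pair to one is a pair of bases: the trace of the identity counts
its members. -/
lemma finrank_eq_card_of_isDualSystem {V J : Type*} [AddCommGroup V] [Module ℂ V]
    [FiniteDimensional ℂ V] [Fintype J] {B : LinearMap.BilinForm ℂ V} {u v : J → V}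
    (h : IsDualSystem B u v) (h1 : ∀ j, B (u j) (v j) = 1) : Fintype.card J = finrank ℂ V := by
  have hid : (LinearMap.id : V →ₗ[ℂ] V) =
      ∑ j, dualTensorHom ℂ V V (B.flip (v j) ⊗ₜ[ℂ] u j) := by
    ext x
    rw [LinearMap.sum_apply]
    exact (h x).symm
  have h2 := LinearMap.trace_id ℂ V
  rw [hid, map_sum] at h2
  simp_rw [LinearMap.trace_eq_contract_apply, contractLeft_apply, LinearMap.BilinForm.flip_apply,
    h1] at h2
  rw [Finset.sum_const, Finset.card_univ, nsmul_eq_mul, mul_one] at h2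
  exact_mod_cast h2

/-- The eigenvalues of a Cartan element, with multiplicities. -/
lemma roots_charpoly_ad (dec : ReductiveDecomposition 𝔨 r) (hB : IsQuadratic B)
    (hP : IsPositiveSystem 𝔥 P) (y : 𝔥) :
    (LieAlgebra.ad ℂ 𝔨 (y : 𝔨)).charpoly.roots =
      (Finset.univ : Finset ((Fin (finrank ℂ 𝔥) ⊕ P) ⊕ P)).val.map
        (Sum.elim (Sum.elim (fun _ => 0) fun α : P => (α : Dual ℂ 𝔥) y)
          fun α : P => -(α : Dual ℂ 𝔥) y) := by
  classical
  obtain ⟨e, f, hef⟩ := exists_isRootBasis dec hB hP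
  obtain ⟨b, b', hb, hb1⟩ := exists_cartan_dualSystem (𝔥 := 𝔥) hB
  have hd := isDualSystem_cartanWeylSystem dec hB hP hef hb
  have hspan : ⊤ ≤ Submodule.span ℂ (Set.range (cartanWeylSystem b e f)) := fun x _ => by
    rw [← hd x]
    exact sum_mem fun j _ => Submodule.smul_mem _ _ (Submodule.subset_span ⟨j, rfl⟩)
  have hcard := finrank_eq_card_of_isDualSystem hd (by
    rintro ((j | α) | α)
    · exact hb1 j
    · exact hef.form_e_f α
    · exact (hB.symm _ _).trans (hef.form_e_f α))
  let u := basisOfTopLeSpanOfCardEqFinrank _ hspan hcard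
  let χ : (Fin (finrank ℂ 𝔥) ⊕ P) ⊕ P → ℂ :=
    Sum.elim (Sum.elim (fun _ => 0) fun α : P => (α : Dual ℂ 𝔥) y) fun α : P => -(α : Dual ℂ 𝔥) y
  have hu : ∀ j, LieAlgebra.ad ℂ 𝔨 (y : 𝔨) (u j) = χ j • u j := by
    intro j
    simp only [u, coe_basisOfTopLeSpanOfCardEqFinrank, LieAlgebra.ad_apply]
    rcases j with (j | α) | α
    · exact (dec.lie_eq_zero_of_mem_cartan y.2 (b j).2).trans (zero_smul ℂ _).symm
    · exact mem_weightSpace_iff.mp (hef.mem_e α) y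
    · exact mem_weightSpace_iff.mp (hef.mem_f α) y
  have hmat : LinearMap.toMatrix u u (LieAlgebra.ad ℂ 𝔨 (y : 𝔨)) = Matrix.diagonal χ := by
    ext i j
    rw [LinearMap.toMatrix_apply, hu, map_smul, Finsupp.smul_apply, Basis.repr_self,
      Matrix.diagonal_apply, smul_eq_mul]
    by_cases hij : i = j
    · rw [if_pos hij, hij, Finsupp.single_eq_same, mul_one]
    · rw [if_neg hij, Finsupp.single_eq_of_ne hij, mul_zero]
  rw [← LinearMap.charpoly_toMatrix _ u, hmat, Matrix.charpoly_diagonal, Polynomial.roots_prod _ _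
    (Finset.prod_ne_zero_iff.mpr fun j _ => Polynomial.X_sub_C_ne_zero _)]
  simp_rw [Polynomial.roots_X_sub_C]
  rw [Multiset.bind_singleton]

/-- The sum of the absolute values of the roots is invariant under conjugation. -/
lemma sum_abs_root_eq (dec : ReductiveDecomposition 𝔨 r) (hB : IsQuadratic B)
    (hP : IsPositiveSystem 𝔥 P) {y z : 𝔥} {g : 𝔨 ≃ₗ[ℂ] 𝔨} (hg : g ∈ adjointGroup 𝔨)
    (h : (z : 𝔨) = g y) : ∑ α : P, |((α : Dual ℂ 𝔥) z).re| = ∑ α : P, |((α : Dual ℂ 𝔥) y).re| := by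
  obtain ⟨E, hE⟩ := exists_equivariant_of_mem_adjointGroup 𝔨 hg
  have h1 : LieAlgebra.ad ℂ 𝔨 (z : 𝔨) = E.conj (LieAlgebra.ad ℂ 𝔨 (y : 𝔨)) := by
    ext x
    rw [LinearEquiv.conj_apply_apply, LieAlgebra.ad_apply, LieAlgebra.ad_apply, ← hE, ← h,
      LinearEquiv.apply_symm_apply]
  have h2 := congrArg (fun p => (p.roots.map fun c : ℂ => |c.re|).sum)
    (LinearEquiv.charpoly_conj E (LieAlgebra.ad ℂ 𝔨 (y : 𝔨)))
  simp only [← h1, roots_charpoly_ad dec hB hP, Multiset.map_map] at h2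
  have h3 : ∀ x : 𝔥, (Multiset.map ((fun c : ℂ => |c.re|) ∘
      (Sum.elim (Sum.elim (fun _ => 0) fun α : P => (α : Dual ℂ 𝔥) x)
          fun α : P => -(α : Dual ℂ 𝔥) x))
      (Finset.univ : Finset ((Fin (finrank ℂ 𝔥) ⊕ P) ⊕ P)).val).sum =
      2 * ∑ α : P, |((α : Dual ℂ 𝔥) x).re| := fun x => by
    change ∑ j, _ = _
    rw [Fintype.sum_sum_type, Fintype.sum_sum_type]
    simp [two_mul]
  rw [h3, h3] at h2
  linarith

/-! #### The centre -/

lemma root_projH_zero (dec : ReductiveDecomposition 𝔨 r) {α : Dual ℂ 𝔥} (hα : α ∈ roots 𝔥 𝔨)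
    (h : 𝔥) : α (dec.projH 0 h) = 0 := by
  obtain ⟨k, hk, -⟩ := dec.exists_factor hα
  rw [hk, dec.projH_projH_of_ne (Fin.succ_ne_zero k), map_zero]

lemma posCone_projH_zero (dec : ReductiveDecomposition 𝔨 r) (hP : IsPositiveSystem 𝔥 P)
    {η : Dual ℂ 𝔥} (hη : η ∈ posCone P) (h : 𝔥) : η (dec.projH 0 h) = 0 := by
  induction hη using AddSubmonoid.closure_induction with
  | mem α hα => exact root_projH_zero dec (hP.mem_roots hα) h
  | zero => rfl
  | add a b _ _ ha hb => rw [LinearMap.add_apply, ha, hb, add_zero]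

/-- On a centre of dimension at most one the form is anisotropic. -/
lemma apply_projH_zero_of_factorForm (dec : ReductiveDecomposition 𝔨 r) (hB : IsQuadratic B)
    (hZ : ∀ z ∈ LieAlgebra.center ℂ 𝔨, ∀ w ∈ LieAlgebra.center ℂ 𝔨, z ≠ 0 → ∃ c : ℂ, w = c • z)
    {η : Dual ℂ 𝔥} (hη : factorForm dec hB 0 η η = 0) (x : 𝔥) : η (dec.projH 0 x) = 0 := by
  rw [← form_sharp hB, dec.coe_projH, ← dec.form_proj_left hB, dec.form_proj hB]
  rw [factorForm_eq] at hη
  have hmem : ∀ y, dec.proj 0 y ∈ LieAlgebra.center ℂ 𝔨 := fun y => by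
    rw [← dec.ideal_zero]
    exact dec.proj_mem 0 y
  by_cases h0 : dec.proj 0 (sharp hB η : 𝔨) = 0
  · rw [h0, map_zero, LinearMap.zero_apply]
  · obtain ⟨c, hc⟩ := hZ _ (hmem _) _ (hmem (x : 𝔨)) h0
    rw [hc, map_smul, hη, smul_zero]

variable {L : Type*} [AddCommGroup L] [Module ℂ L] [LieRingModule 𝔨 L] [LieModule ℂ 𝔨 L]
  {Λ : Dual ℂ 𝔥}

/-- The central character of `L ⊗ S`: all its weights agree with `Λ + ρ` on the centre. -/
lemma apply_projH_zero_of_mem_tensorSpinWeights (dec : ReductiveDecomposition 𝔨 r)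
    (hP : IsPositiveSystem 𝔥 P) (hL : HasHighestWeight P L Λ) {μ : Dual ℂ 𝔥}
    (hμ : μ ∈ tensorSpinWeights P L) (x : 𝔥) :
    (Λ + weylVector P) (dec.projH 0 x) = μ (dec.projH 0 x) := by
  rw [← sub_eq_zero, ← LinearMap.sub_apply]
  exact posCone_projH_zero dec hP (sub_mem_posCone_of_mem_tensorSpinWeights hP dec hL hμ) x

/-! #### Zeros of the Laplace family -/

variable [FiniteDimensional ℂ L]

/-- If all Laplace operators vanish on a weight `μ` of `L ⊗ S`, then `ξ = -μ` and `μ` has the length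
of `Λ + ρ`: the operators of the simple factors give
`|Λ + ρ|² - |μ|² + |ξ + μ|² = 0`, where `|Λ + ρ| ≥ |μ|`. -/
lemma eq_neg_of_laplace_zero (dec : ReductiveDecomposition 𝔨 r) (hB : IsQuadratic B)
    (hP : IsPositiveSystem 𝔥 P)
    (hZ : ∀ z ∈ LieAlgebra.center ℂ 𝔨, ∀ w ∈ LieAlgebra.center ℂ 𝔨, z ≠ 0 → ∃ c : ℂ, w = c • z)
    (hL : HasHighestWeight P L Λ) {ξ μ : Dual ℂ 𝔥} (hξ : ξ ∈ realWeights 𝔥)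
    (hμ : μ ∈ tensorSpinWeights P L)
    (h : ∀ i, factorForm dec hB i (Λ + weylVector P) (Λ + weylVector P) +
      2 * factorForm dec hB i ξ μ + factorForm dec hB i ξ ξ = 0) :
    ξ = -μ ∧ rootForm dec hB μ μ =
      rootForm dec hB (Λ + weylVector P) (Λ + weylVector P) := by
  obtain ⟨l, hl⟩ : ∃ l, l = Λ + weylVector P := ⟨_, rfl⟩
  have hle := (rootForm_le_of_mem_tensorSpinWeights dec hB hP hL hμ).1
  have hz := apply_projH_zero_of_mem_tensorSpinWeights dec hP hL hμ
  rw [← hl] at h hle hz ⊢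
  have h1 : rootForm dec hB l l + 2 * rootForm dec hB ξ μ + rootForm dec hB ξ ξ = 0 := by
    have h2 : l (killingSharp dec hB l) + 2 * μ (killingSharp dec hB ξ) +
        ξ (killingSharp dec hB ξ) = 0 := by
      rw [apply_killingSharp, apply_killingSharp, apply_killingSharp, Finset.mul_sum,
        ← Finset.sum_add_distrib, ← Finset.sum_add_distrib]
      refine Finset.sum_eq_zero fun i _ => ?_
      linear_combination (killingScale dec hB i)⁻¹ * h i.succ
    have h3 := congrArg Complex.re h2
    simp only [Complex.add_re, Complex.mul_re, Complex.re_ofNat, Complex.im_ofNat, zero_mul,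
      sub_zero, Complex.zero_re] at h3
    exact h3
  have h4 : rootForm dec hB (ξ + μ) (ξ + μ) =
      rootForm dec hB ξ ξ + 2 * rootForm dec hB ξ μ + rootForm dec hB μ μ := by
    simp only [map_add, LinearMap.add_apply, rootForm_symm dec hB μ ξ]
    ring
  obtain ⟨h5, h6⟩ := rootForm_self dec hB
    (add_mem hξ (tensorSpinWeights_subset_realWeights hP hμ))
  refine ⟨?_, by linarith⟩
  have h7 := h6 (by linarith)
  have h8 : factorForm dec hB 0 (ξ + l) (ξ + l) = 0 := by
    have h9 : factorForm dec hB 0 ξ μ = factorForm dec hB 0 ξ l := (hz _).symm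
    have h10 := h 0
    rw [h9] at h10
    simp only [map_add, LinearMap.add_apply, factorForm_symm dec hB 0 l ξ]
    linear_combination h10
  have h11 := apply_projH_zero_of_factorForm dec hB hZ h8
  refine eq_neg_of_add_eq_zero_left (LinearMap.ext fun x => ?_)
  have h12 := h7 x
  have h13 := h11 x
  rw [LinearMap.add_apply, hz, ← LinearMap.add_apply] at h13
  rw [map_sub, h13, sub_zero] at h12
  exact h12

/-- A real functional conjugate to `Λ + ρ` is a weight of `L ⊗ S`. Conjugation preserves the
eigenvalues on `L` and on `𝔨`, so some weight `μ` of `L ⊗ S` satisfies `⟨μ, η⟩ ≥ |Λ + ρ|²`, while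
neither `μ` nor `η` is longer than `Λ + ρ`. -/
lemma mem_tensorSpinWeights_of_mem_coadjointOrbit (dec : ReductiveDecomposition 𝔨 r)
    (hB : IsQuadratic B) (hP : IsPositiveSystem 𝔥 P) (hL : HasHighestWeight P L Λ) {η : Dual ℂ 𝔥}
    (hη : η ∈ realWeights 𝔥)
    (h : extend hB η ∈ coadjointOrbit (extend hB (Λ + weylVector P))) :
    η ∈ tensorSpinWeights P L := by
  classical
  have hηl := rootForm_of_mem_coadjointOrbit dec hB h
  obtain ⟨g, hg, hs⟩ := (extend_mem_coadjointOrbit_iff hB).mp h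
  let y := killingSharp dec hB η
  let y₀ := killingSharp dec hB (Λ + weylVector P)
  have hsum : ∀ ζ : Dual ℂ 𝔥, ((killingSharp dec hB ζ : 𝔥) : 𝔨) =
      ∑ i : Fin r, (killingScale dec hB i)⁻¹ • dec.proj i.succ (sharp hB ζ : 𝔨) := fun ζ => by
    rw [killingSharp_apply]
    exact map_sum 𝔥.toSubmodule.subtype _ _
  have hy : (y : 𝔨) = g y₀ := by
    change (killingSharp dec hB η : 𝔨) = g (killingSharp dec hB (Λ + weylVector P) : 𝔨)
    rw [hsum, hsum, map_sum, hs]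
    refine Finset.sum_congr rfl fun i _ => ?_
    rw [map_smul, proj_apply_of_mem_adjointGroup dec _ hg]
  -- `Λ(y₀)` is an eigenvalue of `y` on `L`, hence of the form `ν(y)`
  obtain ⟨ν, hν, hνy⟩ : ∃ ν : Dual ℂ 𝔥, LieModule.weightSpace L (ν : 𝔥 → ℂ) ≠ ⊥ ∧
      ν y = Λ y₀ := by
    obtain ⟨E, hE⟩ := exists_equivariant_of_mem_adjointGroup L hg
    obtain ⟨v, hv, hv0⟩ := exists_mem_ne_zero (weightSpace_highestWeight_ne_bot hL)
    obtain ⟨w, ⟨ν, -, hw⟩, hw0, hz⟩ := exists_mem_of_ker (ι := Unit)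
      (Δ := fun _ => LieModule.toEnd ℂ 𝔨 L y - Λ y₀ • 1) (mem_span_weightVectors hP dec hL)
      (fun w hw _ => by
        obtain ⟨ν, -, hw⟩ := hw
        refine ⟨ν y - Λ y₀, ?_⟩
        rw [LinearMap.sub_apply, LieModule.toEnd_apply_apply, mem_weightSpace_iff.mp hw, sub_smul]
        rfl)
      (x := E v) (fun h0 => hv0 (E.map_eq_zero_iff.mp h0)) (fun _ => by
        rw [LinearMap.sub_apply, LieModule.toEnd_apply_apply, hy, hE, mem_weightSpace_iff.mp hv,
          map_smul]
        exact sub_self _)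
    refine ⟨ν, fun hbot => hw0 ?_, ?_⟩
    · rwa [hbot, LieSubmodule.mem_bot] at hw
    · have := hz ()
      rw [LinearMap.sub_apply, LieModule.toEnd_apply_apply, mem_weightSpace_iff.mp hw,
        LinearMap.smul_apply, Module.End.one_apply, ← sub_smul] at this
      exact sub_eq_zero.mp ((smul_eq_zero.mp this).resolve_right hw0)
  -- the half sum of the roots that are nonnegative on `y`
  let ε : Dual ℂ 𝔥 → ℂ := fun β => if 0 ≤ (β y).re then 1 else -1
  let σ : Dual ℂ 𝔥 := (1 / 2 : ℂ) • ∑ β ∈ P, ε β • β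
  have hσ : σ ∈ spinWeights P := half_sum_mem_spinWeights fun β _ => by
    simp only [ε]
    split_ifs <;> simp
  have hσy : (σ y).re = 1 / 2 * ∑ α : P, |((α : Dual ℂ 𝔥) y).re| := by
    have h1 : σ y = ((1 / 2 : ℝ) : ℂ) * ∑ β ∈ P, ε β * β y := by
      simp only [σ, LinearMap.smul_apply, LinearMap.sum_apply, smul_eq_mul]
      push_cast
      rfl
    rw [h1, Complex.re_ofReal_mul, Complex.re_sum, Finset.sum_coe_sort P fun α => |(α y).re|]
    congr 1
    refine Finset.sum_congr rfl fun β _ => ?_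
    simp only [ε]
    split_ifs with hpos
    · rw [one_mul, abs_of_nonneg hpos]
    · rw [neg_one_mul, Complex.neg_re, abs_of_neg (not_le.mp hpos)]
  have hρ : (weylVector P y₀).re ≤ 1 / 2 * ∑ α : P, |((α : Dual ℂ 𝔥) y₀).re| := by
    have h1 : weylVector P y₀ = ((1 / 2 : ℝ) : ℂ) * ∑ β ∈ P, β y₀ := by
      simp only [weylVector, LinearMap.smul_apply, LinearMap.sum_apply, smul_eq_mul]
      push_cast
      rfl
    rw [h1, Complex.re_ofReal_mul, Complex.re_sum, Finset.sum_coe_sort P fun α => |(α y₀).re|]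
    exact mul_le_mul_of_nonneg_left (Finset.sum_le_sum fun β _ => le_abs_self _) (by norm_num)
  have hμ : ν + σ ∈ tensorSpinWeights P L := ⟨ν, σ, hν, hσ, rfl⟩
  have h1 : rootForm dec hB (Λ + weylVector P) (Λ + weylVector P) ≤
      rootForm dec hB η (ν + σ) := by
    rw [rootForm_apply, rootForm_apply, LinearMap.add_apply, LinearMap.add_apply, Complex.add_re,
      Complex.add_re]
    change (Λ y₀).re + (weylVector P y₀).re ≤ (ν y).re + (σ y).re
    rw [hνy, hσy, sum_abs_root_eq dec hB hP hg hy]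
    linarith
  have h2 := (rootForm_le_of_mem_tensorSpinWeights dec hB hP hL hμ).1
  obtain ⟨μ, hμ'⟩ : ∃ μ, μ = ν + σ := ⟨_, rfl⟩
  rw [← hμ'] at hμ h1 h2
  obtain ⟨h3, h4⟩ := rootForm_self dec hB
    (sub_mem (tensorSpinWeights_subset_realWeights hP hμ) hη)
  have h5 : rootForm dec hB (μ - η) (μ - η) =
      rootForm dec hB μ μ - 2 * rootForm dec hB η μ + rootForm dec hB η η := by
    simp only [map_sub, LinearMap.sub_apply, rootForm_symm dec hB μ η]
    ring
  have h6 := h4 (by linarith)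
  -- on the centre `η` and `Λ + ρ` agree because the adjoint group fixes the centre
  have h7 : ∀ x : 𝔥, η (dec.projH 0 x) = μ (dec.projH 0 x) := fun x => by
    rw [← apply_projH_zero_of_mem_tensorSpinWeights dec hP hL hμ, ← form_sharp hB,
      ← form_sharp hB, dec.coe_projH, ← dec.form_proj_left hB, ← dec.form_proj_left hB, hs,
      proj_apply_of_mem_adjointGroup dec 0 hg, apply_of_mem_center _ hg]
    rw [← dec.ideal_zero]
    exact dec.proj_mem 0 _
  have h8 : μ = η := by
    refine sub_eq_zero.mp (LinearMap.ext fun x => ?_)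
    have h9 := h6 x
    rw [map_sub, LinearMap.sub_apply μ η (dec.projH 0 x), h7, sub_self, sub_zero] at h9
    exact h9
  rwa [← h8]

end Orbit

end DiracFamily

end

theorem mainTheorem2
    {𝔤₀ 𝔤₁ : Type*} [LieRing 𝔤₀] [LieAlgebra ℂ 𝔤₀] [FiniteDimensional ℂ 𝔤₀]
    [AddCommGroup 𝔤₁] [Module ℂ 𝔤₁] [LieRingModule 𝔤₀ 𝔤₁] [LieModule ℂ 𝔤₀ 𝔤₁]
    [FiniteDimensional ℂ 𝔤₁] [Nontrivial 𝔤₁]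
    (𝔤 : DiracFamily.LieSuperalgebra 𝔤₀ 𝔤₁) (h𝔤 : 𝔤.IsClassical) (B : 𝔤.InvariantForm)
    {r : ℕ} (dec : DiracFamily.ReductiveDecomposition 𝔤₀ r)
    (𝔥 : LieSubalgebra ℂ 𝔤₀) [𝔥.IsCartanSubalgebra]
    (P : Finset (Module.Dual ℂ 𝔥)) (hP : DiracFamily.IsPositiveSystem 𝔥 P)
    {L : Type*} [AddCommGroup L] [Module ℂ L] [LieRingModule 𝔤₀ L] [LieModule ℂ 𝔤₀ L]
    [FiniteDimensional ℂ L] [LieModule.IsIrreducible ℂ 𝔤₀ L]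
    (Λ : Module.Dual ℂ 𝔥) (hΛ : Λ ∈ DiracFamily.realRootSpan 𝔥 𝔤₁)
    (hL : DiracFamily.HasHighestWeight P L Λ)
    (innerL : InnerProductSpace.Core ℂ L)
    (innerS : InnerProductSpace.Core ℂ (DiracFamily.Spin P))
    (ξ : Module.Dual ℂ 𝔥) (hξ : ξ ∈ DiracFamily.realRootSpan 𝔥 𝔤₁) :
    -- the factorwise Laplace families act on `L ⊗ S` by well-defined operators `Δ i`
    ∃ Δ : Fin (r + 1) → Module.End ℂ (L ⊗[ℂ] DiracFamily.Spin P),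
      (∀ i, DiracFamily.ActsAs B.even_quadratic hP (DiracFamily.laplaceFactor dec B.even_quadratic
        (DiracFamily.extend B.even_quadratic ξ) i) (Δ i)) ∧
      (∀ Δ' : Fin (r + 1) → Module.End ℂ (L ⊗[ℂ] DiracFamily.Spin P),
        (∀ i, DiracFamily.ActsAs B.even_quadratic hP (DiracFamily.laplaceFactor dec B.even_quadratic
          (DiracFamily.extend B.even_quadratic ξ) i) (Δ' i)) → Δ' = Δ) ∧
      -- for antidominant `ξ` the kernel is trivial unless `ξ = -Λ - ρ`
      (DiracFamily.IsAntidominant B.even_quadratic P ξ → ξ ≠ -Λ - DiracFamily.weylVector P →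
        LinearMap.ker (DiracFamily.sumAdjointMul innerL innerS Δ) = ⊥) ∧
      -- for every `ξ` the kernel is nonzero iff `ξ` lies in the coadjoint orbit of `-Λ - ρ`
      (LinearMap.ker (DiracFamily.sumAdjointMul innerL innerS Δ) ≠ ⊥ ↔
        DiracFamily.extend B.even_quadratic ξ ∈ DiracFamily.coadjointOrbit
          (DiracFamily.extend B.even_quadratic (-Λ - DiracFamily.weylVector P))) := by
  have hB := B.even_quadratic
  have hZ : ∀ z ∈ LieAlgebra.center ℂ 𝔤₀, ∀ w ∈ LieAlgebra.center ℂ 𝔤₀, z ≠ 0 →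
      ∃ c : ℂ, w = c • z := fun z hz w hw hz0 =>
    DiracFamily.exists_smul_of_mem_center 𝔤 h𝔤 hz hw hz0
  have hξr := DiracFamily.realRootSpan_le_realWeights 𝔤₁ hξ
  obtain ⟨e, f, hef⟩ := DiracFamily.exists_isRootBasis dec hB hP
  obtain ⟨b, b', hb, -⟩ := DiracFamily.exists_cartan_dualSystem (𝔥 := 𝔥) hB
  let d := DiracFamily.laplaceP dec hB hef b b' ξ
  let Δ : Fin (r + 1) → Module.End ℂ (L ⊗[ℂ] DiracFamily.Spin P) :=
    fun i => DiracFamily.weilPAction L hB hP (d i)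
  have hd := DiracFamily.weilPInclusion_laplaceP dec hB hP hef hb ξ
  have hker : LinearMap.ker (DiracFamily.sumAdjointMul innerL innerS Δ) ≠ ⊥ ↔
      ∃ μ ∈ DiracFamily.tensorSpinWeights P L, ∀ i,
        DiracFamily.factorForm dec hB i (Λ + DiracFamily.weylVector P)
          (Λ + DiracFamily.weylVector P) + 2 * DiracFamily.factorForm dec hB i ξ μ +
          DiracFamily.factorForm dec hB i ξ ξ = 0 := by
    rw [← DiracFamily.exists_ker_iff dec hB hP hef hb hL ξ, Submodule.ne_bot_iff]
    refine exists_congr fun x => ?_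
    rw [DiracFamily.ker_sumAdjointMul, and_comm]
  have hneg : -Λ - DiracFamily.weylVector P = -(Λ + DiracFamily.weylVector P) := (neg_add' _ _).symm
  refine ⟨Δ, fun i => ⟨d i, hd i, rfl⟩, fun Δ' hΔ' => funext fun i => ?_, fun hanti hne => ?_, ?_⟩
  · obtain ⟨d', hd', h⟩ := hΔ' i
    rw [← h, DiracFamily.weilPInclusion_injective dec hB hP (hd'.trans (hd i).symm)]
  · by_contra hcon
    obtain ⟨μ, hμ, hz⟩ := hker.mp hcon
    obtain ⟨h1, h2⟩ := DiracFamily.eq_neg_of_laplace_zero dec hB hP hZ hL hξr hμ hz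
    have hdom : DiracFamily.IsDominant P μ := fun α hα t e f h => by
      have h3 := hanti.apply_coroot_nonpos hα h
      rw [h1, LinearMap.neg_apply, Complex.neg_re] at h3
      linarith
    exact hne (by rw [hneg, h1, (hdom.rootForm_le dec hB hP hL hμ).2 h2])
  · rw [hker, hneg]
    constructor
    · rintro ⟨μ, hμ, hz⟩
      obtain ⟨h1, h2⟩ := DiracFamily.eq_neg_of_laplace_zero dec hB hP hZ hL hξr hμ hz
      rw [h1]
      exact DiracFamily.extend_neg_mem_coadjointOrbit hB
        ((DiracFamily.rootForm_le_of_mem_tensorSpinWeights dec hB hP hL hμ).2 h2)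
    · intro h
      have h1 := DiracFamily.extend_neg_mem_coadjointOrbit hB h
      rw [neg_neg] at h1
      refine ⟨-ξ, DiracFamily.mem_tensorSpinWeights_of_mem_coadjointOrbit dec hB hP hL
        (neg_mem hξr) h1, fun i => ?_⟩
      -- at `μ = -ξ` the operator is `(Λ + ρ, Λ + ρ)ᵢ - (ξ, ξ)ᵢ`
      rw [← DiracFamily.factorForm_of_mem_coadjointOrbit dec hB i h1]
      simp only [map_neg, LinearMap.neg_apply]
      ring
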